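/- Let $v_1,\dots,v_n$ be distinct points of the unit sphere $S^2\subset\mathbb{R}^3$, let $V=\{v_1,\dots,v_n\}$, and let $g_0$ be the round metric of $S^2$. Definitions. For $v\in S^2$ and $\theta>0$ let $C_{v,\theta}=dr^2+(\theta/2\pi)^2\sin^2 r\,d\varphi^2$ on $S^2\setminus\{\pm v\}$, where $r$ is the distance to $v$ and $\varphi\in\mathbb{R}/2\pi\mathbb{Z}$ is the azimuth around $v$. A smooth one-parameter family $(g_t)_{t\in[0,T]}$ of spherical cone metrics on an open set $U\subset S^2$, with cone angles $\theta_i(t)>0$ at the points $v_i\in U$, is a family of Riemannian metrics on $U\setminus V$ such that * every point of $U\setminus V$ has a neighbourhood on which $g_t=D_t^*g_0$ for all $t\in[0,T]$, with maps $D_t$ to $S^2$ depending smoothly on $(t,x)$; * every $v_i\in U$ has a punctured neighbourhood on which $g_t=\varphi_t^*C_{v_i,\theta_i(t)}$ for all $t\in[0,T]$, with injective maps $\varphi_t$ to $S^2\setminus\{\pm v_i\}$ depending smoothly on $(t,x)$, such that $\varphi_t(x)$ and $\partial_t\varphi_t(x)$ extend continuously in $(t,x)$ to $x=v_i$ by the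 values $v_i$ and $0$. A first-order deformation of $S^2$ as a cone-manifold, with cone points at the $v_i$ and first-order variations of the cone angles $\tau_i\in\mathbb{R}$, is a field $h$ of bilinear forms on the tangent planes of $S^2\setminus V$ such that every point of $S^2$ has an open neighbourhood $U$ on which $h=\frac{d}{dt}\big|_{t=0}g_t$ for some such family $(g_t)_{t\in[0,T]}$, $T>0$, on $U$ that starts at the round metric $g_0$, with $\theta_i(0)=2\pi$ and $\theta_i'(0)=\tau_i$ for all $v_i\in U$. A deformation is trivial if it equals the Lie derivative $L_Xg_0$ on $S^2\setminus V$ for some continuous tangent vector field $X$ on $S^2$ that is smooth on $S^2\setminus V$. Theorem. 1. Let $(g_t)_{t\in[0,1]}$ be a smooth one-parameter family of spherical cone metrics on $S^2$ with cone points $v_1,\dots,v_n$ and cone angles $\theta_i(t)$, starting at the round metric $g_0$, with $\theta_i(0)=2\pi$ for all $i$. Then each $\theta_i$ is differentiable at $0$, and $$\sum_{i=1}^n\theta_i'(0)\,v_i=0\quad\text{in }\mathbb{R}^3.$$ 2. Conversely, let $\tau_1,\dots,\tau_n\in\mathbb{R}$ satisfy $\sum_{i=1}^n\tau_iv_i=0$.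 Then there is a first-order deformation of $S^2$ as a cone-manifold with cone points at the $v_i$ and first-order variations of the cone angles $\tau_i$, and it is unique up to trivial deformations: the difference of any two such deformations is trivial. -/

import Mathlib

open Set Filter Topology
open scoped ContDiff RealInnerProductSpace

noncomputable section

/-- The Euclidean space `ℝ³`. -/
abbrev E3 : Type := EuclideanSpace ℝ (Fin 3)

/-- The unit sphere `S² ⊂ ℝ³`. The tangent plane of `S²` at `x` is `{u | ⟪x, u⟫ = 0}`. A tensor field
of type `(0, 2)` on a part of `S²` is written as a function `g : E3 → E3 → E3 → ℝ`, whose value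
`g x u w` matters only for `x` in that part and `u`, `w` tangent to `S²` at `x`. The round metric is
`⟪u, w⟫`. Maps and vector fields on a part of `S²` are smooth when they are restrictions of smooth
maps on an open subset of `ℝ³`; derivatives are then only taken in directions tangent to `S²`. -/
abbrev S2 : Set E3 := Metric.sphere (0 : E3) 1

/-- The spherical cone metric of angle `θ` with apex `v`, on `S² \ {v, -v}`:
`dr² + (θ / 2π)² sin² r dφ²`, where `r = arccos ⟪v, x⟫` is the distance to `v` and `φ ∈ ℝ / 2πℤ` is the
azimuth around `v`. Here `dr² = ⟪v, u⟫ ⟪v, w⟫ / (1 - ⟪v, x⟫²)`, and `sin² r dφ²` is the round metric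
minus `dr²`. -/
def coneMetric (v : E3) (θ : ℝ) (x u w : E3) : ℝ :=
  ⟪v, u⟫ * ⟪v, w⟫ / (1 - ⟪v, x⟫ ^ 2) +
    (θ / (2 * Real.pi)) ^ 2 * (⟪u, w⟫ - ⟪v, u⟫ * ⟪v, w⟫ / (1 - ⟪v, x⟫ ^ 2))

/-- `g t`, for `t ∈ [0, T]`, is a smooth one-parameter family of spherical cone metrics on the part
`U ∩ S²` of the sphere, with cone points the `v i` in `U`, of cone angles `θ i t`. -/
structure IsConeFamilyOn {ι : Type*} (U : Set E3) (T : ℝ) (v : ι → E3) (θ : ι → ℝ → ℝ)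
    (g : ℝ → E3 → E3 → E3 → ℝ) : Prop where
  /-- `g t` is positive definite away from the cone points. -/
  pos : ∀ t ∈ Icc 0 T, ∀ x ∈ S2 ∩ U, x ∉ range v → ∀ u, ⟪x, u⟫ = 0 → u ≠ 0 → 0 < g t x u u
  /-- Away from the cone points, `g t` is locally the pull-back of the round metric by a map
  `D t` to `S²` which is smooth in `(t, x)`. -/
  regular : ∀ p ∈ S2 ∩ U, p ∉ range v →
    ∃ (W : Set E3) (D : ℝ → E3 → E3), IsOpen W ∧ p ∈ W ∧
      ContDiffOn ℝ ∞ (fun q : ℝ × E3 => D q.1 q.2) (Icc 0 T ×ˢ W) ∧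
      (∀ t ∈ Icc 0 T, MapsTo (D t) (W ∩ S2) S2) ∧
      ∀ t ∈ Icc 0 T, ∀ x ∈ W ∩ S2, ∀ u w, ⟪x, u⟫ = 0 → ⟪x, w⟫ = 0 →
        g t x u w = ⟪fderiv ℝ (D t) x u, fderiv ℝ (D t) x w⟫
  /-- On a punctured neighbourhood `W ∩ S²` of `v i` in `S²`, `g t` is the pull-back of the cone
  metric of angle `θ i t` with apex `v i` by an injective map `φ t`. The map `φ t` fixes `v i` by
  continuity, is smooth in `(t, x)` away from `v i`, and it and its `t`-derivative are continuous
  in `(t, x)` up to `v i`. (No smoothness in `x` at `v i` is asked for.) -/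
  cone : ∀ i, v i ∈ U → (∀ t ∈ Icc 0 T, 0 < θ i t) ∧
    ∃ (W : Set E3) (φ : ℝ → E3 → E3), IsOpen W ∧ W ∈ 𝓝[S2 \ {v i}] (v i) ∧
      ContDiffOn ℝ ∞ (fun q : ℝ × E3 => φ q.1 q.2) (Icc 0 T ×ˢ W) ∧
      (∀ t ∈ Icc 0 T, MapsTo (φ t) (W ∩ S2) (S2 \ {v i, -v i}) ∧ InjOn (φ t) (W ∩ S2)) ∧
      (∀ t ∈ Icc 0 T,
        Tendsto (fun q : ℝ × E3 => φ q.1 q.2) (𝓝[Icc 0 T ×ˢ (W ∩ S2)] (t, v i)) (𝓝 (v i)) ∧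
        Tendsto (fun q : ℝ × E3 => derivWithin (fun s => φ s q.2) (Icc 0 T) q.1)
          (𝓝[Icc 0 T ×ˢ (W ∩ S2)] (t, v i)) (𝓝 0)) ∧
      ∀ t ∈ Icc 0 T, ∀ x ∈ W ∩ S2, ∀ u w, ⟪x, u⟫ = 0 → ⟪x, w⟫ = 0 →
        g t x u w =
          coneMetric (v i) (θ i t) (φ t x) (fderiv ℝ (φ t) x u) (fderiv ℝ (φ t) x w)

/-- The family starts, on `U ∩ S²`, at the round metric; in particular with cone angles `2π`. -/
def StartsRound {ι : Type*} (U : Set E3) (v : ι → E3) (θ : ι → ℝ → ℝ)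
    (g : ℝ → E3 → E3 → E3 → ℝ) : Prop :=
  (∀ x ∈ S2 ∩ U, x ∉ range v → ∀ u w, ⟪x, u⟫ = 0 → ⟪x, w⟫ = 0 → g 0 x u w = ⟪u, w⟫) ∧
    ∀ i, v i ∈ U → θ i 0 = 2 * Real.pi

/-- The tensor field `h` on `S² \ {v i}` is a first-order deformation of the round sphere as a
cone-manifold, with cone points at the `v i` and first-order variations `τ i` of the cone angles:
near every point of `S²` (the `v i` included), `h` is the derivative at `t = 0` of a smooth family
of spherical cone metrics which starts at the round metric, and whose cone angles have derivatives
`τ i` at `t = 0`. -/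
def IsFirstOrderConeDeformation {ι : Type*} (v : ι → E3) (τ : ι → ℝ) (h : E3 → E3 → E3 → ℝ) :
    Prop :=
  ∀ p ∈ S2, ∃ (U : Set E3) (T : ℝ) (θ : ι → ℝ → ℝ) (g : ℝ → E3 → E3 → E3 → ℝ),
    IsOpen U ∧ p ∈ U ∧ 0 < T ∧ IsConeFamilyOn U T v θ g ∧ StartsRound U v θ g ∧
      (∀ i, v i ∈ U → HasDerivWithinAt (θ i) (τ i) (Icc 0 T) 0) ∧
      ∀ x ∈ S2 ∩ U, x ∉ range v → ∀ u w, ⟪x, u⟫ = 0 → ⟪x, w⟫ = 0 →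
        HasDerivWithinAt (fun t => g t x u w) (h x u w) (Icc 0 T) 0

/-- Trivial deformations: `h` is the Lie derivative of the round metric along a continuous tangent
vector field `X` of `S²` which is smooth away from the points `v i`,
`(L_X g₀)(u, w) = ⟪D_u X, w⟫ + ⟪u, D_w X⟫`. -/
def IsTrivialDeformation {ι : Type*} (v : ι → E3) (h : E3 → E3 → E3 → ℝ) : Prop :=
  ∃ (X : E3 → E3) (W : Set E3), IsOpen W ∧ S2 \ range v ⊆ W ∧ ContDiffOn ℝ ∞ X W ∧
    ContinuousOn X S2 ∧ (∀ x ∈ S2, ⟪x, X x⟫ = 0) ∧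
    ∀ x ∈ S2 \ range v, ∀ u w, ⟪x, u⟫ = 0 → ⟪x, w⟫ = 0 →
      h x u w = ⟪fderiv ℝ X x u, w⟫ + ⟪u, fderiv ℝ X x w⟫

end

/-!
A tensor field `h` on a part of the sphere is studied through its radial extension to the open
cone over that part in `ℝ³`. Near a regular point a family of cone metrics is a family of
pull-backs of the round metric, so its derivative is the Lie derivative of the round metric along
a tangent field. After extension, homogeneously of degree one, this is the Lie derivative of the
Euclidean metric along a field `X` of `ℝ³` with `⟪y, X y⟫ = 0` (`IsConeFamilyOn.exists_regular`).
Near a cone point there is an additional term, `τ i` times the derivative of the cone metric in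
the cone angle (`IsConeFamilyOn.exists_cone`). This local structure is `HasLocalForm`. The cone
angle is determined by the metric at one regular point near the cone point, where the derivative
of the cone metric in the angle does not vanish; this is why it is differentiable
(`IsConeFamilyOn.differentiableWithinAt_angle`).

Two local fields with the same Lie derivative differ by a Killing field `y ↦ a × y`. So the
derivative of the half curl of `X`, which is the axial vector of the derivative of `X`, depends on
`h` only, and the fields define a closed one-form `η` on the sphere without the cone points, with
values in `ℝ³`, the Lie algebra of rotations (`HasLocalForm.exists_form`). Off the axis of `v i`
the derivative of the cone metric is generated by the multi-valued field `φ / 2π (v i × y)`, with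
`φ` the azimuth, whose half curl changes by `v i` around `v i`. Hence `η` has the residue `τ i • v
i` at `v i` (`HasLocalForm.exists_hasResidues`), and the residue theorem on the sphere
(`HasResidues.sum_eq_zero`) gives `∑ i, τ i • v i = 0`.

The residue theorem is proved without integration: subtracting differences of the forms `areaPot`,
which all have the same exterior derivative, moves all residues to a regular point `q`. What
remains is locally exact on the sphere without `q`, and it is exact there since the cone over that
set is the image of a half-space (`exists_primitive_offRay`). Going around `q` once shows that the
total residue vanishes (`eq_zero_of_hasFDerivAt_azForm`).

Uniqueness: if all `τ i` vanish, `η` has a global primitive `κ` (`HasLocalForm.exists_curl`), and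
since `X` is recovered from its half curl as `halfCurl X y × y`, the field `κ y × y` is a global
field that generates `h`. Near a cone point it differs by a Killing field from a field that tends
to zero there, so it is continuous (`HasLocalForm.exists_field`).

Existence: if `∑ i, τ i • v i = 0`, the form `∑ i, (τ i / 4π) areaPot (v i) • v i` is closed, and
the fields `k y × y`, for its local primitives `k`, define a tensor field which is, up to a global
Lie derivative, `τ i` times the derivative of the cone metric near `v i`
(`exists_local_solution`). It is locally the derivative of families of cone metrics: near `v i`
those of the cone metrics of angle `2π + t τ i`, elsewhere those of pull-backs by maps with the
given initial velocity (`exists_coneFamily_of_coneTerm`, `exists_coneFamily_of_field`).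
-/

noncomputable section

/-! ### The cross product of `ℝ³` and axial vectors -/

/-- The cross product of `ℝ³`, as a continuous bilinear map. -/
def cr : E3 →L[ℝ] E3 →L[ℝ] E3 :=
  LinearMap.toContinuousLinearMap
    ((LinearMap.toContinuousLinearMap : (E3 →ₗ[ℝ] E3) ≃ₗ[ℝ] E3 →L[ℝ] E3).toLinearMap ∘ₗ
      LinearMap.mk₂ ℝ (fun a b : E3 => (!₂[a 1 * b 2 - a 2 * b 1, a 2 * b 0 - a 0 * b 2,
        a 0 * b 1 - a 1 * b 0] : E3))
        (by intro a b c; ext i; fin_cases i <;> simp <;> ring)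
        (by intro a b c; ext i; fin_cases i <;> simp <;> ring)
        (by intro a b c; ext i; fin_cases i <;> simp <;> ring)
        (by intro a b c; ext i; fin_cases i <;> simp <;> ring))

@[simp] theorem cr_zero (a b : E3) : cr a b 0 = a 1 * b 2 - a 2 * b 1 := rfl
@[simp] theorem cr_one (a b : E3) : cr a b 1 = a 2 * b 0 - a 0 * b 2 := rfl
@[simp] theorem cr_two (a b : E3) : cr a b 2 = a 0 * b 1 - a 1 * b 0 := rfl

theorem inner_coord (a b : E3) : ⟪a, b⟫ = a 0 * b 0 + a 1 * b 1 + a 2 * b 2 := by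
  simp [PiLp.inner_apply, Fin.sum_univ_three, mul_comm]

theorem E3_ext {a b : E3} (h0 : a 0 = b 0) (h1 : a 1 = b 1) (h2 : a 2 = b 2) : a = b := by
  ext i; fin_cases i <;> assumption

theorem inner_cr_left (a b : E3) : ⟪cr a b, a⟫ = 0 := by
  simp only [inner_coord, cr_zero, cr_one, cr_two]; ring

theorem inner_cr_right (a b : E3) : ⟪cr a b, b⟫ = 0 := by
  simp only [inner_coord, cr_zero, cr_one, cr_two]; ring

theorem inner_left_cr (a b : E3) : ⟪a, cr a b⟫ = 0 := by
  rw [real_inner_comm, inner_cr_left]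

theorem inner_right_cr (a b : E3) : ⟪b, cr a b⟫ = 0 := by
  rw [real_inner_comm, inner_cr_right]

theorem inner_cr_skew (a b c : E3) : ⟪cr a b, c⟫ = -⟪b, cr a c⟫ := by
  simp only [inner_coord, cr_zero, cr_one, cr_two]; ring

theorem cr_self (a : E3) : cr a a = 0 := by
  apply E3_ext <;> simp <;> ring

theorem inner_cr_cr (a b c d : E3) : ⟪cr a b, cr c d⟫ = ⟪a, c⟫ * ⟪b, d⟫ - ⟪a, d⟫ * ⟪b, c⟫ := by
  simp only [inner_coord, cr_zero, cr_one, cr_two]; ring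

theorem cr_cr (a b c : E3) : cr a (cr b c) = ⟪a, c⟫ • b - ⟪a, b⟫ • c := by
  apply E3_ext <;> simp [inner_coord] <;> ring

/-- The axial vector of an endomorphism `T` of `ℝ³`: the vector `a` for which `u ↦ a × u` is the
skew-symmetric part of `T`. The axial vector of the derivative of a vector field is half its curl.
-/
def axial : (E3 →L[ℝ] E3) →L[ℝ] E3 :=
  (1 / 2 : ℝ) • ∑ i : Fin 3, (cr (EuclideanSpace.single i 1)).comp
    (ContinuousLinearMap.apply ℝ E3 (EuclideanSpace.single i (1 : ℝ) : E3))

theorem E3_eq_sum (u : E3) : u = u 0 • EuclideanSpace.single 0 1 + u 1 • EuclideanSpace.single 1 1 +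
    u 2 • EuclideanSpace.single 2 1 := by
  apply E3_ext <;> simp

theorem inner_cr_axial (T : E3 →L[ℝ] E3) (u w : E3) :
    ⟪cr (axial T) u, w⟫ = (⟪T u, w⟫ - ⟪u, T w⟫) / 2 := by
  have hT : ∀ z : E3, T z = z 0 • T (EuclideanSpace.single 0 1) +
      z 1 • T (EuclideanSpace.single 1 1) + z 2 • T (EuclideanSpace.single 2 1) := fun z => by
    conv_lhs => rw [E3_eq_sum z]
    simp only [map_add, map_smul]
  rw [hT u, hT w]
  simp only [axial, Fin.sum_univ_three, inner_coord, cr_zero, cr_one, cr_two]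
  simp
  ring

theorem eq_of_inner_eq {a b : E3} (h : ∀ w, ⟪a, w⟫ = ⟪b, w⟫) : a = b :=
  ext_inner_right ℝ h

theorem cr_left_injective {a b : E3} (h : ∀ u, cr a u = cr b u) : a = b := by
  have h0 := h (EuclideanSpace.single 0 1)
  have h1 := h (EuclideanSpace.single 1 1)
  have e1 := congrArg (fun z : E3 => z 1) h0
  have e2 := congrArg (fun z : E3 => z 2) h0
  have e3 := congrArg (fun z : E3 => z 2) h1
  simp at e1 e2 e3
  exact E3_ext e3 e2 e1

theorem axial_cr (a : E3) : axial (cr a) = a := by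
  refine cr_left_injective fun u => eq_of_inner_eq fun w => ?_
  rw [inner_cr_axial, inner_cr_skew a u w]; ring

/-- If the derivative `T` of a field at `y` kills the radial part of the deformation, the field is
recovered from the axial vector of `T`. -/
theorem cr_axial_apply {T : E3 →L[ℝ] E3} {y X : E3} (h : T y = X)
    (h' : ∀ w, ⟪y, T w⟫ = -⟪X, w⟫) : cr (axial T) y = X := by
  refine eq_of_inner_eq fun w => ?_
  rw [inner_cr_axial, h, h']; ring

/-- A trilinear form on `E` which is symmetric in the first two arguments and skew in the last two
vanishes. -/
theorem eq_zero_of_symm_of_skew {E : Type*} {S : E → E → E → ℝ} (h : ∀ a b c, S a b c = S b a c)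
    (h' : ∀ a b c, S a b c = -S a c b) (a b c : E) : S a b c = 0 := by
  have := h a b c; have := h' b a c; have := h b c a
  have := h' c b a; have := h c a b; have := h' a c b
  linarith

/-! ### Orthonormal frames -/

theorem exists_unit_orthogonal {q : E3} (hq : ‖q‖ = 1) : ∃ e : E3, ‖e‖ = 1 ∧ ⟪q, e⟫ = 0 := by
  obtain ⟨w, hw⟩ : ∃ w, cr q w ≠ 0 := by
    by_contra! h
    have : q = 0 := cr_left_injective fun u => by simp [h]
    simp [this] at hq
  refine ⟨‖cr q w‖⁻¹ • cr q w, ?_, ?_⟩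
  · rw [norm_smul, norm_inv, norm_norm, inv_mul_cancel₀ (norm_ne_zero_iff.2 hw)]
  · rw [inner_smul_right, inner_left_cr, mul_zero]

theorem real_inner_self_one {q : E3} (hq : ‖q‖ = 1) : ⟪q, q⟫ = 1 := by
  rw [real_inner_self_eq_norm_sq, hq, one_pow]

/-- A unit vector `q` and a unit vector `e` orthogonal to it are completed by `q × e` to an
orthonormal basis. -/
theorem frame_expansion {q e : E3} (hq : ‖q‖ = 1) (he : ‖e‖ = 1) (hqe : ⟪q, e⟫ = 0) (y : E3) :
    y = ⟪q, y⟫ • q + ⟪e, y⟫ • e + ⟪cr q e, y⟫ • cr q e := by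
  have hon : Orthonormal ℝ ![q, e, cr q e] := by
    rw [orthonormal_iff_ite]
    have h1 := real_inner_self_one hq
    have h2 := real_inner_self_one he
    have h3 : ⟪cr q e, cr q e⟫ = 1 := by
      rw [inner_cr_cr, h1, h2, hqe]; simp
    have h4 : ⟪e, q⟫ = 0 := by rw [real_inner_comm, hqe]
    intro i j
    fin_cases i <;> fin_cases j <;>
      simp [h1, h2, h3, h4, hqe, inner_cr_left, inner_cr_right, inner_left_cr, inner_right_cr,
        -inner_self_eq_norm_sq_to_K]
  have hc : Fintype.card (Fin 3) = Module.finrank ℝ E3 := by simp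
  let b := (basisOfOrthonormalOfCardEqFinrank hon hc).toOrthonormalBasis
    (by simpa using hon)
  have := b.sum_repr' y
  rw [Fin.sum_univ_three] at this
  simpa [b] using this.symm

theorem norm_sq_frame {q e : E3} (hq : ‖q‖ = 1) (he : ‖e‖ = 1) (hqe : ⟪q, e⟫ = 0) (y : E3) :
    ‖y‖ ^ 2 = ⟪q, y⟫ ^ 2 + ⟪e, y⟫ ^ 2 + ⟪cr q e, y⟫ ^ 2 := by
  rw [← real_inner_self_eq_norm_sq]
  have h := frame_expansion hq he hqe y
  calc ⟪y, y⟫ = ⟪⟪q, y⟫ • q + ⟪e, y⟫ • e + ⟪cr q e, y⟫ • cr q e, y⟫ := by rw [← h]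
    _ = _ := by
      simp only [inner_add_left, real_inner_smul_left]
      ring

/-! ### Radial projection and cones over spherical caps -/

/-- The radial projection `ℝ³ \ {0} → S²`. -/
def nrm (y : E3) : E3 := ‖y‖⁻¹ • y

/-- The projection to the tangent plane of the sphere about the origin through `y`. -/
def tanProj (y u : E3) : E3 := u - ⟪nrm y, u⟫ • nrm y

theorem norm_nrm {y : E3} (hy : y ≠ 0) : ‖nrm y‖ = 1 := by
  rw [nrm, norm_smul, norm_inv, norm_norm, inv_mul_cancel₀ (norm_ne_zero_iff.2 hy)]

theorem nrm_mem_S2 {y : E3} (hy : y ≠ 0) : nrm y ∈ S2 := by simp [norm_nrm hy]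

theorem nrm_of_norm_one {y : E3} (hy : ‖y‖ = 1) : nrm y = y := by simp [nrm, hy]

theorem norm_smul_nrm (y : E3) : ‖y‖ • nrm y = y := by
  rcases eq_or_ne y 0 with rfl | hy
  · simp
  · rw [nrm, smul_smul, mul_inv_cancel₀ (norm_ne_zero_iff.2 hy), one_smul]

theorem norm_one_of_mem {x : E3} (hx : x ∈ S2) : ‖x‖ = 1 := by simpa using hx

theorem ne_zero_of_norm_one {x : E3} (hx : ‖x‖ = 1) : x ≠ 0 := by
  rintro rfl; simp at hx

theorem inner_tanProj {y : E3} (hy : y ≠ 0) (u : E3) : ⟪nrm y, tanProj y u⟫ = 0 := by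
  rw [tanProj, inner_sub_right, inner_smul_right, real_inner_self_one (norm_nrm hy)]; ring

theorem tanProj_of_inner_eq_zero {y u : E3} (hy : ‖y‖ = 1) (h : ⟪y, u⟫ = 0) : tanProj y u = u := by
  simp [tanProj, nrm_of_norm_one hy, h]

theorem contDiffAt_nrm {y : E3} (hy : y ≠ 0) : ContDiffAt ℝ ∞ nrm y :=
  ((contDiffAt_norm ℝ hy).inv (norm_ne_zero_iff.2 hy)).smul contDiffAt_id

theorem hasFDerivAt_norm_E3 {y : E3} (hy : y ≠ 0) :
    HasFDerivAt (fun z : E3 => ‖z‖) (‖y‖⁻¹ • innerSL ℝ y) y := by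
  have h1 : HasFDerivAt (fun z : E3 => ‖z‖ ^ 2) (2 • innerSL ℝ y) y :=
    (hasStrictFDerivAt_norm_sq y).hasFDerivAt
  have h2 := h1.sqrt (by positivity)
  have h3 : (fun z : E3 => √(‖z‖ ^ 2)) = fun z => ‖z‖ := by
    funext z; exact Real.sqrt_sq (norm_nonneg z)
  rw [h3] at h2
  refine h2.congr_fderiv (ContinuousLinearMap.ext fun u => ?_)
  rw [Real.sqrt_sq (norm_nonneg y)]
  have := norm_ne_zero_iff.2 hy
  simp
  field_simp

/-- The open cone over the spherical cap about `p` of cosine `c`. -/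
def capCone (p : E3) (c : ℝ) : Set E3 := {y | c * ‖y‖ < ⟪p, y⟫}

/-- The open cone over the punctured spherical cap about `p` of cosine `c`. -/
def punctCone (p : E3) (c : ℝ) : Set E3 := {y | c * ‖y‖ < ⟪p, y⟫ ∧ ⟪p, y⟫ < ‖y‖}

theorem isOpen_capCone (p : E3) (c : ℝ) : IsOpen (capCone p c) :=
  isOpen_lt (by fun_prop) (by fun_prop)

theorem isOpen_punctCone (p : E3) (c : ℝ) : IsOpen (punctCone p c) :=
  (isOpen_capCone p c).inter (isOpen_lt (f := fun y : E3 => ⟪p, y⟫) (g := fun y => ‖y‖)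
    (by fun_prop) (by fun_prop))

theorem capCone_anti {p : E3} {c c' : ℝ} (h : c ≤ c') : capCone p c' ⊆ capCone p c := fun y hy =>
  (mul_le_mul_of_nonneg_right h (norm_nonneg y)).trans_lt hy

theorem punctCone_anti {p : E3} {c c' : ℝ} (h : c ≤ c') : punctCone p c' ⊆ punctCone p c :=
  fun _ hy => ⟨capCone_anti h hy.1, hy.2⟩

theorem convex_capCone (p : E3) {c : ℝ} (hc : 0 ≤ c) : Convex ℝ (capCone p c) := by
  intro x hx y hy a b ha hb hab
  have h1 : ‖a • x + b • y‖ ≤ a * ‖x‖ + b * ‖y‖ := by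
    refine (norm_add_le _ _).trans ?_
    rw [norm_smul, norm_smul, Real.norm_of_nonneg ha, Real.norm_of_nonneg hb]
  have hx' : c * ‖x‖ < ⟪p, x⟫ := hx
  have hy' : c * ‖y‖ < ⟪p, y⟫ := hy
  change c * ‖a • x + b • y‖ < ⟪p, a • x + b • y⟫
  rw [inner_add_right, inner_smul_right, inner_smul_right]
  have h2 := mul_le_mul_of_nonneg_left h1 hc
  rcases ha.eq_or_lt with rfl | ha'
  · have : b = 1 := by linarith
    subst this; nlinarith
  · nlinarith [mul_lt_mul_of_pos_left hx' ha', mul_le_mul_of_nonneg_left hy'.le hb]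

theorem ne_zero_of_mem_capCone {p y : E3} {c : ℝ} (h : y ∈ capCone p c) : y ≠ 0 := by
  rintro rfl; simp [capCone] at h

theorem mem_capCone_self {p : E3} (hp : ‖p‖ = 1) {c : ℝ} (hc : c < 1) : p ∈ capCone p c := by
  simp [capCone, hp, hc]

theorem smul_mem_capCone {p y : E3} {c s : ℝ} (hs : 0 < s) :
    s • y ∈ capCone p c ↔ y ∈ capCone p c := by
  simp only [capCone, mem_ofPred_eq, norm_smul, inner_smul_right, Real.norm_of_nonneg hs.le]
  rw [mul_left_comm, mul_lt_mul_iff_right₀ hs]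

theorem smul_mem_punctCone {p y : E3} {c s : ℝ} (hs : 0 < s) :
    s • y ∈ punctCone p c ↔ y ∈ punctCone p c := by
  simp only [punctCone, mem_ofPred_eq, norm_smul, inner_smul_right, Real.norm_of_nonneg hs.le]
  rw [mul_left_comm, mul_lt_mul_iff_right₀ hs, mul_lt_mul_iff_right₀ hs]

theorem nrm_mem_capCone {p y : E3} {c : ℝ} (hy : y ≠ 0) : nrm y ∈ capCone p c ↔ y ∈ capCone p c :=
  smul_mem_capCone (inv_pos.2 (norm_pos_iff.2 hy))

theorem nrm_mem_punctCone {p y : E3} {c : ℝ} (hy : y ≠ 0) :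
    nrm y ∈ punctCone p c ↔ y ∈ punctCone p c :=
  smul_mem_punctCone (inv_pos.2 (norm_pos_iff.2 hy))

theorem inner_lt_norm {p y : E3} (hp : ‖p‖ = 1) (hy : y ≠ 0) (h : nrm y ≠ p) : ⟪p, y⟫ < ‖y‖ := by
  have h1 : ⟪p, y⟫ ≤ ‖y‖ := by simpa [hp] using real_inner_le_norm p y
  refine h1.lt_of_ne fun h2 => h ?_
  have h3 : ⟪p, y⟫ = ‖p‖ * ‖y‖ := by rw [hp, one_mul, h2]
  rw [inner_eq_norm_mul_iff_real, hp, one_smul] at h3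
  conv_lhs => rw [nrm, ← congrArg (‖y‖⁻¹ • ·) h3]
  rw [smul_smul, inv_mul_cancel₀ (norm_ne_zero_iff.2 hy), one_smul]

theorem nrm_ne_of_inner_lt {p y : E3} (hp : ‖p‖ = 1) (h : ⟪p, y⟫ < ‖y‖) : nrm y ≠ p := by
  rintro rfl
  have hy : y ≠ 0 := by rintro rfl; simp at h
  rw [nrm, real_inner_smul_left, real_inner_self_eq_norm_sq] at h
  have := norm_pos_iff.2 hy
  field_simp at h
  exact lt_irrefl _ h

theorem mem_punctCone_of_mem_capCone {p y : E3} {c : ℝ} (hp : ‖p‖ = 1) (h : y ∈ capCone p c)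
    (h' : nrm y ≠ p) : y ∈ punctCone p c :=
  ⟨h, inner_lt_norm hp (ne_zero_of_mem_capCone h) h'⟩

/-- Caps form a basis of neighbourhoods on the sphere. -/
theorem exists_capCone_subset {p : E3} (hp : ‖p‖ = 1) {U : Set E3} (hU : U ∈ 𝓝[S2] p) :
    ∃ c, 0 ≤ c ∧ c < 1 ∧ ∀ y ∈ capCone p c, nrm y ∈ U := by
  obtain ⟨r, hr, hrU⟩ := Metric.mem_nhdsWithin_iff.1 hU
  refine ⟨max 0 (1 - r ^ 2 / 2), le_max_left _ _, ?_, fun y hy => hrU ⟨?_, ?_⟩⟩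
  · exact max_lt one_pos (by nlinarith)
  · have hy0 := ne_zero_of_mem_capCone hy
    have h1 : nrm y ∈ capCone p (1 - r ^ 2 / 2) :=
      (nrm_mem_capCone hy0).2 (capCone_anti (le_max_right _ _) hy)
    have h2 : 1 - r ^ 2 / 2 < ⟪p, nrm y⟫ := by
      simpa [capCone, norm_nrm hy0] using h1
    rw [Metric.mem_ball, dist_eq_norm]
    refine lt_of_pow_lt_pow_left₀ 2 hr.le ?_
    rw [norm_sub_sq_real, norm_nrm hy0, hp, real_inner_comm]
    linarith
  · exact nrm_mem_S2 (ne_zero_of_mem_capCone hy)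

theorem capCone_mem_nhds {p : E3} (hp : ‖p‖ = 1) {c : ℝ} (hc : c < 1) : capCone p c ∈ 𝓝 p :=
  (isOpen_capCone p c).mem_nhds (mem_capCone_self hp hc)

/-- Spherical coordinates of the cone over a punctured cap. -/
theorem punctCone_eq_image {p e : E3} (hp : ‖p‖ = 1) (he : ‖e‖ = 1) (hpe : ⟪p, e⟫ = 0) (c : ℝ)
    (hc : 0 ≤ c) :
    punctCone p c = (fun z : ℝ × ℝ × ℝ => z.1 • (z.2.1 • p + √(1 - z.2.1 ^ 2) •
      (Real.cos z.2.2 • e + Real.sin z.2.2 • cr p e))) '' (Ioi 0 ×ˢ Ioo c 1 ×ˢ univ) := by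
  have hpp := real_inner_self_one hp
  have hee := real_inner_self_one he
  have hcc : ⟪cr p e, cr p e⟫ = 1 := by rw [inner_cr_cr, hpp, hee, hpe]; simp
  have hep : ⟪e, p⟫ = 0 := by rw [real_inner_comm, hpe]
  ext y
  constructor
  · intro hy
    have hy0 := ne_zero_of_mem_capCone hy.1
    have hn := norm_pos_iff.2 hy0
    have hnn := norm_nrm hy0
    obtain ⟨h1, h2⟩ := (nrm_mem_punctCone hy0).2 hy
    rw [hnn, mul_one] at h1
    rw [hnn] at h2
    have hsq := norm_sq_frame hp he hpe (nrm y)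
    rw [hnn] at hsq
    set b := ⟪p, nrm y⟫
    set a1 := ⟪e, nrm y⟫
    set a2 := ⟪cr p e, nrm y⟫
    have hpos : 0 < 1 - b ^ 2 := by nlinarith
    have hs := Real.sqrt_pos.2 hpos
    have hs2 := Real.sq_sqrt hpos.le
    set r := √(1 - b ^ 2)
    obtain ⟨t, ht1, ht2⟩ : ∃ t, Real.cos t = a1 / r ∧ Real.sin t = a2 / r := by
      have habs : ‖(⟨a1 / r, a2 / r⟩ : ℂ)‖ = 1 := by
        rw [Complex.norm_def, Complex.normSq_mk, Real.sqrt_eq_one]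
        field_simp
        linarith
      refine ⟨Complex.arg ⟨a1 / r, a2 / r⟩, ?_, ?_⟩
      · rw [Complex.cos_arg (by rw [← norm_ne_zero_iff, habs]; simp), habs, div_one]
      · rw [Complex.sin_arg, habs, div_one]
    refine ⟨(‖y‖, b, t), ⟨hn, ⟨h1, h2⟩, mem_univ _⟩, ?_⟩
    change ‖y‖ • (b • p + r • (Real.cos t • e + Real.sin t • cr p e)) = y
    rw [ht1, ht2, smul_add r, smul_smul, smul_smul, mul_div_cancel₀ _ hs.ne',
      mul_div_cancel₀ _ hs.ne', ← add_assoc]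
    rw [← frame_expansion hp he hpe (nrm y), norm_smul_nrm]
  · rintro ⟨⟨s, b, t⟩, ⟨hs, ⟨hb1, hb2⟩, -⟩, rfl⟩
    have hs' : 0 < s := hs
    rw [smul_mem_punctCone hs']
    have hpos : 0 < 1 - b ^ 2 := by
      simp only at hb1 hb2; nlinarith
    have hs2 := Real.sq_sqrt hpos.le
    dsimp only at hb1 hb2 ⊢
    set r := √(1 - b ^ 2)
    set y := b • p + r • (Real.cos t • e + Real.sin t • cr p e)
    have i1 : ⟪p, y⟫ = b := by
      simp [y, inner_add_right, inner_smul_right, hp, hpe, inner_left_cr]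
    have i2 : ⟪e, y⟫ = r * Real.cos t := by
      simp [y, inner_add_right, inner_smul_right, he, hep, inner_right_cr]
    have i3 : ⟪cr p e, y⟫ = r * Real.sin t := by
      simp only [y, inner_add_right, inner_smul_right, hcc, inner_cr_left, inner_cr_right]; ring
    have hny : ‖y‖ = 1 := by
      have := norm_sq_frame hp he hpe y
      rw [i1, i2, i3] at this
      have h1 : ‖y‖ ^ 2 = 1 := by
        rw [this]; linear_combination r ^ 2 * Real.sin_sq_add_cos_sq t + hs2
      exact (pow_eq_one_iff_of_nonneg (norm_nonneg y) two_ne_zero).1 h1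
    simp only [punctCone, mem_ofPred_eq, i1, hny]
    exact ⟨by linarith, hb2⟩

theorem isPreconnected_punctCone {p : E3} (hp : ‖p‖ = 1) {c : ℝ} (hc : 0 ≤ c) :
    IsPreconnected (punctCone p c) := by
  obtain ⟨e, he, hpe⟩ := exists_unit_orthogonal hp
  rw [punctCone_eq_image hp he hpe c hc]
  refine IsPreconnected.image ?_ _ (by fun_prop)
  exact (isPreconnected_Ioi).prod (isPreconnected_Ioo.prod isPreconnected_univ)

theorem exists_mem_punctCone {p : E3} (hp : ‖p‖ = 1) {c : ℝ} (hc : 0 ≤ c) (hc1 : c < 1) :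
    (punctCone p c).Nonempty := by
  obtain ⟨e, he, hpe⟩ := exists_unit_orthogonal hp
  rw [punctCone_eq_image hp he hpe c hc]
  exact ⟨_, ⟨(1, (c + 1) / 2, 0), ⟨by simp, ⟨by simp; linarith, by simp; linarith⟩, by simp⟩, rfl⟩⟩

/-! ### Closed one-forms and their primitives -/

section Primitives

variable {E F : Type*} [NormedAddCommGroup E] [NormedSpace ℝ E] [NormedAddCommGroup F]
  [NormedSpace ℝ F]

/-- `k` is, near `y`, a smooth primitive of the one-form `η`. -/
def IsPrimitiveNear (k : E → F) (η : E → E →L[ℝ] F) (y : E) : Prop :=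
  ∀ᶠ z in 𝓝 y, ContDiffAt ℝ ∞ k z ∧ HasFDerivAt k (η z) z

/-- A smooth closed one-form has local primitives. -/
theorem exists_isPrimitiveNear [CompleteSpace F] {η : E → E →L[ℝ] F} {y : E}
    (hη : ∀ᶠ z in 𝓝 y, ContDiffAt ℝ ∞ η z)
    (hs : ∀ᶠ z in 𝓝 y, ∀ u w, fderiv ℝ η z u w = fderiv ℝ η z w u) :
    ∃ k, IsPrimitiveNear k η y := by
  obtain ⟨r, hr, hball⟩ := Metric.eventually_nhds_iff_ball.1 (hη.and hs)
  obtain ⟨k, hk⟩ := (convex_ball y r).exists_forall_hasFDerivAt_of_fderiv_symmetric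
    Metric.isOpen_ball (fun z hz => (((hball z hz).1).differentiableAt (by simp)).differentiableWithinAt)
    (fun z hz => (hball z hz).2)
  have hC : ContDiffOn ℝ ∞ k (Metric.ball y r) := by
    rw [contDiffOn_infty_iff_fderiv_of_isOpen Metric.isOpen_ball]
    refine ⟨fun z hz => (hk z hz).differentiableAt.differentiableWithinAt, ?_⟩
    exact ContDiffOn.congr (fun z hz => (hball z hz).1.contDiffWithinAt)
      fun z hz => (hk z hz).fderiv
  refine ⟨k, Metric.eventually_nhds_iff_ball.2 ⟨r, hr, fun z hz => ⟨?_, hk z hz⟩⟩⟩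
  exact hC.contDiffAt (Metric.isOpen_ball.mem_nhds hz)

/-- A one-form with local primitives on an open convex set has a primitive. -/
theorem exists_primitive_of_convex [CompleteSpace F] {s : Set E} (hs : Convex ℝ s) (hso : IsOpen s)
    {η : E → E →L[ℝ] F} (h : ∀ y ∈ s, ∃ k, IsPrimitiveNear k η y) :
    ∃ K : E → F, ∀ y ∈ s, HasFDerivAt K (η y) y := by
  have key : ∀ y ∈ s, ∃ k : E → F, ContDiffAt ℝ ∞ k y ∧ η =ᶠ[𝓝 y] fderiv ℝ k := by
    intro y hy
    obtain ⟨k, hk⟩ := h y hy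
    exact ⟨k, hk.self_of_nhds.1, hk.mono fun z hz => hz.2.fderiv.symm⟩
  refine hs.exists_forall_hasFDerivAt_of_fderiv_symmetric hso (fun y hy => ?_) fun y hy u w => ?_
  · obtain ⟨k, hk, he⟩ := key y hy
    have : DifferentiableAt ℝ (fderiv ℝ k) y :=
      (hk.fderiv_right (m := 1) (by norm_cast)).differentiableAt (by simp)
    exact (this.congr_of_eventuallyEq he).differentiableWithinAt
  · obtain ⟨k, hk, he⟩ := key y hy
    rw [he.fderiv_eq]
    exact (hk.of_le (by norm_cast) : ContDiffAt ℝ 2 k y).isSymmSndFDerivAt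
      (by simp) u w

end Primitives

/-- The complement of the closed ray through `-q`. -/
def offRay (q : E3) : Set E3 := {y | 0 < ‖y‖ + ⟪q, y⟫}

theorem isOpen_offRay (q : E3) : IsOpen (offRay q) :=
  isOpen_lt (f := fun _ : E3 => (0 : ℝ)) (g := fun y => ‖y‖ + ⟪q, y⟫) (by fun_prop) (by fun_prop)

/-- A one-form on the complement of a ray with local primitives has a primitive there. The map `z ↦
2 ⟪q, z⟫ z - ‖z‖² q`, which doubles the angle with `q`, is a diffeomorphism of a half-space onto
that complement, and a half-space is convex. -/
theorem exists_primitive_offRay {F : Type*} [NormedAddCommGroup F] [NormedSpace ℝ F]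
    [CompleteSpace F] {q : E3} (hq : ‖q‖ = 1) {η : E3 → E3 →L[ℝ] F}
    (h : ∀ y ∈ offRay q, ∃ k, IsPrimitiveNear k η y) :
    ∃ K : E3 → F, ∀ y ∈ offRay q, HasFDerivAt K (η y) y := by
  set Φ : E3 → E3 := fun z => (2 * ⟪q, z⟫) • z - ‖z‖ ^ 2 • q with hΦ
  set Ψ : E3 → E3 := fun y => (√(2 * (‖y‖ + ⟪q, y⟫)))⁻¹ • (y + ‖y‖ • q) with hΨ
  have hqq := real_inner_self_one hq
  set H : Set E3 := {z | 0 < ⟪q, z⟫} with hH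
  have hHo : IsOpen H :=
    isOpen_lt (f := fun _ : E3 => (0 : ℝ)) (g := fun z => ⟪q, z⟫) (by fun_prop) (by fun_prop)
  have hHc : Convex ℝ H := by
    intro x hx y hy a b ha hb hab
    have hx' : 0 < ⟪q, x⟫ := hx
    have hy' : 0 < ⟪q, y⟫ := hy
    change 0 < ⟪q, a • x + b • y⟫
    rw [inner_add_right, inner_smul_right, inner_smul_right]
    rcases ha.eq_or_lt with rfl | ha'
    · have : b = 1 := by linarith
      subst this; simpa using hy'
    · have := mul_pos ha' hx'; have := mul_nonneg hb hy'.le; linarith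
  have hΦs : ContDiff ℝ ∞ Φ := 
    ((contDiff_const.mul (innerSL ℝ q).contDiff).smul contDiff_id).sub
      ((contDiff_norm_sq ℝ).smul contDiff_const)
  have hnΦ : ∀ z, ‖Φ z‖ = ‖z‖ ^ 2 := by
    intro z
    have : ‖Φ z‖ ^ 2 = (‖z‖ ^ 2) ^ 2 := by
      rw [hΦ, ← real_inner_self_eq_norm_sq]
      simp only [inner_sub_left, inner_sub_right, real_inner_smul_left, inner_smul_right, hqq,
        real_inner_self_eq_norm_sq, real_inner_comm q z]
      ring
    exact (pow_left_inj₀ (norm_nonneg _) (by positivity) two_ne_zero).1 this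
  have hqΦ : ∀ z, ⟪q, Φ z⟫ = 2 * ⟪q, z⟫ ^ 2 - ‖z‖ ^ 2 := by
    intro z
    simp only [hΦ, inner_sub_right, inner_smul_right, hqq]
    ring
  have hΦm : ∀ z ∈ H, Φ z ∈ offRay q := by
    intro z hz
    have hz' : 0 < ⟪q, z⟫ := hz
    change 0 < ‖Φ z‖ + ⟪q, Φ z⟫
    rw [hnΦ, hqΦ]
    nlinarith
  have hsum : ∀ y ∈ offRay q, 0 < √(2 * (‖y‖ + ⟪q, y⟫)) := fun y hy => by
    have : 0 < ‖y‖ + ⟪q, y⟫ := hy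
    exact Real.sqrt_pos.2 (by linarith)
  have hqΨ : ∀ y ∈ offRay q, ⟪q, Ψ y⟫ = √(2 * (‖y‖ + ⟪q, y⟫)) / 2 := by
    intro y hy
    have h0 := hsum y hy
    have h1 : √(2 * (‖y‖ + ⟪q, y⟫)) ^ 2 = 2 * (‖y‖ + ⟪q, y⟫) :=
      Real.sq_sqrt (by have : 0 < ‖y‖ + ⟪q, y⟫ := hy; linarith)
    simp only [hΨ, inner_smul_right, inner_add_right, hqq]
    field_simp
    linarith
  have hΨm : ∀ y ∈ offRay q, Ψ y ∈ H := by
    intro y hy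
    change 0 < ⟪q, Ψ y⟫
    rw [hqΨ y hy]
    have := hsum y hy
    positivity
  have hΦΨ : ∀ y ∈ offRay q, Φ (Ψ y) = y := by
    intro y hy
    have h0 := hsum y hy
    have h1 : √(2 * (‖y‖ + ⟪q, y⟫)) ^ 2 = 2 * (‖y‖ + ⟪q, y⟫) :=
      Real.sq_sqrt (by have : 0 < ‖y‖ + ⟪q, y⟫ := hy; linarith)
    have hn : ‖Ψ y‖ ^ 2 = ‖y‖ := by
      rw [hΨ, ← real_inner_self_eq_norm_sq]
      simp only [inner_add_left, inner_add_right, real_inner_smul_left, inner_smul_right, hqq,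
        real_inner_self_eq_norm_sq, real_inner_comm q y]
      field_simp
      rw [h1]; ring
    have : Φ (Ψ y) = (2 * ⟪q, Ψ y⟫) • Ψ y - ‖Ψ y‖ ^ 2 • q := rfl
    rw [this, hqΨ y hy, hn, hΨ, smul_smul]
    have : 2 * (√(2 * (‖y‖ + ⟪q, y⟫)) / 2) * (√(2 * (‖y‖ + ⟪q, y⟫)))⁻¹ = 1 := by
      field_simp
    rw [this]; simp
  have hΨs : ∀ y ∈ offRay q, DifferentiableAt ℝ Ψ y := by
    intro y hy
    have hy0 : y ≠ 0 := by rintro rfl; simp [offRay] at hy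
    have hnorm : DifferentiableAt ℝ (fun z : E3 => ‖z‖) y := (hasFDerivAt_norm_E3 hy0).differentiableAt
    have h0 := hsum y hy
    have hpos : 2 * (‖y‖ + ⟪q, y⟫) ≠ 0 := by have : 0 < ‖y‖ + ⟪q, y⟫ := hy; linarith
    have hi : DifferentiableAt ℝ (fun z : E3 => ⟪q, z⟫) y :=
      (innerSL ℝ q).differentiableAt
    have hs : DifferentiableAt ℝ (fun z : E3 => √(2 * (‖z‖ + ⟪q, z⟫))) y :=
      ((hnorm.add hi).const_mul 2).sqrt hpos
    exact (hs.inv h0.ne').smul (differentiableAt_id.add (hnorm.smul_const q))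
  obtain ⟨G, hG⟩ := exists_primitive_of_convex hHc hHo
    (η := fun z => (η (Φ z)).comp (fderiv ℝ Φ z)) (F := F) (by
      intro z hz
      obtain ⟨k, hk⟩ := h (Φ z) (hΦm z hz)
      refine ⟨k ∘ Φ, (hΦs.continuous.continuousAt.eventually hk).mono fun z' hz' => ⟨?_, ?_⟩⟩
      · exact hz'.1.comp z' hΦs.contDiffAt
      · exact hz'.2.comp z' (hΦs.contDiffAt.differentiableAt (by simp)).hasFDerivAt)
  refine ⟨G ∘ Ψ, fun y hy => ?_⟩
  have h1 := (hG (Ψ y) (hΨm y hy)).comp y (hΨs y hy).hasFDerivAt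
  refine h1.congr_fderiv ?_
  rw [ContinuousLinearMap.comp_assoc, hΦΨ y hy]
  have h2 : HasFDerivAt (Φ ∘ Ψ) ((fderiv ℝ Φ (Ψ y)).comp (fderiv ℝ Ψ y)) y :=
    (hΦs.contDiffAt.differentiableAt (by simp)).hasFDerivAt.comp y (hΨs y hy).hasFDerivAt
  have h3 : HasFDerivAt (Φ ∘ Ψ) (ContinuousLinearMap.id ℝ E3) y :=
    (hasFDerivAt_id y).congr_of_eventuallyEq
      (Filter.mem_of_superset ((isOpen_offRay q).mem_nhds hy) fun z hz => hΦΨ z hz)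
  rw [h2.unique h3, ContinuousLinearMap.comp_id]

/-! ### Potentials of the area form and the azimuthal form -/

/-- Up to sign, a primitive of the area form of `S²`, smooth away from `v`, as a radially invariant
one-form on the complement of the ray through `v`. On the sphere it is `(1 + cos r) dφ` in polar
coordinates about `v`. -/
def areaPot (v y : E3) : E3 →L[ℝ] ℝ := (‖y‖ * (‖y‖ - ⟪v, y⟫))⁻¹ • innerSL ℝ (cr v y)

/-- The differential `dφ` of the azimuth about `v`, as a radially invariant one-form. -/
def azForm (v y : E3) : E3 →L[ℝ] ℝ := (‖y‖ ^ 2 - ⟪v, y⟫ ^ 2)⁻¹ • innerSL ℝ (cr v y)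

theorem areaPot_apply (v y u : E3) :
    areaPot v y u = (‖y‖ * (‖y‖ - ⟪v, y⟫))⁻¹ * ⟪cr v y, u⟫ := rfl

theorem azForm_apply (v y u : E3) : azForm v y u = (‖y‖ ^ 2 - ⟪v, y⟫ ^ 2)⁻¹ * ⟪cr v y, u⟫ := rfl

theorem azForm_self (v y : E3) : azForm v y y = 0 := by
  rw [azForm_apply, inner_cr_right, mul_zero]

theorem azForm_eq {v y : E3} (hy : y ≠ 0) (h1 : ⟪v, y⟫ < ‖y‖) (h2 : -⟪v, y⟫ < ‖y‖) :
    azForm v y = (1 / 2 : ℝ) • (areaPot v y - areaPot (-v) y) := by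
  ext u
  have := norm_pos_iff.2 hy
  have h3 : ‖y‖ - ⟪v, y⟫ ≠ 0 := by linarith
  have h4 : ‖y‖ + ⟪v, y⟫ ≠ 0 := by linarith
  have h5 : ‖y‖ ^ 2 - ⟪v, y⟫ ^ 2 ≠ 0 := by
    rw [sq_sub_sq]; exact mul_ne_zero h4 h3
  simp only [smul_apply, sub_apply, smul_eq_mul,
    azForm_apply, areaPot_apply, map_neg, neg_apply, inner_neg_left,
    sub_neg_eq_add]
  field_simp
  ring

theorem contDiffAt_inner_cr (v : E3) {y : E3} : ContDiffAt ℝ ∞ (fun z => innerSL ℝ (cr v z)) y :=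
  ((innerSL ℝ (E := E3)).contDiff.comp (cr v).contDiff).contDiffAt

theorem contDiffAt_areaPot {v y : E3} (hy : y ≠ 0) (h : ⟪v, y⟫ < ‖y‖) :
    ContDiffAt ℝ ∞ (areaPot v) y := by
  have hn := contDiffAt_norm ℝ (n := ∞) hy
  have hi : ContDiffAt ℝ ∞ (fun z : E3 => ⟪v, z⟫) y := (innerSL ℝ v).contDiff.contDiffAt
  refine ContDiffAt.smul (ContDiffAt.inv (hn.mul (hn.sub hi)) ?_) (contDiffAt_inner_cr v)
  exact mul_ne_zero (norm_ne_zero_iff.2 hy) (by linarith)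

theorem contDiffAt_azForm {v y : E3} (h : ⟪v, y⟫ ^ 2 < ‖y‖ ^ 2) :
    ContDiffAt ℝ ∞ (azForm v) y := by
  have hi : ContDiffAt ℝ ∞ (fun z : E3 => ⟪v, z⟫) y := (innerSL ℝ v).contDiff.contDiffAt
  refine ContDiffAt.smul (ContDiffAt.inv (((contDiff_norm_sq ℝ).contDiffAt).sub (hi.pow 2)) ?_)
    (contDiffAt_inner_cr v)
  linarith

theorem inner_cr_exchange (v y a u w : E3) : ⟪cr v y, u⟫ * ⟪a, w⟫ - ⟪cr v y, w⟫ * ⟪a, u⟫ =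
    ⟪v, a⟫ * ⟪y, cr u w⟫ - ⟪v, cr u w⟫ * ⟪y, a⟫ := by
  simp only [inner_coord, cr_zero, cr_one, cr_two]; ring

/-- The exterior derivative of `areaPot v` is minus the area form of the sphere, whatever `v`. Hence
the difference of two of these potentials is closed. -/
theorem fderiv_areaPot_antisymm {v y : E3} (hv : ‖v‖ = 1) (hy : y ≠ 0) (h : ⟪v, y⟫ < ‖y‖)
    (u w : E3) : fderiv ℝ (areaPot v) y w u - fderiv ℝ (areaPot v) y u w =
      ⟪y, cr u w⟫ / ‖y‖ ^ 3 := by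
  have hn := hasFDerivAt_norm_E3 hy
  have hi : HasFDerivAt (fun z : E3 => ⟪v, z⟫) (innerSL ℝ v) y := (innerSL ℝ v).hasFDerivAt
  have hpos := norm_pos_iff.2 hy
  have hne : ‖y‖ - ⟪v, y⟫ ≠ 0 := by linarith
  have h0 : ‖y‖ * (‖y‖ - ⟪v, y⟫) ≠ 0 := mul_ne_zero hpos.ne' hne
  have hf := (hasDerivAt_inv h0).comp_hasFDerivAt y (hn.mul (hn.sub hi))
  have hc : HasFDerivAt (fun z => innerSL ℝ (cr v z)) ((innerSL ℝ (E := E3)).comp (cr v)) y :=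
    ((innerSL ℝ (E := E3)).comp (cr v)).hasFDerivAt
  have hA : HasFDerivAt (areaPot v) _ y := hf.smul hc
  have key : ∀ a b, fderiv ℝ (areaPot v) y a b = (‖y‖ * (‖y‖ - ⟪v, y⟫))⁻¹ * ⟪cr v a, b⟫ -
      ((‖y‖ * (‖y‖ - ⟪v, y⟫)) ^ 2)⁻¹ * (‖y‖ * (‖y‖⁻¹ * ⟪y, a⟫ - ⟪v, a⟫) +
        (‖y‖ - ⟪v, y⟫) * (‖y‖⁻¹ * ⟪y, a⟫)) * ⟪cr v y, b⟫ := by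
    intro a b
    rw [hA.fderiv]
    simp
    ring
  rw [key, key]
  have e1 := inner_cr_exchange v y y u w
  have e2 := inner_cr_exchange v y v u w
  have e3 : ⟪cr v w, u⟫ = -⟪v, cr u w⟫ := by
    simp only [inner_coord, cr_zero, cr_one, cr_two]; ring
  have e4 : ⟪cr v u, w⟫ = ⟪v, cr u w⟫ := by
    simp only [inner_coord, cr_zero, cr_one, cr_two]; ring
  rw [real_inner_self_eq_norm_sq] at e1
  rw [real_inner_self_one hv, real_inner_comm v y] at e2
  rw [e3, e4]
  generalize ⟪cr v y, u⟫ = cu at *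
  generalize ⟪cr v y, w⟫ = cw at *
  generalize ⟪y, cr u w⟫ = Dy at *
  generalize ⟪v, cr u w⟫ = Dv at *
  generalize ⟪v, y⟫ = s at *
  generalize ‖y‖ = ρ at *
  field_simp
  linear_combination (-(2 * ρ - s)) * e1 + ρ ^ 2 * e2

theorem fderiv_areaPot_sub_symm {v v' y : E3} (hv : ‖v‖ = 1) (hv' : ‖v'‖ = 1) (hy : y ≠ 0)
    (h : ⟪v, y⟫ < ‖y‖) (h' : ⟪v', y⟫ < ‖y‖) (u w : E3) :
    fderiv ℝ (fun z => areaPot v z - areaPot v' z) y u w =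
      fderiv ℝ (fun z => areaPot v z - areaPot v' z) y w u := by
  rw [fderiv_fun_sub ((contDiffAt_areaPot hy h).differentiableAt (by simp))
    ((contDiffAt_areaPot hy h').differentiableAt (by simp))]
  have := fderiv_areaPot_antisymm hv hy h u w
  have := fderiv_areaPot_antisymm hv' hy h' u w
  simp only [sub_apply]
  linarith

theorem exists_primitive_areaPot_sub {v v' y : E3} (hv : ‖v‖ = 1) (hv' : ‖v'‖ = 1) (hy : y ≠ 0)
    (h : ⟪v, y⟫ < ‖y‖) (h' : ⟪v', y⟫ < ‖y‖) :
    ∃ k, IsPrimitiveNear k (fun z => areaPot v z - areaPot v' z) y := by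
  have hev : ∀ᶠ z in 𝓝 y, z ≠ 0 ∧ ⟪v, z⟫ < ‖z‖ ∧ ⟪v', z⟫ < ‖z‖ := by
    refine (eventually_ne_nhds hy).and (Filter.Eventually.and ?_ ?_)
    · exact ContinuousAt.eventually_lt (f := fun z : E3 => ⟪v, z⟫) (g := fun z => ‖z‖)
        (by fun_prop) (by fun_prop) h
    · exact ContinuousAt.eventually_lt (f := fun z : E3 => ⟪v', z⟫) (g := fun z => ‖z‖)
        (by fun_prop) (by fun_prop) h'
  exact exists_isPrimitiveNear
    (hev.mono fun z hz => (contDiffAt_areaPot hz.1 hz.2.1).sub (contDiffAt_areaPot hz.1 hz.2.2))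
    (hev.mono fun z hz => fderiv_areaPot_sub_symm hv hv' hz.1 hz.2.1 hz.2.2)

theorem abs_inner_lt_iff {v y : E3} : ⟪v, y⟫ ^ 2 < ‖y‖ ^ 2 ↔ ⟪v, y⟫ < ‖y‖ ∧ -⟪v, y⟫ < ‖y‖ := by
  rw [sq_lt_sq, abs_of_nonneg (norm_nonneg y), abs_lt]
  constructor <;> rintro ⟨h1, h2⟩ <;> constructor <;> linarith

/-- Off the axis of `v` the azimuth about `v` exists locally. -/
theorem exists_azimuth {v y : E3} (hv : ‖v‖ = 1) (h : ⟪v, y⟫ ^ 2 < ‖y‖ ^ 2) :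
    ∃ k, IsPrimitiveNear k (azForm v) y := by
  have hy : y ≠ 0 := by rintro rfl; simp at h
  obtain ⟨h1, h2⟩ := abs_inner_lt_iff.1 h
  obtain ⟨k, hk⟩ := exists_primitive_areaPot_sub hv (v' := -v) (by simpa using hv) hy h1
    (by simpa using h2)
  have hev : ∀ᶠ z : E3 in 𝓝 y, ⟪v, z⟫ ^ 2 < ‖z‖ ^ 2 :=
    ContinuousAt.eventually_lt (f := fun z : E3 => ⟪v, z⟫ ^ 2) (g := fun z => ‖z‖ ^ 2)
        (by fun_prop) (by fun_prop) h
  refine ⟨fun z => (1 / 2 : ℝ) • k z, (hk.and hev).mono fun z hz => ⟨?_, ?_⟩⟩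
  · exact hz.1.1.const_smul _
  · have hz0 : z ≠ 0 := by rintro rfl; simp at hz
    obtain ⟨h1, h2⟩ := abs_inner_lt_iff.1 hz.2
    rw [azForm_eq hz0 h1 h2]
    exact hz.1.2.const_smul (1 / 2 : ℝ)

/-! ### The residue theorem on the sphere -/

theorem IsPrimitiveNear.smul_const {F : Type*} [NormedAddCommGroup F] [NormedSpace ℝ F]
    {k : E3 → ℝ} {η : E3 → E3 →L[ℝ] ℝ} {y : E3} (h : IsPrimitiveNear k η y) (s : ℝ) (a : F) :
    IsPrimitiveNear (fun z => s • k z • a) (fun z => s • (η z).smulRight a) y :=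
  h.mono fun _ hz => ⟨(hz.1.smul contDiffAt_const).const_smul s, (hz.2.smul_const a).const_smul s⟩

/-- A function on `ℝ³` that is smooth away from the ray through `p` and agrees with a given
function, smooth on the cone over a punctured cap about `p`, on a smaller such cone. -/
theorem exists_cutoff {F : Type*} [NormedAddCommGroup F] [NormedSpace ℝ F] {p : E3} (hp : ‖p‖ = 1)
    {c : ℝ} (hc1 : c < 1) {f : E3 → F} (hf : ∀ y ∈ punctCone p c, ContDiffAt ℝ ∞ f y) :
    ∃ g : E3 → F, (∀ y, y ≠ 0 → nrm y ≠ p → ContDiffAt ℝ ∞ g y) ∧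
      ∃ c', c ≤ c' ∧ c' < 1 ∧ ∀ y ∈ punctCone p c', g y = f y := by
  set b : E3 → ℝ := fun y => Real.smoothTransition ((⟪p, y⟫ / ‖y‖ - (2 * c + 1) / 3) * (3 / (1 - c)))
  have h1c : 0 < 1 - c := by linarith
  have hb : ∀ y, y ≠ 0 → ContDiffAt ℝ ∞ b y := by
    intro y hy
    have hi : ContDiffAt ℝ ∞ (fun z : E3 => ⟪p, z⟫) y := (innerSL ℝ p).contDiff.contDiffAt
    have := ((hi.div (contDiffAt_norm ℝ hy) (norm_ne_zero_iff.2 hy)).sub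
      (contDiffAt_const (c := (2 * c + 1) / 3))).mul (contDiffAt_const (c := 3 / (1 - c)))
    exact Real.smoothTransition.contDiff.contDiffAt.comp y this
  refine ⟨fun y => b y • f y, fun y hy hyp => ?_, (c + 2) / 3, by linarith, by linarith,
    fun y hy => ?_⟩
  · have hpos := norm_pos_iff.2 hy
    rcases le_or_gt (⟪p, y⟫ / ‖y‖) c with h | h
    · have hev : ∀ᶠ z : E3 in 𝓝 y, ⟪p, z⟫ / ‖z‖ < (2 * c + 1) / 3 := by
        refine ContinuousAt.eventually_lt (f := fun z : E3 => ⟪p, z⟫ / ‖z‖) ?_ continuousAt_const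
          (by linarith)
        exact ContinuousAt.div (by fun_prop) (by fun_prop) hpos.ne'
      refine (contDiffAt_const (c := (0 : F))).congr_of_eventuallyEq (hev.mono fun z hz => ?_)
      have : b z = 0 := by
        refine Real.smoothTransition.zero_of_nonpos ?_
        exact mul_nonpos_of_nonpos_of_nonneg (by linarith) (by positivity)
      simp only [this, zero_smul]
    · refine (hb y hy).smul (hf y ⟨?_, inner_lt_norm hp hy hyp⟩)
      rwa [lt_div_iff₀ hpos] at h
  · have hy0 := ne_zero_of_mem_capCone hy.1
    have hpos := norm_pos_iff.2 hy0
    have h1 : (c + 2) / 3 < ⟪p, y⟫ / ‖y‖ := (lt_div_iff₀ hpos).2 hy.1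
    have : b y = 1 := by
      refine Real.smoothTransition.one_of_one_le ?_
      rw [← div_le_iff₀ (by positivity), one_div_div]
      linarith
    simp only [this, one_smul]

/-- Finitely many rays have dense complement. -/
theorem dense_offRays {ι : Type*} [Finite ι] (v : ι → E3) :
    Dense {y : E3 | y ≠ 0 ∧ nrm y ∉ range v} := by
  have hd : ∀ p : E3, Dense ((Submodule.span ℝ {p} : Submodule ℝ E3) : Set E3)ᶜ := by
    intro p
    rw [← interior_eq_empty_iff_dense_compl, Set.eq_empty_iff_forall_notMem]
    intro x hx
    have htop := Submodule.eq_top_of_nonempty_interior' (Submodule.span ℝ {p}) ⟨x, hx⟩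
    have h1 := finrank_span_le_card (R := ℝ) ({p} : Set E3)
    rw [htop] at h1
    simp at h1
  have hopen : ∀ p : E3, IsOpen ((Submodule.span ℝ {p} : Submodule ℝ E3) : Set E3)ᶜ := fun p =>
    (Submodule.closed_of_finiteDimensional _).isOpen_compl
  have h := dense_iInter_of_isOpen (f := fun i : Option ι =>
    ((Submodule.span ℝ {i.elim 0 v} : Submodule ℝ E3) : Set E3)ᶜ) (fun i => hopen _) (fun i => hd _)
  refine h.mono fun y hy => ?_
  rw [mem_iInter] at hy
  refine ⟨by simpa using hy none, ?_⟩
  rintro ⟨i, hi⟩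
  refine hy (some i) ?_
  simp only [Option.elim, hi]
  exact Submodule.mem_span_singleton.2 ⟨‖y‖, norm_smul_nrm y⟩

/-- A form with local primitives away from a nowhere dense set of removable singularities, on the
complement of a ray, has a primitive there. -/
theorem exists_primitive_offRay_of_dense {F : Type*} [NormedAddCommGroup F] [NormedSpace ℝ F]
    [CompleteSpace F] {q : E3} (hq : ‖q‖ = 1) {η : E3 → E3 →L[ℝ] F} {R : Set E3} (hR : Dense R)
    (h : ∀ y ∈ offRay q, ∃ k : E3 → F, ∀ᶠ z in 𝓝 y, ContDiffAt ℝ ∞ k z ∧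
      (z ∈ R → HasFDerivAt k (η z) z)) :
    ∃ K : E3 → F, ∀ y ∈ offRay q, y ∈ R → HasFDerivAt K (η y) y := by
  choose! k hk using h
  obtain ⟨K, hK⟩ := exists_primitive_offRay hq (η := fun y => fderiv ℝ (k y) y) (F := F) (by
    intro y hy
    refine ⟨k y, ?_⟩
    have hev := (hk y hy).eventually_nhds.and ((isOpen_offRay q).mem_nhds hy)
    refine hev.mono fun z hz => ?_
    have h1 := hz.1.self_of_nhds.1
    refine ⟨h1, ?_⟩
    have h2 := (hk z hz.2).self_of_nhds.1
    -- The two derivatives agree on the dense set `R` near `z`, hence at `z`.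
    have hfreq : ∃ᶠ w in 𝓝 z, fderiv ℝ (k z) w = fderiv ℝ (k y) w := by
      have hfr : ∃ᶠ w in 𝓝 z, w ∈ R := mem_closure_iff_frequently.1 (hR z)
      refine (hfr.and_eventually (hz.1.and (hk z hz.2))).mono fun w hw => ?_
      rw [(hw.2.1.2 hw.1).fderiv, (hw.2.2.2 hw.1).fderiv]
    have hc1 : ContinuousAt (fderiv ℝ (k z)) z :=
      (h2.fderiv_right (m := 0) (by norm_cast)).continuousAt
    have hc2 : ContinuousAt (fderiv ℝ (k y)) z :=
      (h1.fderiv_right (m := 0) (by norm_cast)).continuousAt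
    have heq : fderiv ℝ (k z) z = fderiv ℝ (k y) z := by
      by_contra hne
      exact hfreq ((hc1.prodMk hc2).eventually_mem
        (isClosed_diagonal.isOpen_compl.mem_nhds hne))
    change HasFDerivAt (k y) (fderiv ℝ (k z) z) z
    rw [heq]
    exact (h1.differentiableAt (by simp)).hasFDerivAt)
  refine ⟨K, fun y hy hyR => ?_⟩
  have := (hk y hy).self_of_nhds.2 hyR
  rw [← this.fderiv]
  exact hK y hy

section Residues

variable {ι F : Type*} [Fintype ι] [NormedAddCommGroup F] [NormedSpace ℝ F]

/-- The vector-valued one-form `η` on the complement of the rays through the points `v i` is locally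
exact, and near the ray through `v i` it is the sum of the exact form `d (g i)` and of `1 / 2π`
times the differential of the azimuth about `v i` times the vector `a i`, its residue at `v i`. -/
structure HasResidues (v : ι → E3) (a : ι → F) (η : E3 → E3 →L[ℝ] F) (g : ι → E3 → F) : Prop where
  norm_eq : ∀ i, ‖v i‖ = 1
  injective : Function.Injective v
  exact : ∀ y, y ≠ 0 → nrm y ∉ range v → ∃ k, IsPrimitiveNear k η y
  smooth : ∀ i y, y ≠ 0 → nrm y ≠ v i → ContDiffAt ℝ ∞ (g i) y
  residue : ∀ i, ∃ c, 0 ≤ c ∧ c < 1 ∧ ∀ y ∈ punctCone (v i) c,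
    HasFDerivAt (g i) (η y - (1 / (2 * Real.pi)) • (azForm (v i) y).smulRight (a i)) y

/-- The standard one-form with residue `a` at `v` and `-a` at `q`, plus the exact form `d g`. -/
def residueForm (v q : E3) (a : F) (g : E3 → F) (y : E3) : E3 →L[ℝ] F :=
  fderiv ℝ g y + (1 / (4 * Real.pi)) • (areaPot v y - areaPot q y).smulRight a

/-- A closed one-form on the sphere is a sum of standard forms `residueForm`, which move all
residues to a single further pole `q`, and of a form without residues, which is exact off `q`
because a sphere without a point is simply connected. -/
theorem HasResidues.exists_primitive [CompleteSpace F] {v : ι → E3} {a : ι → F}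
    {η : E3 → E3 →L[ℝ] F} {g : ι → E3 → F} (h : HasResidues v a η g) {q : E3} (hq : ‖q‖ = 1) :
    ∃ K : E3 → F, ∀ y, y ≠ 0 → nrm y ∉ range v → nrm y ≠ q →
      HasFDerivAt K (η y - ∑ j, residueForm (v j) q (a j) (g j) y) y := by
  have hv := h.norm_eq
  have hoff : ∀ y, y ∈ offRay (-q) ↔ ⟪q, y⟫ < ‖y‖ := fun y => by
    simp only [offRay, mem_ofPred_eq, inner_neg_left]
    constructor <;> intro h <;> linarith
  have hq' : ‖-q‖ = 1 := by rwa [norm_neg]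
  have key := exists_primitive_offRay_of_dense hq' (dense_offRays v)
    (η := fun y => η y - ∑ j, residueForm (v j) q (a j) (g j) y) (F := F) ?_
  · obtain ⟨K, hK⟩ := key
    exact ⟨K, fun y hy hyv hyq => hK y ((hoff y).2 (inner_lt_norm hq hy hyq)) ⟨hy, hyv⟩⟩
  intro y hy
  rw [hoff] at hy
  have hy0 : y ≠ 0 := by rintro rfl; simp at hy
  have hpiece : ∀ j, ∃ k : E3 → F, nrm y ≠ v j →
      IsPrimitiveNear k (residueForm (v j) q (a j) (g j)) y := by
    intro j
    by_cases hj : nrm y = v j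
    · exact ⟨fun _ => 0, fun h => absurd hj h⟩
    have hlt := inner_lt_norm (hv j) hy0 hj
    obtain ⟨k, hk⟩ := exists_primitive_areaPot_sub (hv j) hq hy0 hlt hy
    refine ⟨fun z => g j z + (1 / (4 * Real.pi)) • k z • a j, fun _ => ?_⟩
    have hev : ∀ᶠ z in 𝓝 y, z ≠ 0 ∧ ⟪v j, z⟫ < ‖z‖ := (eventually_ne_nhds hy0).and
      (ContinuousAt.eventually_lt (f := fun z : E3 => ⟪v j, z⟫) (g := fun z => ‖z‖)
        (by fun_prop) (by fun_prop) hlt)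
    refine ((hk.smul_const (1 / (4 * Real.pi)) (a j)).and hev).mono fun z hz => ?_
    have hg := h.smooth j z hz.2.1 (nrm_ne_of_inner_lt (hv j) hz.2.2)
    exact ⟨hg.add hz.1.1, (hg.differentiableAt (by simp)).hasFDerivAt.add hz.1.2⟩
  choose k hk using hpiece
  by_cases hyv : nrm y ∈ range v
  · obtain ⟨i, hi⟩ := hyv
    obtain ⟨c, hc0, hc1, hc⟩ := h.residue i
    have hcap : y ∈ capCone (v i) c := by
      rw [← nrm_mem_capCone hy0, ← hi]; exact mem_capCone_self (hv i) hc1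
    obtain ⟨k', hk'⟩ := exists_primitive_areaPot_sub hq (v' := -v i) (by rw [norm_neg, hv]) hy0 hy
      (by
        have : c * ‖y‖ < ⟪v i, y⟫ := hcap
        rw [inner_neg_left]
        have := norm_pos_iff.2 hy0
        nlinarith)
    classical
    have hsum : ∀ᶠ z in 𝓝 y, ∀ j ∈ Finset.univ.erase i, ContDiffAt ℝ ∞ (k j) z ∧
        HasFDerivAt (k j) (residueForm (v j) q (a j) (g j) z) z := by
      rw [Filter.eventually_all_finset]
      intro j hj
      refine hk j fun hj' => (Finset.mem_erase.1 hj).1 (h.injective (hj'.symm.trans hi.symm))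
    refine ⟨fun z => (1 / (4 * Real.pi)) • k' z • a i - ∑ j ∈ Finset.univ.erase i, k j z, ?_⟩
    refine (((hk'.smul_const (1 / (4 * Real.pi)) (a i)).and hsum).and
      ((isOpen_capCone _ _).mem_nhds hcap)).mono fun z ⟨⟨hz1, hz2⟩, hz3⟩ => ⟨?_, ?_⟩
    · exact hz1.1.sub (ContDiffAt.sum fun j hj => (hz2 j hj).1)
    · intro hzR
      have hzp : z ∈ punctCone (v i) c :=
        mem_punctCone_of_mem_capCone (hv i) hz3 fun h => hzR.2 ⟨i, h.symm⟩
      refine (hz1.2.sub (HasFDerivAt.fun_sum fun j hj => (hz2 j hj).2)).congr_fderiv ?_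
      rw [← Finset.add_sum_erase _ _ (Finset.mem_univ i)]
      have hz0 := hzR.1
      have hpos : 0 < ⟪v i, z⟫ := by
        have : c * ‖z‖ < ⟪v i, z⟫ := hz3
        have := norm_pos_iff.2 hz0
        nlinarith
      rw [residueForm, (hc z hzp).fderiv,
        azForm_eq hz0 hzp.2 (by linarith [norm_nonneg z])]
      ext u : 1
      simp only [sub_apply, smul_apply, add_apply,
        ContinuousLinearMap.smulRight_apply, smul_eq_mul, smul_smul]
      have : (1 / (2 * Real.pi)) * (1 / 2 * ((areaPot (v i) z) u - (areaPot (-v i) z) u)) =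
        1 / (4 * Real.pi) * ((areaPot (v i) z) u - (areaPot q z) u) +
          1 / (4 * Real.pi) * ((areaPot q z) u - (areaPot (-v i) z) u) := by
        field_simp; ring
      rw [this, add_smul]
      abel
  · obtain ⟨k0, hk0⟩ := h.exact y hy0 hyv
    have hsum : ∀ᶠ z in 𝓝 y, ∀ j ∈ Finset.univ, ContDiffAt ℝ ∞ (k j) z ∧
        HasFDerivAt (k j) (residueForm (v j) q (a j) (g j) z) z := by
      rw [Filter.eventually_all_finset]
      exact fun j _ => hk j fun hj => hyv ⟨j, hj.symm⟩
    refine ⟨fun z => k0 z - ∑ j, k j z, (hk0.and hsum).mono fun z hz => ⟨?_, fun _ => ?_⟩⟩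
    · exact hz.1.1.sub (ContDiffAt.sum fun j hj => (hz.2 j hj).1)
    · exact hz.1.2.sub (HasFDerivAt.fun_sum fun j hj => (hz.2 j hj).2)

theorem exists_unit_notMem_range {ι : Type*} [Finite ι] (v : ι → E3) :
    ∃ q, ‖q‖ = 1 ∧ q ∉ range v := by
  obtain ⟨y, hy0, hy⟩ := (dense_offRays v).nonempty
  exact ⟨nrm y, norm_nrm hy0, hy⟩

/-- A one-form which is a constant vector `b` times the differential of the azimuth near the ray
through `q`, off that ray, is exact there only for `b = 0`. -/
theorem eq_zero_of_hasFDerivAt_azForm {q : E3} (hq : ‖q‖ = 1) {m : E3 → F} {b : F}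
    (hm : ∀ᶠ y in 𝓝 q, nrm y ≠ q → HasFDerivAt m ((azForm q y).smulRight b) y) : b = 0 := by
  obtain ⟨r, hr, hball⟩ := Metric.eventually_nhds_iff_ball.1 hm
  obtain ⟨e, he, hqe⟩ := exists_unit_orthogonal hq
  have hqq := real_inner_self_one hq
  have hee := real_inner_self_one he
  have heq : ⟪e, q⟫ = 0 := by rw [real_inner_comm, hqe]
  have hcc : ⟪cr q e, cr q e⟫ = 1 := by rw [inner_cr_cr, hqq, hee, hqe]; simp
  have hcre : cr q (cr q e) = -e := by rw [cr_cr, hqe, hqq]; simp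
  -- On the circle `γ` about `q` the function `m (γ s) - s • b` is constant, and `γ` has period `2π`.
  set ε := r / 2
  have hε : 0 < ε := by positivity
  set N : ℝ → E3 := fun s => Real.cos s • e + Real.sin s • cr q e
  have hNN : ∀ s, ⟪N s, N s⟫ = 1 := fun s => by
    simp only [N, inner_add_left, inner_add_right, real_inner_smul_left, inner_smul_right, hee, hcc,
      inner_cr_right, inner_right_cr]
    linear_combination Real.sin_sq_add_cos_sq s
  have hqN : ∀ s, ⟪q, N s⟫ = 0 := fun s => by
    simp only [N, inner_add_right, inner_smul_right, hqe, inner_left_cr]; ring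
  have hNd : ∀ s, HasDerivAt N (cr q (N s)) s := fun s => by
    have := ((Real.hasDerivAt_cos s).smul_const e).add ((Real.hasDerivAt_sin s).smul_const (cr q e))
    refine this.congr_deriv ?_
    simp only [N, map_add, map_smul, hcre]
    module
  set γ : ℝ → E3 := fun s => q + ε • N s
  have hγd : ∀ s, HasDerivAt γ (ε • cr q (N s)) s := fun s => ((hNd s).const_smul ε).const_add q
  have hqγ : ∀ s, ⟪q, γ s⟫ = 1 := fun s => by
    simp only [γ, inner_add_right, inner_smul_right, hqq, hqN]; ring
  have hnγ : ∀ s, ‖γ s‖ ^ 2 = 1 + ε ^ 2 := fun s => by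
    rw [← real_inner_self_eq_norm_sq]
    simp only [γ, inner_add_left, inner_add_right, real_inner_smul_left, inner_smul_right, hqq, hqN,
      hNN, real_inner_comm q (N s)]
    ring
  have hd : ∀ s, HasDerivAt (fun s => m (γ s) - s • b) 0 s := by
    intro s
    have hmem : γ s ∈ Metric.ball q r := by
      have hN1 : ‖N s‖ = 1 := by
        rw [← pow_eq_one_iff_of_nonneg (norm_nonneg _) two_ne_zero, ← real_inner_self_eq_norm_sq, hNN]
      rw [Metric.mem_ball, dist_eq_norm]
      simp only [γ, add_sub_cancel_left, norm_smul, hN1, Real.norm_of_nonneg hε.le, ε]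
      linarith
    have hne : nrm (γ s) ≠ q := by
      refine nrm_ne_of_inner_lt hq ?_
      rw [hqγ]
      exact lt_of_pow_lt_pow_left₀ 2 (norm_nonneg _) (by rw [hnγ]; nlinarith)
    have h1 := (hball _ hmem hne).comp_hasDerivAt s (hγd s)
    have h2 := h1.sub ((hasDerivAt_id s).smul_const b)
    refine h2.congr_deriv ?_
    have h3 : azForm q (γ s) (ε • cr q (N s)) = 1 := by
      have : cr q (γ s) = ε • cr q (N s) := by simp [γ, cr_self]
      rw [azForm_apply, this, hnγ, hqγ, real_inner_smul_left, inner_smul_right, inner_cr_cr, hqq,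
        hNN, hqN]
      field_simp
      ring
    rw [ContinuousLinearMap.smulRight_apply, h3]
    simp
  have hconst := is_const_of_deriv_eq_zero (fun s => (hd s).differentiableAt)
    (fun s => (hd s).deriv) 0 (2 * Real.pi)
  have hper : γ (2 * Real.pi) = γ 0 := by simp [γ, N]
  simp only [hper, zero_smul, sub_zero] at hconst
  have : (2 * Real.pi) • b = 0 := by
    have := congrArg (fun z => m (γ 0) - z) hconst
    simpa using this.symm
  exact (smul_eq_zero.1 this).resolve_left (by positivity)

/-- The residue theorem on the sphere: the residues of a closed one-form sum to zero. -/
theorem HasResidues.sum_eq_zero [CompleteSpace F] {v : ι → E3} {a : ι → F}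
    {η : E3 → E3 →L[ℝ] F} {g : ι → E3 → F} (h : HasResidues v a η g) : ∑ j, a j = 0 := by
  have hv := h.norm_eq
  -- At `q` the form `η` is regular, while the standard forms have the residue `-∑ j, a j` there.
  obtain ⟨q, hq, hqv⟩ := exists_unit_notMem_range v
  obtain ⟨K, hK⟩ := h.exists_primitive hq
  have hq0 := ne_zero_of_norm_one hq
  have hqn : nrm q = q := nrm_of_norm_one hq
  obtain ⟨k0, hk0⟩ := h.exact q hq0 (by rwa [hqn])
  have hjq : ∀ j, ⟪v j, q⟫ < ‖q‖ := fun j =>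
    inner_lt_norm (hv j) hq0 (by rw [hqn]; exact fun h => hqv ⟨j, h.symm⟩)
  have hk : ∀ j, ∃ k, IsPrimitiveNear k (fun z => areaPot (v j) z - areaPot (-q) z) q := fun j =>
    exists_primitive_areaPot_sub (hv j) (by rwa [norm_neg]) hq0 (hjq j)
      (by rw [inner_neg_left, real_inner_self_one hq, hq]; norm_num)
  choose k hk using hk
  have hev : ∀ᶠ y in 𝓝 q, y ≠ 0 ∧ 0 < ⟪q, y⟫ ∧ ∀ j, ⟪v j, y⟫ < ‖y‖ := by
    refine (eventually_ne_nhds hq0).and (Filter.Eventually.and ?_ ?_)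
    · exact ContinuousAt.eventually_lt (f := fun _ : E3 => (0 : ℝ)) (g := fun z => ⟪q, z⟫)
        (by fun_prop) (by fun_prop) (by rw [real_inner_self_one hq]; norm_num)
    · exact Filter.eventually_all.2 fun j => ContinuousAt.eventually_lt
        (f := fun z : E3 => ⟪v j, z⟫) (g := fun z => ‖z‖) (by fun_prop) (by fun_prop) (hjq j)
  have hkall := Filter.eventually_all.2 hk
  have hb : (-(1 / (2 * Real.pi))) • ∑ j, a j = 0 := by
    refine eq_zero_of_hasFDerivAt_azForm hq (m := fun y => k0 y - K y -
      ∑ j, (g j y + (1 / (4 * Real.pi)) • k j y • a j)) ?_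
    filter_upwards [hk0, hev, hkall] with y hy0 hy1 hyk hyq
    have hyv : ∀ j, nrm y ≠ v j := fun j => nrm_ne_of_inner_lt (hv j) (hy1.2.2 j)
    have hKy := hK y hy1.1 (by rintro ⟨j, hj⟩; exact hyv j hj.symm) hyq
    have hg : ∀ j, HasFDerivAt (g j) (fderiv ℝ (g j) y) y := fun j =>
      ((h.smooth j y hy1.1 (hyv j)).differentiableAt (by simp)).hasFDerivAt
    refine ((hy0.2.sub hKy).sub (HasFDerivAt.fun_sum fun j _ => (hg j).add
      (((hyk j).2.smul_const (a j)).const_smul (1 / (4 * Real.pi))))).congr_fderiv ?_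
    have hlt := inner_lt_norm hq hy1.1 hyq
    ext u : 1
    simp only [residueForm, sub_apply, smul_apply, add_apply, sum_apply,
      ContinuousLinearMap.smulRight_apply, azForm_eq hy1.1 hlt (by linarith [hy1.2.1])]
    rw [sub_sub_cancel, ← Finset.sum_sub_distrib, Finset.smul_sum, Finset.smul_sum]
    refine Finset.sum_congr rfl fun j _ => ?_
    rw [add_sub_add_left_eq_sub, smul_smul, smul_smul, smul_smul, ← sub_smul]
    congr 1
    simp only [smul_eq_mul]
    field_simp
    ring
  refine (smul_eq_zero.1 hb).resolve_left ?_
  have := Real.pi_pos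
  simp

end Residues

/-! ### Homogeneous vector fields and the deformations they generate -/

section Rigidity

variable {E : Type*} [NormedAddCommGroup E] [InnerProductSpace ℝ E]

theorem isSymmSndFDerivAt_of_smooth {F : Type*} [NormedAddCommGroup F] [NormedSpace ℝ F] {X : E → F}
    {y : E} (h : ContDiffAt ℝ ∞ X y) : IsSymmSndFDerivAt ℝ X y :=
  (h.of_le (by norm_cast) : ContDiffAt ℝ 2 X y).isSymmSndFDerivAt (by simp)

theorem differentiableAt_fderiv {E F : Type*} [NormedAddCommGroup E] [NormedSpace ℝ E]
    [NormedAddCommGroup F] [NormedSpace ℝ F] {X : E → F}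
    {y : E} (h : ContDiffAt ℝ ∞ X y) : DifferentiableAt ℝ (fderiv ℝ X) y :=
  (h.fderiv_right (m := 1) (by norm_cast)).differentiableAt (by simp)

/-- The second derivative of a Killing field of a Euclidean space vanishes. -/
theorem fderiv_fderiv_eq_zero_of_skew {X : E → E} {y : E} (hX : ContDiffAt ℝ ∞ X y)
    (h : ∀ᶠ z in 𝓝 y, ∀ u w, ⟪fderiv ℝ X z u, w⟫ + ⟪u, fderiv ℝ X z w⟫ = 0) :
    fderiv ℝ (fderiv ℝ X) y = 0 := by
  have hd := (differentiableAt_fderiv hX).hasFDerivAt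
  have hS := eq_zero_of_symm_of_skew (S := fun a b c => ⟪fderiv ℝ (fderiv ℝ X) y a b, c⟫)
    (fun a b c => by rw [isSymmSndFDerivAt_of_smooth hX a b]) (fun a b c => ?_)
  · ext a b
    exact ext_inner_right ℝ fun c => by simpa using hS a b c
  · have h1 : HasFDerivAt (fun z => ⟪fderiv ℝ X z b, c⟫ + ⟪b, fderiv ℝ X z c⟫) _ y :=
      ((hd.clm_apply (hasFDerivAt_const b y)).inner ℝ (hasFDerivAt_const c y)).add
        ((hasFDerivAt_const b y).inner ℝ (hd.clm_apply (hasFDerivAt_const c y)))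
    have h2 : HasFDerivAt (fun z => ⟪fderiv ℝ X z b, c⟫ + ⟪b, fderiv ℝ X z c⟫)
        (0 : E →L[ℝ] ℝ) y :=
      (hasFDerivAt_const (0 : ℝ) y).congr_of_eventuallyEq (h.mono fun z hz => hz b c)
    have h3 := congrArg (fun L => L a) (h1.unique h2)
    simp at h3
    rw [real_inner_comm b]
    linarith

/-- The second derivative of a local isometry of a Euclidean space vanishes. -/
theorem fderiv_fderiv_eq_zero_of_isometry [FiniteDimensional ℝ E] {X : E → E} {y : E}
    (hX : ContDiffAt ℝ ∞ X y)
    (h : ∀ᶠ z in 𝓝 y, ∀ u w, ⟪fderiv ℝ X z u, fderiv ℝ X z w⟫ = ⟪u, w⟫) :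
    fderiv ℝ (fderiv ℝ X) y = 0 := by
  have hd := (differentiableAt_fderiv hX).hasFDerivAt
  have hS := eq_zero_of_symm_of_skew
    (S := fun a b c => ⟪fderiv ℝ (fderiv ℝ X) y a b, fderiv ℝ X y c⟫)
    (fun a b c => by rw [isSymmSndFDerivAt_of_smooth hX a b]) (fun a b c => ?_)
  · have hinj : Function.Injective (fderiv ℝ X y).toLinearMap := by
      rw [← LinearMap.ker_eq_bot, LinearMap.ker_eq_bot']
      intro u hu
      have := h.self_of_nhds u u
      have hu' : fderiv ℝ X y u = 0 := hu
      rw [hu', inner_zero_left] at this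
      exact inner_self_eq_zero.1 this.symm
    have hsurj := LinearMap.injective_iff_surjective.1 hinj
    ext a b
    refine ext_inner_right ℝ fun c => ?_
    obtain ⟨d, hd⟩ := hsurj c
    have hd' : fderiv ℝ X y d = c := hd
    rw [← hd']
    simpa using hS a b d
  · have h1 : HasFDerivAt (fun z => ⟪fderiv ℝ X z b, fderiv ℝ X z c⟫) _ y :=
      (hd.clm_apply (hasFDerivAt_const b y)).inner ℝ (hd.clm_apply (hasFDerivAt_const c y))
    have h2 : HasFDerivAt (fun z => ⟪fderiv ℝ X z b, fderiv ℝ X z c⟫)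
        (0 : E →L[ℝ] ℝ) y :=
      (hasFDerivAt_const ⟪b, c⟫ y).congr_of_eventuallyEq (h.mono fun z hz => hz b c)
    have h3 := congrArg (fun L => L a) (h1.unique h2)
    simp at h3
    rw [real_inner_comm _ (fderiv ℝ (fderiv ℝ X) y a c)]
    linarith

end Rigidity

/-- The first-order variation at angle `2π` of the cone metric with apex `v`, for unit variation of
the angle, extended to a radially invariant tensor field off the axis of `v`. -/
def coneTerm (v y u w : E3) : ℝ :=
  1 / Real.pi * (⟪cr v y, u⟫ * ⟪cr v y, w⟫ / (‖y‖ ^ 2 - ⟪v, y⟫ ^ 2))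

/-- The smooth vector field `X` on `O ⊆ ℝ³` is tangent to the spheres about the origin and satisfies
Euler's relation for homogeneity of degree one, and the Lie derivative along `X` of the Euclidean
metric is `H`. Such fields are the homogeneous extensions of tangent fields of the sphere. -/
structure IsLocalField (H : E3 → E3 → E3 → ℝ) (X : E3 → E3) (O : Set E3) : Prop where
  smooth : ∀ y ∈ O, ContDiffAt ℝ ∞ X y
  tangent : ∀ y ∈ O, ⟪y, X y⟫ = 0
  euler : ∀ y ∈ O, fderiv ℝ X y y = X y
  sym : ∀ y ∈ O, ∀ u w, ⟪fderiv ℝ X y u, w⟫ + ⟪u, fderiv ℝ X y w⟫ = H y u w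

/-- Half the curl of a vector field. It is constant for Killing fields. -/
def halfCurl (X : E3 → E3) (y : E3) : E3 := axial (fderiv ℝ X y)

theorem IsLocalField.mono {H : E3 → E3 → E3 → ℝ} {X : E3 → E3} {O O' : Set E3}
    (h : IsLocalField H X O) (hO : O' ⊆ O) : IsLocalField H X O' :=
  ⟨fun y hy => h.smooth y (hO hy), fun y hy => h.tangent y (hO hy), fun y hy => h.euler y (hO hy),
    fun y hy => h.sym y (hO hy)⟩

theorem contDiffAt_halfCurl {X : E3 → E3} {y : E3} (h : ContDiffAt ℝ ∞ X y) :
    ContDiffAt ℝ ∞ (halfCurl X) y :=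
  axial.contDiff.contDiffAt.comp y (h.fderiv_right (by simp))

/-- A local field is recovered from its half curl, a field of angular velocities. -/
theorem IsLocalField.cr_halfCurl {H : E3 → E3 → E3 → ℝ} {X : E3 → E3} {O : Set E3}
    (h : IsLocalField H X O) (hO : IsOpen O) {y : E3} (hy : y ∈ O) :
    cr (halfCurl X y) y = X y := by
  refine cr_axial_apply (h.euler y hy) fun w => ?_
  have hd := ((h.smooth y hy).differentiableAt (by simp)).hasFDerivAt
  have h1 : HasFDerivAt (fun z => ⟪z, X z⟫) _ y := (hasFDerivAt_id y).inner ℝ hd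
  have h2 : HasFDerivAt (fun z => ⟪z, X z⟫) (0 : E3 →L[ℝ] ℝ) y :=
    (hasFDerivAt_const (0 : ℝ) y).congr_of_eventuallyEq
      (Filter.mem_of_superset (hO.mem_nhds hy) fun z hz => h.tangent z hz)
  have h3 := congrArg (fun L => L w) (h1.unique h2)
  simp at h3
  rw [real_inner_comm w]
  linarith

theorem IsLocalField.sub {H₁ H₂ : E3 → E3 → E3 → ℝ} {X₁ X₂ : E3 → E3} {O : Set E3}
    (h₁ : IsLocalField H₁ X₁ O) (h₂ : IsLocalField H₂ X₂ O) :
    IsLocalField (fun y u w => H₁ y u w - H₂ y u w) (fun y => X₁ y - X₂ y) O := by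
  have hf : ∀ y ∈ O, fderiv ℝ (fun y => X₁ y - X₂ y) y = fderiv ℝ X₁ y - fderiv ℝ X₂ y :=
    fun y hy => fderiv_fun_sub ((h₁.smooth y hy).differentiableAt (by simp))
      ((h₂.smooth y hy).differentiableAt (by simp))
  refine ⟨fun y hy => (h₁.smooth y hy).sub (h₂.smooth y hy), fun y hy => ?_, fun y hy => ?_,
    fun y hy u w => ?_⟩
  · rw [inner_sub_right, h₁.tangent y hy, h₂.tangent y hy, sub_zero]
  · rw [hf y hy, sub_apply, h₁.euler y hy, h₂.euler y hy]
  · rw [hf y hy, ← h₁.sym y hy, ← h₂.sym y hy]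
    simp only [sub_apply, inner_sub_left, inner_sub_right]
    ring

/-- The derivative of the curl of a field depends only on the deformation the field generates. -/
theorem IsLocalField.fderiv_halfCurl_eq {H : E3 → E3 → E3 → ℝ} {X₁ X₂ : E3 → E3} {O₁ O₂ : Set E3}
    (h₁ : IsLocalField H X₁ O₁) (h₂ : IsLocalField H X₂ O₂) (hO₁ : IsOpen O₁) (hO₂ : IsOpen O₂)
    {y : E3} (hy₁ : y ∈ O₁) (hy₂ : y ∈ O₂) :
    fderiv ℝ (halfCurl X₁) y = fderiv ℝ (halfCurl X₂) y := by
  have h := (h₁.mono inter_subset_left).sub (h₂.mono (O' := O₁ ∩ O₂) inter_subset_right)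
  have hy : y ∈ O₁ ∩ O₂ := ⟨hy₁, hy₂⟩
  have hO := (hO₁.inter hO₂).mem_nhds hy
  have h0 := fderiv_fderiv_eq_zero_of_skew (h.smooth y hy)
    (Filter.mem_of_superset hO fun z hz u w => by rw [h.sym z hz, sub_self])
  have hev : fderiv ℝ (fun z => X₁ z - X₂ z) =ᶠ[𝓝 y] fun z => fderiv ℝ X₁ z - fderiv ℝ X₂ z :=
    Filter.mem_of_superset hO fun z hz => fderiv_fun_sub
      ((h₁.smooth z hz.1).differentiableAt (by simp)) ((h₂.smooth z hz.2).differentiableAt (by simp))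
  have hd₁ := differentiableAt_fderiv (h₁.smooth y hy₁)
  have hd₂ := differentiableAt_fderiv (h₂.smooth y hy₂)
  rw [hev.fderiv_eq, fderiv_fun_sub hd₁ hd₂, sub_eq_zero] at h0
  have e₁ := (axial.hasFDerivAt.comp y hd₁.hasFDerivAt).fderiv
  have e₂ := (axial.hasFDerivAt.comp y hd₂.hasFDerivAt).fderiv
  change fderiv ℝ (axial ∘ fderiv ℝ X₁) y = fderiv ℝ (axial ∘ fderiv ℝ X₂) y
  rw [e₁, e₂, h0]

/-- The single-valued part of the half curl of the field `φ / 2π (v × y)`, for `φ` the azimuth. -/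
def rotCurl (v y : E3) : E3 := (1 / (2 * Real.pi)) • axial ((azForm v y).smulRight (cr v y))

theorem contDiffAt_rotCurl {v y : E3} (h : ⟪v, y⟫ ^ 2 < ‖y‖ ^ 2) : ContDiffAt ℝ ∞ (rotCurl v) y := by
  have h1 : ContDiffAt ℝ ∞ (fun z => (azForm v z).smulRight (cr v z)) y :=
    (contDiffAt_azForm h).smulRight (cr v).contDiff.contDiffAt
  exact (axial.contDiff.contDiffAt.comp y h1).const_smul _

/-- Off the axis of `v` the variation of the cone angle is generated by a multi-valued field of
rotations about `v`. -/
theorem exists_isLocalField_coneTerm {v y : E3} (hv : ‖v‖ = 1) (h : ⟪v, y⟫ ^ 2 < ‖y‖ ^ 2) :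
    ∃ Z O, IsOpen O ∧ y ∈ O ∧ IsLocalField (coneTerm v) Z O ∧ HasFDerivAt (halfCurl Z)
      (fderiv ℝ (rotCurl v) y + (1 / (2 * Real.pi)) • (azForm v y).smulRight v) y := by
  obtain ⟨k, hk⟩ := exists_azimuth hv h
  have hev : ∀ᶠ z : E3 in 𝓝 y, ⟪v, z⟫ ^ 2 < ‖z‖ ^ 2 :=
    ContinuousAt.eventually_lt (f := fun z : E3 => ⟪v, z⟫ ^ 2) (g := fun z => ‖z‖ ^ 2)
        (by fun_prop) (by fun_prop) h
  obtain ⟨O, hO, hOo, hyO⟩ := eventually_nhds_iff.1 (hk.and hev)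
  have hd : ∀ z ∈ O, HasFDerivAt (fun z => (1 / (2 * Real.pi)) • k z • cr v z)
      ((1 / (2 * Real.pi)) • (k z • cr v + (azForm v z).smulRight (cr v z))) z := fun z hz =>
    ((hO z hz).1.2.fun_smul (cr v).hasFDerivAt).fun_const_smul _
  refine ⟨fun z => (1 / (2 * Real.pi)) • k z • cr v z, O, hOo, hyO,
    ⟨fun z hz => ?_, fun z hz => ?_, fun z hz => ?_, fun z hz u w => ?_⟩, ?_⟩
  · exact ((hO z hz).1.1.smul (cr v).contDiff.contDiffAt).const_smul _
  · simp [inner_smul_right, inner_right_cr]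
  · rw [(hd z hz).fderiv]
    simp [azForm_self]
  · rw [(hd z hz).fderiv]
    simp only [smul_apply, add_apply, ContinuousLinearMap.smulRight_apply, inner_add_left,
      inner_add_right, real_inner_smul_left, inner_smul_right, azForm_apply, coneTerm,
      inner_cr_skew v u w, real_inner_comm (cr v z) u]
    have : ‖z‖ ^ 2 - ⟪v, z⟫ ^ 2 ≠ 0 := by linarith [(hO z hz).2]
    field_simp
    ring
  · have he : halfCurl (fun z => (1 / (2 * Real.pi)) • k z • cr v z) =ᶠ[𝓝 y]
        fun z => rotCurl v z + (1 / (2 * Real.pi)) • k z • v := by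
      refine Filter.mem_of_superset (hOo.mem_nhds hyO) fun z hz => ?_
      simp only [mem_ofPred_eq, halfCurl, (hd z hz).fderiv, map_smul, map_add, axial_cr, rotCurl]
      module
    refine HasFDerivAt.congr_of_eventuallyEq ?_ he
    exact ((contDiffAt_rotCurl h).differentiableAt (by simp)).hasFDerivAt.add
      (((hO y hyO).1.2.smul_const v).fun_const_smul _)

/-! ### Deformations in terms of local vector fields -/

/-- The radially invariant tensor field `H` on the cone over `S² \ {v i}` has the local structure of
a first-order cone deformation: it is locally a Lie derivative of the metric, up to the multiple
`τ i` of the variation of the cone metric near `v i`, where the field tends to zero at `v i`. -/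
structure HasLocalForm {ι : Type*} (v : ι → E3) (τ : ι → ℝ) (H : E3 → E3 → E3 → ℝ) : Prop where
  regular : ∀ p, ‖p‖ = 1 → p ∉ range v → ∃ c X, 0 ≤ c ∧ c < 1 ∧ IsLocalField H X (capCone p c) ∧
    ∀ j, v j ∉ capCone p c
  cone : ∀ i, ∃ c Y, 0 ≤ c ∧ c < 1 ∧
    IsLocalField (fun y u w => H y u w - τ i * coneTerm (v i) y u w) Y (punctCone (v i) c) ∧
    (∀ j, v j ∉ punctCone (v i) c) ∧ Tendsto Y (𝓝[S2 \ {v i}] (v i)) (𝓝 0)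

theorem HasLocalForm.sub {ι : Type*} {v : ι → E3} {τ₁ τ₂ : ι → ℝ}
    {H₁ H₂ : E3 → E3 → E3 → ℝ} (h₁ : HasLocalForm v τ₁ H₁) (h₂ : HasLocalForm v τ₂ H₂) :
    HasLocalForm v (fun i => τ₁ i - τ₂ i) (fun y u w => H₁ y u w - H₂ y u w) := by
  refine ⟨fun p hp hpv => ?_, fun i => ?_⟩
  · obtain ⟨c₁, X₁, h10, h11, hX₁, hv₁⟩ := h₁.regular p hp hpv
    obtain ⟨c₂, X₂, h20, h21, hX₂, hv₂⟩ := h₂.regular p hp hpv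
    refine ⟨max c₁ c₂, fun y => X₁ y - X₂ y, le_max_of_le_left h10, max_lt h11 h21,
      (hX₁.mono (capCone_anti (le_max_left _ _))).sub (hX₂.mono (capCone_anti (le_max_right _ _))),
      fun j hj => hv₁ j (capCone_anti (le_max_left _ _) hj)⟩
  · obtain ⟨c₁, X₁, h10, h11, hX₁, hv₁, ht₁⟩ := h₁.cone i
    obtain ⟨c₂, X₂, h20, h21, hX₂, hv₂, ht₂⟩ := h₂.cone i
    refine ⟨max c₁ c₂, fun y => X₁ y - X₂ y, le_max_of_le_left h10, max_lt h11 h21, ?_,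
      fun j hj => hv₁ j (punctCone_anti (le_max_left _ _) hj), by simpa using ht₁.sub ht₂⟩
    have := (hX₁.mono (punctCone_anti (le_max_left _ _))).sub
      (hX₂.mono (punctCone_anti (le_max_right c₁ _)))
    refine ⟨this.smooth, this.tangent, this.euler, fun y hy u w => ?_⟩
    rw [this.sym y hy]
    ring

theorem inner_sq_lt_of_mem_punctCone {p y : E3} {c : ℝ} (hc : 0 ≤ c) (h : y ∈ punctCone p c) :
    ⟪p, y⟫ ^ 2 < ‖y‖ ^ 2 := by
  refine abs_inner_lt_iff.2 ⟨h.2, ?_⟩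
  have : c * ‖y‖ < ⟪p, y⟫ := h.1
  have := mul_nonneg hc (norm_nonneg y)
  linarith [norm_nonneg y]

/-- A deformation determines a closed one-form, the derivative of the half curl of the local fields
that generate it. Near a cone point it is exact up to the residue coming from the cone angle. -/
theorem HasLocalForm.exists_form {ι : Type*} {v : ι → E3} {τ : ι → ℝ} {H : E3 → E3 → E3 → ℝ}
    (h : HasLocalForm v τ H) (hv : ∀ i, ‖v i‖ = 1) :
    ∃ η : E3 → E3 →L[ℝ] E3,
      (∀ p c X, IsLocalField H X (capCone p c) → ∀ y ∈ capCone p c, nrm y ∉ range v →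
        HasFDerivAt (halfCurl X) (η y) y) ∧
      ∀ i c Y, 0 ≤ c → IsLocalField (fun y u w => H y u w - τ i * coneTerm (v i) y u w) Y
        (punctCone (v i) c) → ∀ y ∈ punctCone (v i) c, nrm y ∉ range v →
          HasFDerivAt (fun z => halfCurl Y z + τ i • rotCurl (v i) z)
            (η y - (1 / (2 * Real.pi)) • (azForm (v i) y).smulRight (τ i • v i)) y := by
  have hreg := h.regular
  choose! c X hc0 hc1 hX hvc using hreg
  have hmem : ∀ y, y ≠ 0 → nrm y ∉ range v → y ∈ capCone (nrm y) (c (nrm y)) := fun y hy hyv => by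
    rw [← nrm_mem_capCone hy]
    exact mem_capCone_self (norm_nrm hy) (hc1 _ (norm_nrm hy) hyv)
  refine ⟨fun y => fderiv ℝ (halfCurl (X (nrm y))) y, fun p c' X' hX' y hy hyv => ?_,
    fun i c' Y hc' hY y hy hyv => ?_⟩
  · have hy0 := ne_zero_of_mem_capCone hy
    dsimp only
    rw [(hX _ (norm_nrm hy0) hyv).fderiv_halfCurl_eq hX' (isOpen_capCone _ _) (isOpen_capCone _ _)
      (hmem y hy0 hyv) hy]
    exact ((contDiffAt_halfCurl (hX'.smooth y hy)).differentiableAt (by simp)).hasFDerivAt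
  · have hy0 := ne_zero_of_mem_capCone hy.1
    have hlt := inner_sq_lt_of_mem_punctCone hc' hy
    obtain ⟨Z, O, hO, hyO, hZ, hZd⟩ := exists_isLocalField_coneTerm (hv i) hlt
    have hXy := hX _ (norm_nrm hy0) hyv
    have hmy := hmem y hy0 hyv
    -- On the overlap of the domains, `Y + τ i • Z` generates `H`.
    have hsum : IsLocalField H (fun z => Y z + τ i • Z z) (punctCone (v i) c' ∩ O) := by
      have hf : ∀ z ∈ punctCone (v i) c' ∩ O, fderiv ℝ (fun z => Y z + τ i • Z z) z =
          fderiv ℝ Y z + τ i • fderiv ℝ Z z := fun z hz =>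
        (((hY.smooth z hz.1).differentiableAt (by simp)).hasFDerivAt.add
          (((hZ.smooth z hz.2).differentiableAt (by simp)).hasFDerivAt.fun_const_smul (τ i))).fderiv
      refine ⟨fun z hz => (hY.smooth z hz.1).add ((hZ.smooth z hz.2).const_smul _),
        fun z hz => ?_, fun z hz => ?_, fun z hz u w => ?_⟩
      · rw [inner_add_right, inner_smul_right, hY.tangent z hz.1, hZ.tangent z hz.2]; simp
      · rw [hf z hz, add_apply, smul_apply, hY.euler z hz.1, hZ.euler z hz.2]
      · have e1 := hY.sym z hz.1 u w
        have e2 := hZ.sym z hz.2 u w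
        rw [hf z hz]
        simp only [add_apply, smul_apply, inner_add_left, inner_add_right, real_inner_smul_left,
          inner_smul_right]
        linear_combination e1 + τ i * e2
    have hopen := (isOpen_punctCone (v i) c').inter hO
    have heq := hXy.fderiv_halfCurl_eq hsum (isOpen_capCone _ _) hopen hmy ⟨hy, hyO⟩
    have hYd : HasFDerivAt (halfCurl Y) (fderiv ℝ (halfCurl Y) y) y :=
      ((contDiffAt_halfCurl (hY.smooth y hy)).differentiableAt (by simp)).hasFDerivAt
    have hev : halfCurl (fun z => Y z + τ i • Z z) =ᶠ[𝓝 y]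
        fun z => halfCurl Y z + τ i • halfCurl Z z := by
      refine Filter.mem_of_superset (hopen.mem_nhds ⟨hy, hyO⟩) fun z hz => ?_
      have hf := ((hY.smooth z hz.1).differentiableAt (by simp)).hasFDerivAt.fun_add
          (((hZ.smooth z hz.2).differentiableAt (by simp)).hasFDerivAt.fun_const_smul (τ i))
      change axial (fderiv ℝ (fun z => Y z + τ i • Z z) z) = _
      rw [hf.fderiv, map_add, map_smul]
      rfl
    rw [hev.fderiv_eq, (hYd.fun_add (hZd.fun_const_smul (τ i))).fderiv] at heq
    dsimp only
    rw [heq]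
    have hr := (((contDiffAt_rotCurl hlt).differentiableAt (by simp)).hasFDerivAt.fun_const_smul
      (τ i))
    refine (hYd.add hr).congr_fderiv ?_
    ext u : 1
    simp only [add_apply, sub_apply, smul_apply, ContinuousLinearMap.smulRight_apply]
    module

/-- The residue theorem applies to a deformation, with residue `τ i • v i` at `v i`. -/
theorem HasLocalForm.exists_hasResidues {ι : Type*} [Fintype ι] {v : ι → E3} {τ : ι → ℝ}
    {H : E3 → E3 → E3 → ℝ} (h : HasLocalForm v τ H) (hv : ∀ i, ‖v i‖ = 1)
    (hinj : Function.Injective v) :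
    ∃ (η : E3 → E3 →L[ℝ] E3) (g : ι → E3 → E3), HasResidues v (fun i => τ i • v i) η g ∧
      (∀ p, ‖p‖ = 1 → p ∉ range v → ∃ c X, 0 ≤ c ∧ c < 1 ∧ IsLocalField H X (capCone p c) ∧
        ∀ y ∈ capCone p c, nrm y ∉ range v ∧ HasFDerivAt (halfCurl X) (η y) y) ∧
      ∀ i, ∃ c Y, 0 ≤ c ∧ c < 1 ∧
        IsLocalField (fun y u w => H y u w - τ i * coneTerm (v i) y u w) Y (punctCone (v i) c) ∧
        Tendsto Y (𝓝[S2 \ {v i}] (v i)) (𝓝 0) ∧ ∀ y ∈ punctCone (v i) c, nrm y ∉ range v ∧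
          HasFDerivAt (fun z => halfCurl Y z + τ i • rotCurl (v i) z)
            (η y - (1 / (2 * Real.pi)) • (azForm (v i) y).smulRight (τ i • v i)) y := by
  obtain ⟨η, hη1, hη2⟩ := h.exists_form hv
  have hregular : ∀ p, ‖p‖ = 1 → p ∉ range v → ∃ c X, 0 ≤ c ∧ c < 1 ∧
      IsLocalField H X (capCone p c) ∧
        ∀ y ∈ capCone p c, nrm y ∉ range v ∧ HasFDerivAt (halfCurl X) (η y) y := by
    intro p hp hpv
    obtain ⟨c, X, h0, h1, hX, hvc⟩ := h.regular p hp hpv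
    refine ⟨c, X, h0, h1, hX, fun y hy => ?_⟩
    have hyv : nrm y ∉ range v := by
      rintro ⟨j, hj⟩
      refine hvc j ?_
      rw [hj, nrm_mem_capCone (ne_zero_of_mem_capCone hy)]; exact hy
    exact ⟨hyv, hη1 p c X hX y hy hyv⟩
  have hcone : ∀ i, ∃ c Y, 0 ≤ c ∧ c < 1 ∧
      IsLocalField (fun y u w => H y u w - τ i * coneTerm (v i) y u w) Y (punctCone (v i) c) ∧
        Tendsto Y (𝓝[S2 \ {v i}] (v i)) (𝓝 0) ∧ ∀ y ∈ punctCone (v i) c, nrm y ∉ range v ∧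
          HasFDerivAt (fun z => halfCurl Y z + τ i • rotCurl (v i) z)
            (η y - (1 / (2 * Real.pi)) • (azForm (v i) y).smulRight (τ i • v i)) y := by
    intro i
    obtain ⟨c, Y, h0, h1, hY, hvc, ht⟩ := h.cone i
    refine ⟨c, Y, h0, h1, hY, ht, fun y hy => ?_⟩
    have hyv : nrm y ∉ range v := by
      rintro ⟨j, hj⟩
      refine hvc j ?_
      rw [hj, nrm_mem_punctCone (ne_zero_of_mem_capCone hy.1)]; exact hy
    exact ⟨hyv, hη2 i c Y h0 hY y hy hyv⟩
  choose c Y hc0 hc1 hY ht hYd using hcone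
  have hcut : ∀ i, ∃ g : E3 → E3, (∀ y, y ≠ 0 → nrm y ≠ v i → ContDiffAt ℝ ∞ g y) ∧
      ∃ c', c i ≤ c' ∧ c' < 1 ∧ ∀ y ∈ punctCone (v i) c',
        g y = halfCurl (Y i) y + τ i • rotCurl (v i) y := fun i =>
    exists_cutoff (hv i) (hc1 i) fun y hy => (contDiffAt_halfCurl ((hY i).smooth y hy)).add
      ((contDiffAt_rotCurl (inner_sq_lt_of_mem_punctCone (hc0 i) hy)).const_smul _)
  choose g hg c' hcc' hc'1 hgf using hcut
  refine ⟨η, g, ⟨hv, hinj, fun y hy hyv => ?_, hg, fun i => ?_⟩, hregular, fun i =>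
    ⟨c i, Y i, hc0 i, hc1 i, hY i, ht i, hYd i⟩⟩
  · obtain ⟨c, X, h0, h1, hX, hXd⟩ := hregular (nrm y) (norm_nrm hy) hyv
    refine ⟨halfCurl X, Filter.mem_of_superset ((isOpen_capCone (nrm y) c).mem_nhds ?_)
      fun z hz => ⟨contDiffAt_halfCurl (hX.smooth z hz), (hXd z hz).2⟩⟩
    rw [← nrm_mem_capCone hy]; exact mem_capCone_self (norm_nrm hy) h1
  · refine ⟨c' i, (hc0 i).trans (hcc' i), hc'1 i, fun y hy => ?_⟩
    refine (hYd i y (punctCone_anti (hcc' i) hy)).2.congr_of_eventuallyEq ?_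
    exact Filter.mem_of_superset ((isOpen_punctCone _ _).mem_nhds hy) (hgf i)

/-- The balance of the cone angles is the residue theorem for the one-form of a deformation. -/
theorem HasLocalForm.sum_smul_eq_zero {ι : Type*} [Fintype ι] {v : ι → E3} {τ : ι → ℝ}
    {H : E3 → E3 → E3 → ℝ} (h : HasLocalForm v τ H) (hv : ∀ i, ‖v i‖ = 1)
    (hinj : Function.Injective v) : ∑ i, τ i • v i = 0 := by
  obtain ⟨η, g, hr, -⟩ := h.exists_hasResidues hv hinj
  exact hr.sum_eq_zero

/-! ### Rigidity: deformations with constant cone angles -/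

theorem exists_eq_add_const {F : Type*} [NormedAddCommGroup F] [NormedSpace ℝ F] {O : Set E3}
    (hO : IsOpen O) (hc : IsPreconnected O) {f g : E3 → F} {η : E3 → E3 →L[ℝ] F}
    (hf : ∀ y ∈ O, HasFDerivAt f (η y) y) (hg : ∀ y ∈ O, HasFDerivAt g (η y) y) :
    ∃ C, ∀ y ∈ O, f y = g y + C := by
  have hd : ∀ y ∈ O, HasFDerivAt (fun z => f z - g z) (0 : E3 →L[ℝ] F) y := fun y hy => by
    simpa using (hf y hy).fun_sub (hg y hy)
  obtain ⟨C, hC⟩ := hO.exists_is_const_of_fderiv_eq_zero hc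
    (fun y hy => (hd y hy).differentiableAt.differentiableWithinAt) (fun y hy => (hd y hy).fderiv)
  exact ⟨C, fun y hy => by rw [← hC y hy]; abel⟩

/-- If the cone angles do not vary, the one-form of a deformation is globally exact. -/
theorem HasLocalForm.exists_curl {ι : Type*} [Fintype ι] {v : ι → E3} {H : E3 → E3 → E3 → ℝ}
    {η : E3 → E3 →L[ℝ] E3} {g : ι → E3 → E3} (hr : HasResidues v (fun _ => (0 : E3)) η g)
    (hreg : ∀ p, ‖p‖ = 1 → p ∉ range v → ∃ c X, 0 ≤ c ∧ c < 1 ∧ IsLocalField H X (capCone p c) ∧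
        ∀ y ∈ capCone p c, nrm y ∉ range v ∧ HasFDerivAt (halfCurl X) (η y) y) :
    ∃ κ : E3 → E3, ∀ y, y ≠ 0 → nrm y ∉ range v → HasFDerivAt κ (η y) y := by
  classical
  obtain ⟨q, hq, hqv⟩ := exists_unit_notMem_range v
  obtain ⟨K, hK⟩ := hr.exists_primitive hq
  have hK' : ∀ y, y ≠ 0 → nrm y ∉ range v → nrm y ≠ q →
      HasFDerivAt (fun z => K z + ∑ j, g j z) (η y) y := by
    intro y hy hyv hyq
    have hg : ∀ j, HasFDerivAt (g j) (fderiv ℝ (g j) y) y := fun j =>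
      ((hr.smooth j y hy fun h => hyv ⟨j, h.symm⟩).differentiableAt (by simp)).hasFDerivAt
    refine ((hK y hy hyv hyq).fun_add (HasFDerivAt.fun_sum fun j _ => hg j)).congr_fderiv ?_
    ext u : 1
    simp [residueForm]
  obtain ⟨c, X, hc0, hc1, -, hX⟩ := hreg q hq hqv
  obtain ⟨C, hC⟩ := exists_eq_add_const (isOpen_punctCone q c) (isPreconnected_punctCone hq hc0)
    (fun y hy => hK' y (ne_zero_of_mem_capCone hy.1) (hX y hy.1).1 (nrm_ne_of_inner_lt hq hy.2))
    (fun y hy => (hX y hy.1).2)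
  refine ⟨fun y => if y ∈ capCone q c then halfCurl X y + C else K y + ∑ j, g j y,
    fun y hy hyv => ?_⟩
  by_cases hyq : nrm y = q
  · have hmem : y ∈ capCone q c := by
      rw [← nrm_mem_capCone hy, hyq]; exact mem_capCone_self hq hc1
    refine ((hX y hmem).2.add_const C).congr_of_eventuallyEq
      (Filter.mem_of_superset ((isOpen_capCone q c).mem_nhds hmem) fun z hz => ?_)
    exact if_pos hz
  · have hlt := inner_lt_norm hq hy hyq
    have hev : ∀ᶠ z : E3 in 𝓝 y, ⟪q, z⟫ < ‖z‖ :=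
      ContinuousAt.eventually_lt (f := fun z : E3 => ⟪q, z⟫) (g := fun z => ‖z‖)
        (by fun_prop) (by fun_prop) hlt
    refine (hK' y hy hyv hyq).congr_of_eventuallyEq (hev.mono fun z hz => ?_)
    by_cases hzc : z ∈ capCone q c
    · exact (if_pos hzc).trans (hC z ⟨hzc, hz⟩).symm
    · exact if_neg hzc

/-- A deformation which does not vary the cone angles is generated by a global field, which is
continuous at the cone points. -/
theorem HasLocalForm.exists_field {ι : Type*} [Fintype ι] {v : ι → E3} {H : E3 → E3 → E3 → ℝ}
    (h : HasLocalForm v (fun _ => 0) H) (hv : ∀ i, ‖v i‖ = 1) (hinj : Function.Injective v) :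
    ∃ X : E3 → E3, ContinuousOn X S2 ∧ (∀ y, ⟪y, X y⟫ = 0) ∧ ∀ p, ‖p‖ = 1 → p ∉ range v →
      ∃ O ∈ 𝓝 p, IsLocalField H X O := by
  classical
  obtain ⟨η, g, hr, hreg, hcone⟩ := h.exists_hasResidues hv hinj
  simp only [zero_smul] at hr hcone
  obtain ⟨κ, hκ⟩ := HasLocalForm.exists_curl hr hreg
  have hcone' : ∀ i, ∃ c Y C, c < 1 ∧ Tendsto Y (𝓝[S2 \ {v i}] (v i)) (𝓝 0) ∧
      ∀ y ∈ punctCone (v i) c, nrm y ∉ range v ∧ cr (κ y) y = Y y + cr C y := by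
    intro i
    obtain ⟨c, Y, hc0, hc1, hY, ht, hYd⟩ := hcone i
    obtain ⟨C, hC⟩ := exists_eq_add_const (isOpen_punctCone (v i) c)
      (isPreconnected_punctCone (hv i) hc0)
      (fun y hy => hκ y (ne_zero_of_mem_capCone hy.1) (hYd y hy).1)
      (g := halfCurl Y) (fun y hy => by
        have h1 := (hYd y hy).2
        simp only [add_zero] at h1
        exact h1.congr_fderiv (by ext u : 1; simp))
    refine ⟨c, Y, C, hc1, ht, fun y hy => ⟨(hYd y hy).1, ?_⟩⟩
    rw [hC y hy, map_add, add_apply, hY.cr_halfCurl (isOpen_punctCone _ _) hy]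
  choose c Y C hc1 ht hYC using hcone'
  set X : E3 → E3 := fun y => if hy : ∃ i, v i = nrm y then cr (C hy.choose) y else cr (κ y) y
    with hXdef
  have hXreg : ∀ y, nrm y ∉ range v → X y = cr (κ y) y := fun y hy => dif_neg hy
  have hXv : ∀ i, X (v i) = cr (C i) (v i) := fun i => by
    have hex : ∃ j, v j = nrm (v i) := ⟨i, (nrm_of_norm_one (hv i)).symm⟩
    have : hex.choose = i := hinj (hex.choose_spec.trans (nrm_of_norm_one (hv i)))
    rw [hXdef]
    simp only [dif_pos hex, this]
  have hlocal : ∀ p, ‖p‖ = 1 → p ∉ range v → ∃ O ∈ 𝓝 p, IsLocalField H X O := by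
    intro p hp hpv
    obtain ⟨c, Z, hc0, hc1, hZ, hZd⟩ := hreg p hp hpv
    have hopen := isOpen_capCone p c
    obtain ⟨D, hD⟩ := exists_eq_add_const hopen (convex_capCone p hc0).isPreconnected
      (fun y hy => hκ y (ne_zero_of_mem_capCone hy) (hZd y hy).1) (fun y hy => (hZd y hy).2)
    have hX : ∀ y ∈ capCone p c, X y = Z y + cr D y := fun y hy => by
      rw [hXreg y (hZd y hy).1, hD y hy, map_add, add_apply, hZ.cr_halfCurl hopen hy]
    have hev : ∀ y ∈ capCone p c, X =ᶠ[𝓝 y] fun z => Z z + cr D z := fun y hy =>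
      Filter.mem_of_superset (hopen.mem_nhds hy) hX
    have hd : ∀ y ∈ capCone p c, fderiv ℝ X y = fderiv ℝ Z y + cr D := fun y hy => by
      rw [(hev y hy).fderiv_eq]
      exact (((hZ.smooth y hy).differentiableAt (by simp)).hasFDerivAt.add
        (cr D).hasFDerivAt).fderiv
    refine ⟨capCone p c, capCone_mem_nhds hp hc1, fun y hy => ?_, fun y hy => ?_, fun y hy => ?_,
      fun y hy u w => ?_⟩
    · exact ((hZ.smooth y hy).add (cr D).contDiff.contDiffAt).congr_of_eventuallyEq (hev y hy)
    · rw [hX y hy, inner_add_right, hZ.tangent y hy, inner_right_cr, add_zero]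
    · rw [hd y hy, hX y hy, add_apply, hZ.euler y hy]
    · rw [hd y hy, ← hZ.sym y hy]
      simp only [add_apply, inner_add_left, inner_add_right, inner_cr_skew D u w]
      ring
  refine ⟨X, fun x hx => ?_, fun y => ?_, hlocal⟩
  · by_cases hxv : x ∈ range v
    · obtain ⟨i, rfl⟩ := hxv
      rw [← continuousWithinAt_sdiff_self, ContinuousWithinAt, hXv]
      have h1 : Tendsto (fun y => Y i y + cr (C i) y) (𝓝[S2 \ {v i}] (v i))
          (𝓝 (0 + cr (C i) (v i))) :=
        (ht i).add ((cr (C i)).continuous.continuousWithinAt)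
      rw [zero_add] at h1
      refine h1.congr' ?_
      filter_upwards [self_mem_nhdsWithin,
        mem_nhdsWithin_of_mem_nhds (capCone_mem_nhds (hv i) (hc1 i))] with y hy hyc
      have hy1 := norm_one_of_mem hy.1
      have hyp := mem_punctCone_of_mem_capCone (hv i) hyc
        (by rw [nrm_of_norm_one hy1]; exact hy.2)
      rw [hXreg y (hYC i y hyp).1, (hYC i y hyp).2]
    · obtain ⟨O, hO, hXO⟩ := hlocal x (norm_one_of_mem hx) hxv
      exact (hXO.smooth x (mem_of_mem_nhds hO)).continuousAt.continuousWithinAt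
  · rw [hXdef]
    dsimp only
    split_ifs <;> exact inner_right_cr _ _

/-! ### First-order variation of a family of maps to the sphere -/

section Variation

variable {E F : Type*} [NormedAddCommGroup E] [NormedSpace ℝ E] [NormedAddCommGroup F]
  [NormedSpace ℝ F]

/-- The initial velocity of a family of maps parametrised by `[0, T]`. -/
def velocity (T : ℝ) (D : ℝ → E → F) (x : E) : F := derivWithin (fun t => D t x) (Icc 0 T) 0

/-- In a smooth family of maps on `[0, T] × W` the derivatives in time, at time zero, and in space
commute. -/
theorem family_derivatives {T : ℝ} (hT : 0 < T) {W : Set E} (hW : IsOpen W) {D : ℝ → E → F}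
    (hD : ContDiffOn ℝ ∞ (fun q : ℝ × E => D q.1 q.2) (Icc 0 T ×ˢ W)) :
    (∀ t ∈ Icc 0 T, ∀ x ∈ W, ContDiffAt ℝ ∞ (D t) x) ∧
    (∀ x ∈ W, ContDiffAt ℝ ∞ (velocity T D) x) ∧
    (∀ x ∈ W, HasDerivWithinAt (fun t => D t x) (velocity T D x) (Icc 0 T) 0) ∧
    ∀ x ∈ W, ∀ u, HasDerivWithinAt (fun t => fderiv ℝ (D t) x u) (fderiv ℝ (velocity T D) x u)
      (Icc 0 T) 0 := by
  set G : ℝ × E → F := fun q => D q.1 q.2 with hG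
  set S : Set (ℝ × E) := Icc 0 T ×ˢ W with hS
  have hu : UniqueDiffOn ℝ S := (uniqueDiffOn_Icc hT).prod hW.uniqueDiffOn
  have h0 : (0 : ℝ) ∈ Icc 0 T := ⟨le_rfl, hT.le⟩
  have hGd : ∀ q ∈ S, HasFDerivWithinAt G (fderivWithin ℝ G S q) S q := fun q hq =>
    ((hD q hq).differentiableWithinAt (by simp)).hasFDerivWithinAt
  have hG' : ContDiffOn ℝ ∞ (fderivWithin ℝ G S) S := hD.fderivWithin hu (by simp)
  have hG'd : ∀ q ∈ S, HasFDerivWithinAt (fderivWithin ℝ G S)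
      (fderivWithin ℝ (fderivWithin ℝ G S) S q) S q := fun q hq =>
    ((hG' q hq).differentiableWithinAt (by simp)).hasFDerivWithinAt
  have hx : ∀ t ∈ Icc 0 T, ∀ x ∈ W, HasFDerivAt (D t)
      ((fderivWithin ℝ G S (t, x)).comp (ContinuousLinearMap.inr ℝ ℝ E)) x := fun t ht x hx =>
    ((hGd (t, x) ⟨ht, hx⟩).comp (s := W) x (hasFDerivAt_prodMk_right t x).hasFDerivWithinAt
      (fun y hy => ⟨ht, hy⟩)).hasFDerivAt (hW.mem_nhds hx)
  have hin : ∀ x, HasDerivWithinAt (fun t : ℝ => (t, x)) ((1 : ℝ), (0 : E)) (Icc 0 T) 0 := fun x =>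
    (hasDerivWithinAt_id _ _).prodMk (hasDerivWithinAt_const _ _ x)
  have ht : ∀ x ∈ W, HasDerivWithinAt (fun t => D t x) (fderivWithin ℝ G S (0, x) (1, 0))
      (Icc 0 T) 0 := fun x hx => by
    have h1 : HasFDerivWithinAt G (fderivWithin ℝ G S (0, x)) S (0, x) := hGd (0, x) ⟨h0, hx⟩
    exact h1.comp_hasDerivWithinAt (t := S) 0 (hin x) (fun t ht => ⟨ht, hx⟩)
  have hvel : ∀ x ∈ W, velocity T D x = fderivWithin ℝ G S (0, x) (1, 0) := fun x hx =>
    (ht x hx).derivWithin (uniqueDiffOn_Icc hT 0 h0)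
  have hslice : ∀ t ∈ Icc 0 T, ContDiffOn ℝ ∞ (fun x : E => (t, x)) W := fun t _ =>
    contDiffOn_const.prodMk contDiffOn_id
  refine ⟨fun t ht x hx => ?_, fun x hx => ?_, fun x hx => ?_, fun x hxW u => ?_⟩
  · exact (hD.comp (hslice t ht) fun y hy => ⟨ht, hy⟩).contDiffAt (hW.mem_nhds hx)
  · have h1 : ContDiffOn ℝ ∞ (fun x => fderivWithin ℝ G S (0, x) (1, 0)) W :=
      (hG'.comp (hslice 0 h0) fun y hy => ⟨h0, hy⟩).clm_apply contDiffOn_const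
    exact (h1.congr hvel).contDiffAt (hW.mem_nhds hx)
  · rw [hvel x hx]; exact ht x hx
  · have h1 : HasDerivWithinAt (fun t => fderivWithin ℝ G S (t, x))
        (fderivWithin ℝ (fderivWithin ℝ G S) S (0, x) (1, 0)) (Icc 0 T) 0 :=
      (hG'd (0, x) ⟨h0, hxW⟩).comp_hasDerivWithinAt (t := S) 0 (hin x) (fun t ht => ⟨ht, hxW⟩)
    have h2 : HasDerivWithinAt (fun t => fderivWithin ℝ G S (t, x) (0, u))
        (fderivWithin ℝ (fderivWithin ℝ G S) S (0, x) (1, 0) (0, u)) (Icc 0 T) 0 := by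
      simpa using h1.clm_apply (hasDerivWithinAt_const (0 : ℝ) (Icc 0 T) ((0 : ℝ), u))
    have h3 : HasFDerivAt (fun y => fderivWithin ℝ G S (0, y) (1, 0)) _ x :=
      (((hG'd (0, x) ⟨h0, hxW⟩).comp (s := W) x (hasFDerivAt_prodMk_right (0 : ℝ) x).hasFDerivWithinAt
        (fun y hy => ⟨h0, hy⟩)).hasFDerivAt (hW.mem_nhds hxW)).clm_apply
          (hasFDerivAt_const ((1 : ℝ), (0 : E)) x)
    have h4 : velocity T D =ᶠ[𝓝 x] fun y => fderivWithin ℝ G S (0, y) (1, 0) :=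
      Filter.mem_of_superset (hW.mem_nhds hxW) hvel
    have hcl : ((0 : ℝ), x) ∈ closure (interior S) := by
      rw [hS, interior_prod_eq, closure_prod_eq, interior_Icc, closure_Ioo hT.ne, hW.interior_eq]
      exact ⟨h0, subset_closure hxW⟩
    have hsymm := (hD (0, x) ⟨h0, hxW⟩).isSymmSndFDerivWithinAt
      (by rw [minSmoothness_of_isRCLikeNormedField]; norm_cast) hu hcl ⟨h0, hxW⟩
    rw [h4.fderiv_eq, h3.fderiv]
    refine (h2.congr_deriv ?_).congr (fun t ht => ?_) ?_
    · rw [hsymm (1, 0) (0, u)]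
      simp
    · rw [(hx t ht x hxW).fderiv]; rfl
    · rw [(hx 0 h0 x hxW).fderiv]; rfl

end Variation

/-- The homogeneous extension, of degree one, of a map on the sphere. -/
def homExt (f : E3 → E3) (y : E3) : E3 := ‖y‖ • f (nrm y)

theorem hasFDerivAt_nrm {y : E3} (hy : y ≠ 0) : ∃ L : E3 →L[ℝ] E3, HasFDerivAt nrm L y ∧
    ∀ u, L u = ‖y‖⁻¹ • tanProj y u := by
  have hn := norm_ne_zero_iff.2 hy
  have h1 : HasFDerivAt nrm _ y :=
    ((hasDerivAt_inv hn).comp_hasFDerivAt y (hasFDerivAt_norm_E3 hy)).smul (hasFDerivAt_id y)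
  refine ⟨_, h1, fun u => ?_⟩
  simp only [add_apply, smul_apply, ContinuousLinearMap.smulRight_apply, tanProj, nrm,
    real_inner_smul_left, innerSL_apply_apply, Function.comp, smul_smul, smul_sub,
    ContinuousLinearMap.id_apply, smul_eq_mul]
  rw [sub_eq_add_neg, ← neg_smul]
  congr 2
  field_simp

theorem fderiv_homExt {f : E3 → E3} {y : E3} (hy : y ≠ 0) (hf : DifferentiableAt ℝ f (nrm y))
    (u : E3) : fderiv ℝ (homExt f) y u =
      fderiv ℝ f (nrm y) (tanProj y u) + ⟪nrm y, u⟫ • f (nrm y) := by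
  obtain ⟨L, hL, hLu⟩ := hasFDerivAt_nrm hy
  have h1 : HasFDerivAt (homExt f) _ y := (hasFDerivAt_norm_E3 hy).smul (hf.hasFDerivAt.comp y hL)
  have hn := norm_ne_zero_iff.2 hy
  rw [h1.fderiv]
  simp [hLu, smul_smul, mul_inv_cancel₀ hn, nrm, real_inner_smul_left]

theorem tanProj_self (y : E3) : tanProj y y = 0 := by
  rcases eq_or_ne y 0 with rfl | hy
  · simp [tanProj]
  · have hn := norm_ne_zero_iff.2 hy
    rw [tanProj, nrm, real_inner_smul_left, real_inner_self_eq_norm_sq, smul_smul]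
    have : ‖y‖⁻¹ * ‖y‖ ^ 2 * ‖y‖⁻¹ = 1 := by field_simp
    rw [this, one_smul, sub_self]

theorem inner_nrm_self {y : E3} : ⟪nrm y, y⟫ = ‖y‖ := by
  rcases eq_or_ne y 0 with rfl | hy
  · simp
  · have hn := norm_ne_zero_iff.2 hy
    rw [nrm, real_inner_smul_left, real_inner_self_eq_norm_sq]
    field_simp

theorem fderiv_homExt_self {f : E3 → E3} {y : E3} (hy : y ≠ 0) (hf : DifferentiableAt ℝ f (nrm y)) :
    fderiv ℝ (homExt f) y y = homExt f y := by
  rw [fderiv_homExt hy hf, tanProj_self, map_zero, zero_add, inner_nrm_self, homExt]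

theorem inner_eq_inner_tanProj {y : E3} (hy : y ≠ 0) (u w : E3) :
    ⟪u, w⟫ = ⟪tanProj y u, tanProj y w⟫ + ⟪nrm y, u⟫ * ⟪nrm y, w⟫ := by
  simp only [tanProj, inner_sub_left, inner_sub_right, real_inner_smul_left, inner_smul_right,
    real_inner_self_one (norm_nrm hy), real_inner_comm (nrm y) u]
  ring

/-- The open cone over a part of the sphere. -/
def coneOver (W : Set E3) : Set E3 := {y | y ≠ 0 ∧ nrm y ∈ W}

theorem continuousOn_nrm : ContinuousOn nrm {0}ᶜ := fun _ hy =>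
  (contDiffAt_nrm hy).continuousAt.continuousWithinAt

theorem isOpen_coneOver {W : Set E3} (hW : IsOpen W) : IsOpen (coneOver W) :=
  continuousOn_nrm.isOpen_inter_preimage isOpen_compl_singleton hW

theorem norm_homExt {f : E3 → E3} {W : Set E3} (hf : MapsTo f (W ∩ S2) S2) {y : E3}
    (hy : y ∈ coneOver W) : ‖homExt f y‖ = ‖y‖ := by
  rw [homExt, norm_smul, norm_norm, norm_one_of_mem (hf ⟨hy.2, nrm_mem_S2 hy.1⟩), mul_one]

theorem contDiffAt_homExt {f : E3 → E3} {y : E3} (hy : y ≠ 0) (hf : ContDiffAt ℝ ∞ f (nrm y)) :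
    ContDiffAt ℝ ∞ (homExt f) y :=
  (contDiffAt_norm ℝ hy).smul (hf.comp y (contDiffAt_nrm hy))

/-- The homogeneous extension of a map of the sphere pulls the Euclidean metric back to the
homogeneous extension of the pull-back of the round metric. -/
theorem inner_fderiv_homExt {f : E3 → E3} {W : Set E3} (hW : IsOpen W)
    (hfd : ∀ x ∈ W, ContDiffAt ℝ ∞ f x) (hf : MapsTo f (W ∩ S2) S2) {y : E3} (hy : y ∈ coneOver W)
    (u w : E3) : ⟪fderiv ℝ (homExt f) y u, fderiv ℝ (homExt f) y w⟫ =
      ⟪fderiv ℝ f (nrm y) (tanProj y u), fderiv ℝ f (nrm y) (tanProj y w)⟫ +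
        ⟪nrm y, u⟫ * ⟪nrm y, w⟫ := by
  have hd := (hfd _ hy.2).differentiableAt (by simp)
  have hperp : ∀ a, ⟪f (nrm y), fderiv ℝ f (nrm y) (tanProj y a)⟫ = 0 := by
    intro a
    have hx0 : nrm y ≠ 0 := ne_zero_of_norm_one (norm_nrm hy.1)
    have hxn : nrm (nrm y) = nrm y := nrm_of_norm_one (norm_nrm hy.1)
    have hx : nrm y ∈ coneOver W := ⟨hx0, by rw [hxn]; exact hy.2⟩
    have h1 := (contDiffAt_homExt hx0 (by rw [hxn]; exact hfd _ hy.2)).differentiableAt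
      (by simp) |>.hasFDerivAt
    have h2 : HasFDerivAt (fun z => ‖homExt f z‖ ^ 2) _ (nrm y) := h1.norm_sq
    have h3 : HasFDerivAt (fun z => ‖homExt f z‖ ^ 2) _ (nrm y) :=
      ((hasStrictFDerivAt_norm_sq (nrm y)).hasFDerivAt).congr_of_eventuallyEq
        (Filter.mem_of_superset ((isOpen_coneOver hW).mem_nhds hx) fun z hz => by
          simp only [mem_ofPred_eq, norm_homExt hf hz])
    have h4 := congrArg (fun L => L (tanProj y a)) (h2.unique h3)
    have h5 : tanProj (nrm y) (tanProj y a) = tanProj y a :=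
      tanProj_of_inner_eq_zero (norm_nrm hy.1) (inner_tanProj hy.1 a)
    have h6 : homExt f (nrm y) = f (nrm y) := by rw [homExt, norm_nrm hy.1, one_smul, hxn]
    simp only [smul_apply, ContinuousLinearMap.comp_apply, innerSL_apply_apply,
      inner_tanProj hy.1 a] at h4
    rw [fderiv_homExt hx0 (by rw [hxn]; exact hd), hxn, h5, h6, inner_tanProj hy.1 a] at h4
    simpa using h4
  have hff := real_inner_self_one (norm_one_of_mem (hf ⟨hy.2, nrm_mem_S2 hy.1⟩))
  rw [fderiv_homExt hy.1 hd, fderiv_homExt hy.1 hd]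
  simp only [inner_add_left, inner_add_right, real_inner_smul_left, inner_smul_right, hperp, hff,
    real_inner_comm (f (nrm y)) (fderiv ℝ f (nrm y) (tanProj y u))]
  ring

/-! ### Families of cone metrics generate local fields -/

theorem nhdsWithin_sphere_diff_neBot {p : E3} (hp : ‖p‖ = 1) : (𝓝[S2 \ {p}] p).NeBot := by
  rw [← mem_closure_iff_nhdsWithin_neBot, mem_closure_iff_nhds]
  intro t ht
  obtain ⟨c, hc0, hc1, hc⟩ := exists_capCone_subset hp (mem_nhdsWithin_of_mem_nhds ht : t ∈ 𝓝[S2] p)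
  obtain ⟨y, hy⟩ := exists_mem_punctCone hp hc0 hc1
  exact ⟨nrm y, hc y hy.1, nrm_mem_S2 (ne_zero_of_mem_capCone hy.1), nrm_ne_of_inner_lt hp hy.2⟩

theorem eventually_mem_punctCone {p : E3} (hp : ‖p‖ = 1) {c : ℝ} (hc : c < 1) :
    ∀ᶠ x in 𝓝[S2 \ {p}] p, x ∈ punctCone p c := by
  filter_upwards [self_mem_nhdsWithin, mem_nhdsWithin_of_mem_nhds (capCone_mem_nhds hp hc)]
    with y hy hyc
  exact mem_punctCone_of_mem_capCone hp hyc
    (by rw [nrm_of_norm_one (norm_one_of_mem hy.1)]; exact hy.2)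

/-- A family of maps to the sphere whose initial map is a local isometry starts, up to a linear
isometry `R`, at the identity, and the pull-backs of the round metric vary by the Lie derivative
along a local field. -/
theorem exists_generator {T : ℝ} (hT : 0 < T) {W : Set E3} (hW : IsOpen W) {D : ℝ → E3 → E3}
    (hD : ContDiffOn ℝ ∞ (fun q : ℝ × E3 => D q.1 q.2) (Icc 0 T ×ˢ W))
    (hmaps : ∀ t ∈ Icc 0 T, MapsTo (D t) (W ∩ S2) S2) {O : Set E3} (hO : IsOpen O)
    (hOc : IsPreconnected O) (hOne : O.Nonempty) (hOW : O ⊆ coneOver W)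
    (hiso : ∀ y ∈ O, ∀ u w, ⟪nrm y, u⟫ = 0 → ⟪nrm y, w⟫ = 0 →
      ⟪fderiv ℝ (D 0) (nrm y) u, fderiv ℝ (D 0) (nrm y) w⟫ = ⟪u, w⟫) :
    ∃ (R : E3 ≃ₗᵢ[ℝ] E3) (X : E3 → E3), (∀ y ∈ O, homExt (D 0) y = R y) ∧
      (∀ y ∈ O, R (X y) = homExt (velocity T D) y) ∧
      IsLocalField (fun y u w => ⟪fderiv ℝ X y u, w⟫ + ⟪u, fderiv ℝ X y w⟫) X O ∧
      ∀ y ∈ O, ∀ u w, HasDerivWithinAt (fun t => ⟪fderiv ℝ (D t) (nrm y) (tanProj y u),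
        fderiv ℝ (D t) (nrm y) (tanProj y w)⟫) (⟪fderiv ℝ X y u, w⟫ + ⟪u, fderiv ℝ X y w⟫)
        (Icc 0 T) 0 := by
  have h0 : (0 : ℝ) ∈ Icc 0 T := ⟨le_rfl, hT.le⟩
  obtain ⟨d1, d2, d3, d4⟩ := family_derivatives hT hW hD
  have hcone := isOpen_coneOver hW
  have hHs : ∀ t ∈ Icc 0 T, ∀ y ∈ coneOver W, ContDiffAt ℝ ∞ (homExt (D t)) y := fun t ht y hy =>
    contDiffAt_homExt hy.1 (d1 t ht _ hy.2)
  have hEs : ∀ y ∈ coneOver W, ContDiffAt ℝ ∞ (homExt (velocity T D)) y := fun y hy =>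
    contDiffAt_homExt hy.1 (d2 _ hy.2)
  have hiso' : ∀ y ∈ O, ∀ u w,
      ⟪fderiv ℝ (homExt (D 0)) y u, fderiv ℝ (homExt (D 0)) y w⟫ = ⟪u, w⟫ := by
    intro y hy u w
    have hy' := hOW hy
    rw [inner_fderiv_homExt hW (d1 0 h0) (hmaps 0 h0) hy',
      hiso y hy _ _ (inner_tanProj hy'.1 u) (inner_tanProj hy'.1 w), inner_eq_inner_tanProj hy'.1 u w]
  obtain ⟨R₀, hR₀⟩ : ∃ R₀, ∀ y ∈ O, fderiv ℝ (homExt (D 0)) y = R₀ :=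
    hO.exists_is_const_of_fderiv_eq_zero hOc
      (fun y hy => (differentiableAt_fderiv (hHs 0 h0 y (hOW hy))).differentiableWithinAt)
      (fun y hy => fderiv_fderiv_eq_zero_of_isometry (hHs 0 h0 y (hOW hy))
        (Filter.mem_of_superset (hO.mem_nhds hy) hiso'))
  obtain ⟨R, hR⟩ : ∃ R : E3 ≃ₗᵢ[ℝ] E3, ∀ u, R u = R₀ u := by
    obtain ⟨y, hy⟩ := hOne
    have hin : ∀ u w, ⟪R₀.toLinearMap u, R₀.toLinearMap w⟫ = ⟪u, w⟫ := fun u w => by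
      have := hiso' y hy u w
      rwa [hR₀ y hy] at this
    exact ⟨(R₀.toLinearMap.isometryOfInner hin).toLinearIsometryEquiv rfl, fun u => rfl⟩
  have hD0 : ∀ y ∈ O, homExt (D 0) y = R y := fun y hy => by
    rw [hR, ← hR₀ y hy, fderiv_homExt_self (hOW hy).1
      ((d1 0 h0 _ (hOW hy).2).differentiableAt (by simp))]
  set X : E3 → E3 := fun y => R.symm (homExt (velocity T D) y) with hX
  have hXd : ∀ y ∈ O, ∀ u, fderiv ℝ X y u = R.symm (fderiv ℝ (homExt (velocity T D)) y u) :=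
    fun y hy u => by
      have h1 := ((hEs y (hOW hy)).differentiableAt (by simp)).hasFDerivAt
      have h2 : HasFDerivAt X _ y :=
        (R.symm.toContinuousLinearEquiv.toContinuousLinearMap.hasFDerivAt).comp y h1
      rw [h2.fderiv]; rfl
  have hRX : ∀ y, R (X y) = homExt (velocity T D) y := fun y => R.apply_symm_apply _
  refine ⟨R, X, hD0, fun y _ => hRX y, ⟨fun y hy => ?_, fun y hy => ?_, fun y hy => ?_,
    fun y hy u w => rfl⟩, fun y hy u w => ?_⟩
  · exact R.symm.toContinuousLinearEquiv.toContinuousLinearMap.contDiff.contDiffAt.comp y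
      (hEs y (hOW hy))
  · rw [← R.inner_map_map, hRX, ← hD0 y hy]
    have hy' := hOW hy
    have h1 : HasDerivWithinAt (fun t => ‖homExt (D t) y‖ ^ 2) _ (Icc 0 T) 0 :=
      ((d3 _ hy'.2).fun_const_smul ‖y‖).norm_sq
    have h2 : HasDerivWithinAt (fun t => ‖homExt (D t) y‖ ^ 2) 0 (Icc 0 T) 0 :=
      (hasDerivWithinAt_const (0 : ℝ) (Icc 0 T) (‖y‖ ^ 2)).congr
        (fun t ht => by rw [norm_homExt (hmaps t ht) hy']) (by rw [norm_homExt (hmaps 0 h0) hy'])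
    have h3 := (uniqueDiffOn_Icc hT 0 h0).eq_deriv _ h1 h2
    have h4 : 2 * ⟪homExt (D 0) y, homExt (velocity T D) y⟫ = 0 := h3
    linarith
  · rw [hXd y hy, fderiv_homExt_self (hOW hy).1 ((d2 _ (hOW hy).2).differentiableAt (by simp))]
  · have hy' := hOW hy
    have hv : ∀ a, HasDerivWithinAt (fun t => fderiv ℝ (homExt (D t)) y a)
        (fderiv ℝ (homExt (velocity T D)) y a) (Icc 0 T) 0 := fun a => by
      have h1 := (d4 _ hy'.2 (tanProj y a)).add ((d3 _ hy'.2).fun_const_smul ⟪nrm y, a⟫)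
      rw [← fderiv_homExt hy'.1 ((d2 _ hy'.2).differentiableAt (by simp))] at h1
      exact h1.congr (fun t ht => fderiv_homExt hy'.1 ((d1 t ht _ hy'.2).differentiableAt (by simp)) a)
        (fderiv_homExt hy'.1 ((d1 0 h0 _ hy'.2).differentiableAt (by simp)) a)
    have h2 := ((hv u).inner ℝ (hv w)).sub_const (⟪nrm y, u⟫ * ⟪nrm y, w⟫)
    have h3 : ∀ t ∈ Icc 0 T, ⟪fderiv ℝ (D t) (nrm y) (tanProj y u),
        fderiv ℝ (D t) (nrm y) (tanProj y w)⟫ = ⟪fderiv ℝ (homExt (D t)) y u,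
          fderiv ℝ (homExt (D t)) y w⟫ - ⟪nrm y, u⟫ * ⟪nrm y, w⟫ := fun t ht => by
      rw [inner_fderiv_homExt hW (d1 t ht) (hmaps t ht) hy']; ring
    refine (h2.congr_deriv ?_).congr h3 (h3 0 h0)
    rw [hR₀ y hy, ← hR, ← hR, hXd y hy, hXd y hy, ← R.inner_map_map (R.symm _),
      ← R.inner_map_map u, R.apply_symm_apply, R.apply_symm_apply]
    ring

section Families

variable {ι : Type*} [Finite ι] {v : ι → E3} {U : Set E3} {T : ℝ} {θ : ι → ℝ → ℝ}
  {g : ℝ → E3 → E3 → E3 → ℝ}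

/-- A family of cone metrics is generated near a regular point by a local field. -/
theorem IsConeFamilyOn.exists_regular (hfam : IsConeFamilyOn U T v θ g) (hT : 0 < T)
    (hU : IsOpen U) (hround : StartsRound U v θ g) {p : E3} (hp : ‖p‖ = 1) (hpU : p ∈ U)
    (hpv : p ∉ range v) :
    ∃ c X, 0 ≤ c ∧ c < 1 ∧
      IsLocalField (fun y u w => ⟪fderiv ℝ X y u, w⟫ + ⟪u, fderiv ℝ X y w⟫) X (capCone p c) ∧
      ∀ y ∈ capCone p c, nrm y ∈ U ∧ nrm y ∉ range v ∧ ∀ u w,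
        HasDerivWithinAt (fun t => g t (nrm y) (tanProj y u) (tanProj y w))
          (⟪fderiv ℝ X y u, w⟫ + ⟪u, fderiv ℝ X y w⟫) (Icc 0 T) 0 := by
  have h0 : (0 : ℝ) ∈ Icc 0 T := ⟨le_rfl, hT.le⟩
  obtain ⟨W, D, hW, hpW, hD, hmaps, hg⟩ := hfam.regular p ⟨by simpa using hp, hpU⟩ hpv
  have hnhds : W ∩ U ∩ (range v)ᶜ ∈ 𝓝[S2] p := mem_nhdsWithin_of_mem_nhds
    (((hW.inter hU).inter (finite_range v).isClosed.isOpen_compl).mem_nhds ⟨⟨hpW, hpU⟩, hpv⟩)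
  obtain ⟨c, hc0, hc1, hc⟩ := exists_capCone_subset hp hnhds
  obtain ⟨R, X, -, -, hX, hXd⟩ := exists_generator hT hW hD hmaps (isOpen_capCone p c)
    (convex_capCone p hc0).isPreconnected ⟨p, mem_capCone_self hp hc1⟩
    (fun y hy => ⟨ne_zero_of_mem_capCone hy, (hc y hy).1.1⟩) (fun y hy u w hu hw => by
      have hx := nrm_mem_S2 (ne_zero_of_mem_capCone hy)
      rw [← hg 0 h0 _ ⟨(hc y hy).1.1, hx⟩ u w hu hw]
      exact hround.1 _ ⟨hx, (hc y hy).1.2⟩ (hc y hy).2 u w hu hw)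
  refine ⟨c, X, hc0, hc1, hX, fun y hy => ⟨(hc y hy).1.2, (hc y hy).2, fun u w => ?_⟩⟩
  have hy0 := ne_zero_of_mem_capCone hy
  have hgt := fun t ht => hg t ht (nrm y) ⟨(hc y hy).1.1, nrm_mem_S2 hy0⟩ _ _ (inner_tanProj hy0 u)
    (inner_tanProj hy0 w)
  exact (hXd y hy u w).congr hgt (hgt 0 h0)

theorem inner_mul_sub_eq {v x u w : E3} (hv : ‖v‖ = 1) (hx : ‖x‖ = 1) (hu : ⟪x, u⟫ = 0)
    (hw : ⟪x, w⟫ = 0) : ⟪u, w⟫ * (1 - ⟪v, x⟫ ^ 2) - ⟪v, u⟫ * ⟪v, w⟫ =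
      ⟪cr v x, u⟫ * ⟪cr v x, w⟫ := by
  have h : ⟪cr v x, u⟫ * ⟪cr v x, w⟫ = ⟪v, v⟫ * (⟪x, x⟫ * ⟪u, w⟫ - ⟪x, w⟫ * ⟪x, u⟫) -
      ⟪v, x⟫ * (⟪v, x⟫ * ⟪u, w⟫ - ⟪x, w⟫ * ⟪v, u⟫) +
      ⟪v, w⟫ * (⟪v, x⟫ * ⟪x, u⟫ - ⟪x, x⟫ * ⟪v, u⟫) := by
    simp only [inner_coord, cr_zero, cr_one, cr_two]; ring
  rw [h, hu, hw, real_inner_self_one hv, real_inner_self_one hx]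
  ring

/-- The variation of the cone metric is `1 / π` times the part of the round metric orthogonal to the
radial direction. -/
theorem coneTerm_eq {v y : E3} (hv : ‖v‖ = 1) (hlt : ⟪v, y⟫ ^ 2 < ‖y‖ ^ 2) (u w : E3) :
    Real.pi * coneTerm v y u w = ⟪tanProj y u, tanProj y w⟫ -
      ⟪v, tanProj y u⟫ * ⟪v, tanProj y w⟫ / (1 - ⟪v, nrm y⟫ ^ 2) := by
  have hy : y ≠ 0 := by rintro rfl; simp at hlt
  have hn := norm_pos_iff.2 hy
  have h1 := inner_mul_sub_eq hv (norm_nrm hy) (inner_tanProj hy u) (inner_tanProj hy w)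
  have h2 : ∀ a, ⟪cr v (nrm y), tanProj y a⟫ = ‖y‖⁻¹ * ⟪cr v y, a⟫ := fun a => by
    rw [tanProj, inner_sub_right, inner_smul_right, inner_cr_right, mul_zero, sub_zero, nrm, map_smul,
      real_inner_smul_left]
  have h3 : ⟪v, nrm y⟫ = ‖y‖⁻¹ * ⟪v, y⟫ := by rw [nrm, inner_smul_right]
  have h4 : ‖y‖ ^ 2 - ⟪v, y⟫ ^ 2 ≠ 0 := by linarith
  have h5 : 1 - ⟪v, nrm y⟫ ^ 2 = (‖y‖ ^ 2 - ⟪v, y⟫ ^ 2) / ‖y‖ ^ 2 := by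
    rw [h3]; field_simp
  have h6 : 1 - ⟪v, nrm y⟫ ^ 2 ≠ 0 := by rw [h5]; positivity
  have h7 : ⟪tanProj y u, tanProj y w⟫ - ⟪v, tanProj y u⟫ * ⟪v, tanProj y w⟫ / (1 - ⟪v, nrm y⟫ ^ 2) =
      (‖y‖⁻¹ * ⟪cr v y, u⟫) * (‖y‖⁻¹ * ⟪cr v y, w⟫) / (1 - ⟪v, nrm y⟫ ^ 2) := by
    rw [← h2, ← h2, ← h1]
    field_simp
  rw [h7, h5, coneTerm]
  field_simp

theorem coneMetric_eq (v : E3) (θ : ℝ) (x u w : E3) : coneMetric v θ x u w =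
    ⟪u, w⟫ + ((θ / (2 * Real.pi)) ^ 2 - 1) * (⟪u, w⟫ - ⟪v, u⟫ * ⟪v, w⟫ / (1 - ⟪v, x⟫ ^ 2)) := by
  rw [coneMetric]; ring

/-- A family of cone metrics is generated near a cone point by a local field tending to zero at the
cone point, and by the variation of the cone angle. -/
theorem IsConeFamilyOn.exists_cone (hfam : IsConeFamilyOn U T v θ g) (hT : 0 < T)
    (hU : IsOpen U) (hround : StartsRound U v θ g) (hv : ∀ i, ‖v i‖ = 1) {i : ι} (hi : v i ∈ U) :
    ∃ c X, 0 ≤ c ∧ c < 1 ∧ IsLocalField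
        (fun y u w => ⟪fderiv ℝ X y u, w⟫ + ⟪u, fderiv ℝ X y w⟫) X (punctCone (v i) c) ∧
      Tendsto X (𝓝[S2 \ {v i}] (v i)) (𝓝 0) ∧
      ∀ y ∈ punctCone (v i) c, nrm y ∈ U ∧ nrm y ∉ range v ∧ ∀ u w, ∃ G B : ℝ → ℝ,
        (∀ t ∈ Icc 0 T, g t (nrm y) (tanProj y u) (tanProj y w) =
          G t + ((θ i t / (2 * Real.pi)) ^ 2 - 1) * B t) ∧
        HasDerivWithinAt G (⟪fderiv ℝ X y u, w⟫ + ⟪u, fderiv ℝ X y w⟫) (Icc 0 T) 0 ∧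
        DifferentiableWithinAt ℝ B (Icc 0 T) 0 ∧ B 0 = Real.pi * coneTerm (v i) y u w := by
  have h0 : (0 : ℝ) ∈ Icc 0 T := ⟨le_rfl, hT.le⟩
  obtain ⟨-, W, φ, hW, hWv, hφ, hmaps, hlim, hg⟩ := hfam.cone i hi
  have hmaps' : ∀ t ∈ Icc 0 T, MapsTo (φ t) (W ∩ S2) S2 := fun t ht x hx => ((hmaps t ht).1 hx).1
  have hnhds : insert (v i) W ∩ U ∩ (range v \ {v i})ᶜ ∈ 𝓝[S2] (v i) := by
    refine inter_mem (inter_mem ?_ (mem_nhdsWithin_of_mem_nhds (hU.mem_nhds hi)))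
      (mem_nhdsWithin_of_mem_nhds (((finite_range v).sdiff).isClosed.isOpen_compl.mem_nhds (by simp)))
    rw [mem_nhdsWithin_iff_eventually] at hWv ⊢
    filter_upwards [hWv] with x hx hxS
    by_cases hxi : x = v i
    · exact Or.inl hxi
    · exact Or.inr (hx ⟨hxS, hxi⟩)
  obtain ⟨c, hc0, hc1, hc⟩ := exists_capCone_subset (hv i) hnhds
  have hW' : ∀ y ∈ punctCone (v i) c, nrm y ∈ W ∧ nrm y ∈ U ∧ nrm y ∉ range v := fun y hy => by
    have hne := nrm_ne_of_inner_lt (hv i) hy.2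
    obtain ⟨⟨h1, h2⟩, h3⟩ := hc y hy.1
    exact ⟨h1.resolve_left hne, h2, fun h => h3 ⟨h, hne⟩⟩
  have hne0 : ∀ y ∈ punctCone (v i) c, y ≠ 0 := fun y hy => ne_zero_of_mem_capCone hy.1
  obtain ⟨d1, d2, d3, d4⟩ := family_derivatives hT hW hφ
  obtain ⟨R, X, hR, hRX, hX, hXd⟩ := exists_generator hT hW hφ hmaps'
    (isOpen_punctCone (v i) c) (isPreconnected_punctCone (hv i) hc0)
    (exists_mem_punctCone (hv i) hc0 hc1) (fun y hy => ⟨hne0 y hy, (hW' y hy).1⟩)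
    (fun y hy u w hu hw => by
      have hx := nrm_mem_S2 (hne0 y hy)
      have h1 := hg 0 h0 _ ⟨(hW' y hy).1, hx⟩ u w hu hw
      rw [hround.1 _ ⟨hx, (hW' y hy).2.1⟩ (hW' y hy).2.2 u w hu hw, hround.2 i hi, coneMetric_eq,
        div_self (by positivity)] at h1
      rw [h1]; ring)
  -- Points of the sphere near `v i`, as points of `[0, T] × (W ∩ S2)` at time zero.
  have hpair : Tendsto (fun x : E3 => ((0 : ℝ), x)) (𝓝[S2 \ {v i}] (v i))
      (𝓝[Icc 0 T ×ˢ (W ∩ S2)] (0, v i)) := by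
    refine tendsto_nhdsWithin_iff.2 ⟨?_, ?_⟩
    · exact ((continuous_const.prodMk continuous_id).tendsto (v i)).mono_left nhdsWithin_le_nhds
    · filter_upwards [hWv, self_mem_nhdsWithin] with x hx hxS
      exact ⟨h0, hx, hxS.1⟩
  have hneBot := nhdsWithin_sphere_diff_neBot (hv i)
  have hx1 : ∀ᶠ x in 𝓝[S2 \ {v i}] (v i), x ∈ punctCone (v i) c ∧ ‖x‖ = 1 :=
    (eventually_mem_punctCone (hv i) hc1).and (by
      filter_upwards [self_mem_nhdsWithin] with x hx using norm_one_of_mem hx.1)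
  have hRv : R (v i) = v i := by
    have h1 : Tendsto (fun x => φ 0 x) (𝓝[S2 \ {v i}] (v i)) (𝓝 (v i)) := (hlim 0 h0).1.comp hpair
    have h2 : Tendsto (fun x => φ 0 x) (𝓝[S2 \ {v i}] (v i)) (𝓝 (R (v i))) := by
      refine ((R.continuous.tendsto (v i)).mono_left nhdsWithin_le_nhds).congr' ?_
      filter_upwards [hx1] with x hx
      rw [← hR x hx.1, homExt, hx.2, one_smul, nrm_of_norm_one hx.2]
    exact tendsto_nhds_unique h2 h1
  have hvR : ∀ u, ⟪v i, R u⟫ = ⟪v i, u⟫ := fun u => by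
    conv_lhs => rw [← hRv, R.inner_map_map]
  refine ⟨c, X, hc0, hc1, hX, ?_, fun y hy => ⟨(hW' y hy).2.1, (hW' y hy).2.2, fun u w => ?_⟩⟩
  · have h1 : Tendsto (fun x => velocity T φ x) (𝓝[S2 \ {v i}] (v i)) (𝓝 0) :=
      (hlim 0 h0).2.comp hpair
    have h2 := (R.symm.continuous.tendsto 0).comp h1
    rw [map_zero] at h2
    refine h2.congr' ?_
    filter_upwards [hx1] with x hx
    have h3 := hRX x hx.1
    rw [homExt, hx.2, one_smul, nrm_of_norm_one hx.2] at h3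
    rw [Function.comp, ← h3, R.symm_apply_apply]
  · have hy0 := hne0 y hy
    have hlt := inner_sq_lt_of_mem_punctCone hc0 hy
    have hWy := (hW' y hy).1
    refine ⟨_, fun t => ⟪fderiv ℝ (φ t) (nrm y) (tanProj y u), fderiv ℝ (φ t) (nrm y) (tanProj y w)⟫ -
      ⟪v i, fderiv ℝ (φ t) (nrm y) (tanProj y u)⟫ * ⟪v i, fderiv ℝ (φ t) (nrm y) (tanProj y w)⟫ /
        (1 - ⟪v i, φ t (nrm y)⟫ ^ 2), fun t ht => ?_, hXd y hy u w, ?_, ?_⟩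
    · rw [hg t ht _ ⟨hWy, nrm_mem_S2 hy0⟩ _ _ (inner_tanProj hy0 u) (inner_tanProj hy0 w),
        coneMetric_eq]
    all_goals
      have hφ0 : φ 0 (nrm y) = R (nrm y) := by
        have := hR y hy
        rw [homExt] at this
        rw [nrm, map_smul, ← this, smul_smul, inv_mul_cancel₀ (norm_ne_zero_iff.2 hy0), one_smul]
        rfl
      have hlt1 : 1 - ⟪v i, nrm y⟫ ^ 2 ≠ 0 := by
        have : ⟪v i, nrm y⟫ = ‖y‖⁻¹ * ⟪v i, y⟫ := by rw [nrm, inner_smul_right]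
        have hn := norm_pos_iff.2 hy0
        have h4 : ‖y‖ ^ 2 - ⟪v i, y⟫ ^ 2 ≠ 0 := by linarith
        have : 1 - ⟪v i, nrm y⟫ ^ 2 = (‖y‖ ^ 2 - ⟪v i, y⟫ ^ 2) / ‖y‖ ^ 2 := by
          rw [this]; field_simp
        rw [this]; positivity
    · have hu := (d4 _ hWy (tanProj y u)).differentiableWithinAt
      have hw := (d4 _ hWy (tanProj y w)).differentiableWithinAt
      have hx := (d3 _ hWy).differentiableWithinAt
      have hc := differentiableWithinAt_const (𝕜 := ℝ) (x := (0 : ℝ)) (s := Icc 0 T) (v i)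
      refine (hu.inner ℝ hw).sub (((hc.inner ℝ hu).mul (hc.inner ℝ hw)).div
        ((differentiableWithinAt_const 1).sub ((hc.inner ℝ hx).pow 2)) ?_)
      change 1 - ⟪v i, φ 0 (nrm y)⟫ ^ 2 ≠ 0
      rwa [hφ0, hvR]
    · have hfd : ∀ a, fderiv ℝ (φ 0) (nrm y) (tanProj y a) = R (tanProj y a) := fun a => by
        have h1 := fderiv_homExt hy0 ((d1 0 h0 _ hWy).differentiableAt (by simp)) (tanProj y a)
        rw [inner_tanProj hy0, zero_smul, add_zero] at h1
        have h2 : tanProj y (tanProj y a) = tanProj y a := by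
          conv_lhs => rw [tanProj, inner_tanProj hy0, zero_smul, sub_zero]
        have h3 : fderiv ℝ (homExt (φ 0)) y = R.toContinuousLinearEquiv.toContinuousLinearMap := by
          have h4 : homExt (φ 0) =ᶠ[𝓝 y] R.toContinuousLinearEquiv.toContinuousLinearMap :=
            Filter.mem_of_superset ((isOpen_punctCone (v i) c).mem_nhds hy) hR
          rw [h4.fderiv_eq, ContinuousLinearMap.fderiv]
        rw [h2, h3] at h1
        exact h1.symm
      rw [coneTerm_eq (hv i) hlt]
      simp only [hfd, hφ0, hvR, R.inner_map_map]

end Families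

/-! ### First-order deformations and their local form -/

section Deformations

variable {ι : Type*} {v : ι → E3}

/-- First-order deformations, extended radially to the cone over the sphere, are locally Lie
derivatives up to variations of the cone metric. -/
theorem IsFirstOrderConeDeformation.hasLocalForm [Finite ι] {τ : ι → ℝ} {h : E3 → E3 → E3 → ℝ}
    (hdef : IsFirstOrderConeDeformation v τ h) (hv : ∀ i, ‖v i‖ = 1) :
    HasLocalForm v τ (fun y u w => h (nrm y) (tanProj y u) (tanProj y w)) := by
  refine ⟨fun p hp hpv => ?_, fun i => ?_⟩
  · obtain ⟨U, T, θ, g, hU, hpU, hT, hfam, hround, -, hh⟩ := hdef p (by simpa using hp)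
    have h0 : (0 : ℝ) ∈ Icc 0 T := ⟨le_rfl, hT.le⟩
    obtain ⟨c, X, hc0, hc1, hX, hXd⟩ := hfam.exists_regular hT hU hround hp hpU hpv
    refine ⟨c, X, hc0, hc1, ⟨hX.smooth, hX.tangent, hX.euler, fun y hy u w => ?_⟩, fun j hj => ?_⟩
    · obtain ⟨h1, h2, h3⟩ := hXd y hy
      have hy0 := ne_zero_of_mem_capCone hy
      exact (uniqueDiffOn_Icc hT 0 h0).eq_deriv _ (h3 u w)
        (hh _ ⟨nrm_mem_S2 hy0, h1⟩ h2 _ _ (inner_tanProj hy0 u) (inner_tanProj hy0 w))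
    · exact (hXd _ hj).2.1 ⟨j, (nrm_of_norm_one (hv j)).symm⟩
  · obtain ⟨U, T, θ, g, hU, hpU, hT, hfam, hround, hθ, hh⟩ := hdef (v i) (by simp [hv])
    have h0 : (0 : ℝ) ∈ Icc 0 T := ⟨le_rfl, hT.le⟩
    obtain ⟨c, X, hc0, hc1, hX, hlim, hXd⟩ := hfam.exists_cone hT hU hround hv hpU
    refine ⟨c, X, hc0, hc1, ⟨hX.smooth, hX.tangent, hX.euler, fun y hy u w => ?_⟩, fun j hj => ?_,
      hlim⟩
    · obtain ⟨h1, h2, h3⟩ := hXd y hy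
      have hy0 := ne_zero_of_mem_capCone hy.1
      obtain ⟨G, B, hg, hG, hB, hB0⟩ := h3 u w
      have hpi := Real.pi_pos
      have hf : HasDerivWithinAt (fun t => (θ i t / (2 * Real.pi)) ^ 2 - 1) (τ i / Real.pi)
          (Icc 0 T) 0 := by
        have := (((hθ i hpU).div_const (2 * Real.pi)).pow 2).sub_const 1
        refine this.congr_deriv ?_
        rw [hround.2 i hpU]
        field_simp
        simp
      have hd := (hG.add (hf.mul hB.hasDerivWithinAt)).congr hg (hg 0 h0)
      have he := (uniqueDiffOn_Icc hT 0 h0).eq_deriv _ hd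
        (hh _ ⟨nrm_mem_S2 hy0, h1⟩ h2 _ _ (inner_tanProj hy0 u) (inner_tanProj hy0 w))
      rw [hround.2 i hpU, hB0, div_self (by positivity)] at he
      rw [← he]
      field_simp
      ring
    · exact (hXd _ hj).2.1 ⟨j, (nrm_of_norm_one (hv j)).symm⟩

/-- In a smooth family of cone metrics the cone angles are differentiable at time zero: they are
determined by the metric at a single regular point near the cone point. -/
theorem IsConeFamilyOn.differentiableWithinAt_angle [Finite ι] {U : Set E3} {T : ℝ}
    {θ : ι → ℝ → ℝ} {g : ℝ → E3 → E3 → E3 → ℝ} (hfam : IsConeFamilyOn U T v θ g) (hT : 0 < T)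
    (hU : IsOpen U) (hround : StartsRound U v θ g) (hv : ∀ i, ‖v i‖ = 1) {i : ι} (hi : v i ∈ U) :
    DifferentiableWithinAt ℝ (θ i) (Icc 0 T) 0 := by
  have h0 : (0 : ℝ) ∈ Icc 0 T := ⟨le_rfl, hT.le⟩
  obtain ⟨c, X, hc0, hc1, -, -, hXd⟩ := hfam.exists_cone hT hU hround hv hi
  obtain ⟨y, hy⟩ := exists_mem_punctCone (hv i) hc0 hc1
  obtain ⟨h1, h2, h3⟩ := hXd y hy
  have hy0 := ne_zero_of_mem_capCone hy.1
  have hlt := inner_sq_lt_of_mem_punctCone hc0 hy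
  -- The direction of rotation about `v i` sees the cone angle.
  set u := cr (v i) y
  obtain ⟨G, B, hg, hG, hB, hB0⟩ := h3 u u
  have huu : ⟪u, u⟫ = ‖y‖ ^ 2 - ⟪v i, y⟫ ^ 2 := by
    rw [inner_cr_cr, real_inner_self_one (hv i), real_inner_self_eq_norm_sq, real_inner_comm (v i) y]
    ring
  have hB0' : B 0 ≠ 0 := by
    have hpi := Real.pi_pos
    rw [hB0, coneTerm, huu]
    have : ‖y‖ ^ 2 - ⟪v i, y⟫ ^ 2 ≠ 0 := by linarith
    field_simp
    exact this
  obtain ⟨c', X', -, hc'1, -, hXd'⟩ := hfam.exists_regular hT hU hround (norm_nrm hy0) h1 h2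
  have hgd := (hXd' (nrm y) (mem_capCone_self (norm_nrm hy0) hc'1)).2.2 (tanProj y u) (tanProj y u)
  rw [nrm_of_norm_one (norm_nrm hy0),
    tanProj_of_inner_eq_zero (norm_nrm hy0) (inner_tanProj hy0 u)] at hgd
  have hθ0 := hround.2 i hi
  have hpi := Real.pi_pos
  have hev : ∀ᶠ t in 𝓝[Icc 0 T] 0, B t ≠ 0 := hB.continuousWithinAt.eventually_ne hB0'
  set q : ℝ → ℝ := fun t => 1 + (g t (nrm y) (tanProj y u) (tanProj y u) - G t) / B t
  have hq : DifferentiableWithinAt ℝ q (Icc 0 T) 0 :=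
    ((hgd.differentiableWithinAt.sub hG.differentiableWithinAt).div hB hB0').const_add 1
  have hqθ : ∀ t ∈ Icc 0 T, B t ≠ 0 → θ i t = 2 * Real.pi * √(q t) := by
    intro t ht hBt
    have hpos := (hfam.cone i hi).1 t ht
    have : q t = (θ i t / (2 * Real.pi)) ^ 2 := by
      simp only [q]
      rw [hg t ht]
      field_simp
      ring
    rw [this, Real.sqrt_sq (by positivity)]
    field_simp
  have hq0 : q 0 ≠ 0 := by
    intro h
    have := hqθ 0 h0 hB0'
    rw [h, Real.sqrt_zero, mul_zero, hθ0] at this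
    linarith
  refine ((hq.sqrt hq0).const_mul (2 * Real.pi)).congr_of_eventuallyEq ?_ (hqθ 0 h0 hB0')
  filter_upwards [hev, self_mem_nhdsWithin] with t ht htI using hqθ t htI ht

/-- A global family of cone metrics induces a first-order deformation. -/
theorem IsConeFamilyOn.exists_isFirstOrderConeDeformation [Finite ι] {T : ℝ} {θ : ι → ℝ → ℝ}
    {g : ℝ → E3 → E3 → E3 → ℝ} (hfam : IsConeFamilyOn univ T v θ g) (hT : 0 < T)
    (hround : StartsRound univ v θ g) (hv : ∀ i, ‖v i‖ = 1) :
    ∃ h, IsFirstOrderConeDeformation v (fun i => derivWithin (θ i) (Icc 0 T) 0) h := by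
  refine ⟨fun x u w => derivWithin (fun t => g t x u w) (Icc 0 T) 0, fun p _ =>
    ⟨univ, T, θ, g, isOpen_univ, mem_univ _, hT, hfam, hround, fun i hi =>
      (hfam.differentiableWithinAt_angle hT isOpen_univ hround hv hi).hasDerivWithinAt,
      fun x hx hxv u w hu hw => ?_⟩⟩
  have hx1 := norm_one_of_mem hx.1
  obtain ⟨c, X, -, hc1, -, hXd⟩ := hfam.exists_regular hT isOpen_univ hround hx1 hx.2 hxv
  have := (hXd x (mem_capCone_self hx1 hc1)).2.2 u w
  rw [nrm_of_norm_one hx1, tanProj_of_inner_eq_zero hx1 hu, tanProj_of_inner_eq_zero hx1 hw] at this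
  exact this.differentiableWithinAt.hasDerivWithinAt

/-- Two first-order deformations with the same variations of the cone angles differ by a trivial
one. -/
theorem IsFirstOrderConeDeformation.isTrivialDeformation_sub [Fintype ι] {τ : ι → ℝ}
    {h₁ h₂ : E3 → E3 → E3 → ℝ} (hdef₁ : IsFirstOrderConeDeformation v τ h₁)
    (hdef₂ : IsFirstOrderConeDeformation v τ h₂) (hv : ∀ i, ‖v i‖ = 1)
    (hinj : Function.Injective v) : IsTrivialDeformation v (h₁ - h₂) := by
  have h := (hdef₁.hasLocalForm hv).sub (hdef₂.hasLocalForm hv)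
  simp only [sub_self] at h
  obtain ⟨X, hXc, hXt, hXloc⟩ := h.exists_field hv hinj
  refine ⟨X, interior {y | ContDiffAt ℝ ∞ X y}, isOpen_interior, fun p hp => ?_, fun y hy => ?_, hXc,
    fun x _ => hXt x, fun x hx u w hu hw => ?_⟩
  · obtain ⟨O, hO, hX⟩ := hXloc p (norm_one_of_mem hp.1) hp.2
    exact mem_interior_iff_mem_nhds.2 (Filter.mem_of_superset hO hX.smooth)
  · have hy' : ContDiffAt ℝ ∞ X y := by simpa using interior_subset hy
    exact hy'.contDiffWithinAt
  · have hx1 := norm_one_of_mem hx.1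
    obtain ⟨O, hO, hX⟩ := hXloc x hx1 hx.2
    have := hX.sym x (mem_of_mem_nhds hO) u w
    rw [nrm_of_norm_one hx1, tanProj_of_inner_eq_zero hx1 hu, tanProj_of_inner_eq_zero hx1 hw] at this
    exact this.symm

end Deformations

/-! ### Deformations with prescribed variations of the cone angles -/

/-- The symmetric tensor generated by a field `y ↦ k y × y` of infinitesimal rotations whose axial
vector has derivative `L`. -/
def rotTensor (L : E3 →L[ℝ] E3) (y u w : E3) : ℝ := ⟪cr (L u) y, w⟫ + ⟪u, cr (L w) y⟫

theorem rotTensor_sub (L L' : E3 →L[ℝ] E3) (y u w : E3) :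
    rotTensor (L - L') y u w = rotTensor L y u w - rotTensor L' y u w := by
  simp only [rotTensor, sub_apply, map_sub, inner_sub_left, inner_sub_right]; ring

theorem hasFDerivAt_cr_self {k : E3 → E3} {L : E3 →L[ℝ] E3} {y : E3} (h : HasFDerivAt k L y) :
    HasFDerivAt (fun z => cr (k z) z) ((cr.flip y).comp L + cr (k y)) y := by
  refine ((cr.hasFDerivAt.comp y h).clm_apply (hasFDerivAt_id y)).congr_fderiv ?_
  ext u : 1
  simp [add_comm]

theorem sym_fderiv_cr_self {k : E3 → E3} {L : E3 →L[ℝ] E3} {y : E3} (h : HasFDerivAt k L y)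
    (u w : E3) : ⟪fderiv ℝ (fun z => cr (k z) z) y u, w⟫ + ⟪u, fderiv ℝ (fun z => cr (k z) z) y w⟫ =
      rotTensor L y u w := by
  rw [(hasFDerivAt_cr_self h).fderiv]
  simp only [add_apply, ContinuousLinearMap.comp_apply, ContinuousLinearMap.flip_apply,
    inner_add_left, inner_add_right, rotTensor, inner_cr_skew (k y) u w]
  ring

theorem rotTensor_azForm {v y : E3} (a : ℝ) (u w : E3) :
    rotTensor ((a / (2 * Real.pi)) • (azForm v y).smulRight v) y u w = a * coneTerm v y u w := by
  simp only [rotTensor, smul_apply, ContinuousLinearMap.smulRight_apply, map_smul, inner_smul_right,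
    real_inner_smul_left, azForm_apply, coneTerm, real_inner_comm (cr v y) u]
  have := Real.pi_pos
  rw [div_eq_mul_inv (⟪cr v y, u⟫ * ⟪cr v y, w⟫)]
  field_simp
  ring

/-- A smooth local field near `p`, cut off: it is smooth everywhere, unchanged near `p`, and zero
outside a prescribed neighbourhood of `p`. -/
theorem exists_cutoff_nhds {E F : Type*} [NormedAddCommGroup E] [InnerProductSpace ℝ E]
    [FiniteDimensional ℝ E] [NormedAddCommGroup F] [NormedSpace ℝ F]
    {p : E} {Y : E → F} (hY : ∀ᶠ y in 𝓝 p, ContDiffAt ℝ ∞ Y y) {U : Set E} (hU : U ∈ 𝓝 p) :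
    ∃ b : E → ℝ, (∀ y, ContDiffAt ℝ ∞ (fun z => b z • Y z) y) ∧ (∀ᶠ y in 𝓝 p, b y = 1) ∧
      ∀ y ∉ U, ∀ᶠ z in 𝓝 y, b z = 0 := by
  obtain ⟨r, hr, hball⟩ := Metric.eventually_nhds_iff_ball.1 (hY.and hU)
  let b : ContDiffBump p := ⟨r / 4, r / 2, by positivity, by linarith⟩
  have hzero : ∀ y ∉ Metric.ball p r, ∀ᶠ z in 𝓝 y, b z = 0 := by
    intro y hy
    have hy' : r / 2 < dist y p := by
      rw [Metric.mem_ball, not_lt] at hy; linarith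
    have : ∀ᶠ z in 𝓝 y, r / 2 < dist z p :=
      continuousAt_const.eventually_lt (by fun_prop) hy'
    exact this.mono fun z hz => b.zero_of_le_dist hz.le
  refine ⟨b, fun y => ?_, ?_, fun y hy => hzero y fun h => hy (hball y h).2⟩
  · by_cases hy : y ∈ Metric.ball p r
    · exact b.contDiff.contDiffAt.smul (hball y hy).1
    · refine (contDiffAt_const (c := (0 : F))).congr_of_eventuallyEq ((hzero y hy).mono fun z hz => ?_)
      dsimp only
      rw [hz, zero_smul]
  · exact Filter.mem_of_superset (Metric.ball_mem_nhds p (by positivity : 0 < r / 4)) fun z hz =>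
      b.one_of_mem_closedBall (Metric.ball_subset_closedBall hz)

section Existence

variable {ι : Type*} [Fintype ι] {v : ι → E3} {τ : ι → ℝ}

/-- The one-form on the sphere with residues `τ i • v i` at the points `v i`. It is closed if the
residues sum to zero. -/
def solutionForm (v : ι → E3) (τ : ι → ℝ) (y : E3) : E3 →L[ℝ] E3 :=
  ∑ j, (τ j / (4 * Real.pi)) • (areaPot (v j) y).smulRight (v j)

/-- Away from the cone points the solution form is locally exact if `∑ i, τ i • v i = 0`, since it
may then be written with the closed forms `areaPot (v j) - areaPot (-p)`. -/
theorem exists_primitive_solutionForm (hv : ∀ i, ‖v i‖ = 1) (hτ : ∑ i, τ i • v i = 0) {p : E3}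
    (hp : ‖p‖ = 1) (hpv : p ∉ range v) : ∃ k, IsPrimitiveNear k (solutionForm v τ) p := by
  have hp0 := ne_zero_of_norm_one hp
  have hk : ∀ j, ∃ k, IsPrimitiveNear k (fun z => areaPot (v j) z - areaPot (-p) z) p := fun j =>
    exists_primitive_areaPot_sub (hv j) (by rwa [norm_neg]) hp0
      (inner_lt_norm (hv j) hp0 (by rw [nrm_of_norm_one hp]; exact fun h => hpv ⟨j, h.symm⟩))
      (by rw [inner_neg_left, real_inner_self_one hp, hp]; norm_num)
  choose k hk using hk
  have hall := Filter.eventually_all.2 fun j => (hk j).smul_const (τ j / (4 * Real.pi)) (v j)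
  refine ⟨fun z => ∑ j, (τ j / (4 * Real.pi)) • k j z • v j, hall.mono fun z hz => ⟨?_, ?_⟩⟩
  · exact ContDiffAt.sum fun j _ => (hz j).1
  · refine (HasFDerivAt.fun_sum fun j _ => (hz j).2).congr_fderiv ?_
    ext u : 1
    have h0 : ∑ j, (τ j / (4 * Real.pi)) • areaPot (-p) z u • v j = 0 := by
      have : ∀ j, (τ j / (4 * Real.pi)) • areaPot (-p) z u • v j =
          (areaPot (-p) z u / (4 * Real.pi)) • τ j • v j := fun j => by
        rw [smul_smul, smul_smul]; congr 1; ring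
      simp only [this]
      rw [← Finset.smul_sum, hτ, smul_zero]
    simp only [solutionForm, sum_apply, smul_apply, ContinuousLinearMap.smulRight_apply, sub_apply,
      sub_smul, smul_sub, Finset.sum_sub_distrib, h0, sub_zero]

/-- Near a cone point the solution form is the sum of an exact form and of its singular part. -/
theorem exists_primitive_solutionForm_cone (hv : ∀ i, ‖v i‖ = 1) (hinj : Function.Injective v)
    (hτ : ∑ i, τ i • v i = 0) (i : ι) : ∃ k : E3 → E3, ∀ᶠ y in 𝓝 (v i), ContDiffAt ℝ ∞ k y ∧
      (nrm y ≠ v i → HasFDerivAt k (solutionForm v τ y -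
        (τ i / (2 * Real.pi)) • (azForm (v i) y).smulRight (v i)) y) := by
  classical
  have hp := hv i
  have hp0 := ne_zero_of_norm_one hp
  have hk : ∀ j, ∃ k, j ≠ i → IsPrimitiveNear k (fun z => areaPot (v j) z - areaPot (-v i) z) (v i) := by
    intro j
    by_cases hji : j = i
    · exact ⟨fun _ => 0, fun h => absurd hji h⟩
    obtain ⟨k, hk⟩ := exists_primitive_areaPot_sub (v' := -v i) (hv j) (by rwa [norm_neg]) hp0
      (inner_lt_norm (hv j) hp0 (by
        rw [nrm_of_norm_one hp]; exact fun h => hji (hinj h.symm)))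
      (by rw [inner_neg_left, real_inner_self_one hp, hp]; norm_num)
    exact ⟨k, fun _ => hk⟩
  choose k hk using hk
  have hall : ∀ᶠ z in 𝓝 (v i), ∀ j ∈ Finset.univ.erase i,
      ContDiffAt ℝ ∞ (fun z => (τ j / (4 * Real.pi)) • k j z • v j) z ∧
        HasFDerivAt (fun z => (τ j / (4 * Real.pi)) • k j z • v j)
          ((τ j / (4 * Real.pi)) • (areaPot (v j) z - areaPot (-v i) z).smulRight (v j)) z := by
    rw [Filter.eventually_all_finset]
    exact fun j hj => (hk j (Finset.mem_erase.1 hj).1).smul_const (τ j / (4 * Real.pi)) (v j)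
  have hpos : ∀ᶠ y : E3 in 𝓝 (v i), y ≠ 0 ∧ 0 < ⟪v i, y⟫ :=
    (eventually_ne_nhds hp0).and (ContinuousAt.eventually_lt (f := fun _ : E3 => (0 : ℝ))
      (g := fun z => ⟪v i, z⟫) (by fun_prop) (by fun_prop)
      (by rw [real_inner_self_one hp]; norm_num))
  refine ⟨fun z => ∑ j ∈ Finset.univ.erase i, (τ j / (4 * Real.pi)) • k j z • v j,
    (hall.and hpos).mono fun z hz => ⟨?_, fun hzi => ?_⟩⟩
  · exact ContDiffAt.sum fun j hj => (hz.1 j hj).1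
  · refine (HasFDerivAt.fun_sum fun j hj => (hz.1 j hj).2).congr_fderiv ?_
    have hlt := inner_lt_norm hp hz.2.1 hzi
    ext u : 1
    have h0 : ∑ j ∈ Finset.univ.erase i, (τ j / (4 * Real.pi)) • areaPot (-v i) z u • v j =
        -((τ i / (4 * Real.pi)) • areaPot (-v i) z u • v i) := by
      have : ∀ j, (τ j / (4 * Real.pi)) • areaPot (-v i) z u • v j =
          (areaPot (-v i) z u / (4 * Real.pi)) • τ j • v j := fun j => by
        rw [smul_smul, smul_smul]; congr 1; ring
      simp only [this]
      rw [← Finset.smul_sum, ← smul_neg]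
      congr 1
      rw [← Finset.add_sum_erase _ _ (Finset.mem_univ i)] at hτ
      exact (neg_eq_of_add_eq_zero_right hτ).symm
    rw [azForm_eq hz.2.1 hlt (by linarith [hz.2.2, norm_nonneg z]), solutionForm,
      ← Finset.add_sum_erase _ _ (Finset.mem_univ i)]
    have e1 : ∀ a, τ i / (2 * Real.pi) * (1 / 2 * a) = τ i / (4 * Real.pi) * a := fun a => by
      have := Real.pi_pos
      field_simp
      ring
    simp only [smul_smul] at h0
    simp only [sum_apply, smul_apply, ContinuousLinearMap.smulRight_apply, sub_apply, add_apply,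
      sub_smul, smul_sub, Finset.sum_sub_distrib, smul_smul, smul_eq_mul, h0, e1]
    abel

/-- If `∑ i, τ i • v i = 0` there is a tensor field that near `v i` is `τ i` times the variation of
the cone metric, and that elsewhere is locally a Lie derivative of the metric. It is the tensor of
the rotation fields `k y × y`, for `k` a local primitive of the solution form, corrected by a global
Lie derivative that removes near each `v i` the part of `k` which is smooth there. -/
theorem exists_local_solution (hv : ∀ i, ‖v i‖ = 1) (hinj : Function.Injective v)
    (hτ : ∑ i, τ i • v i = 0) : ∃ h : E3 → E3 → E3 → ℝ,
      (∀ p, ‖p‖ = 1 → p ∉ range v → ∃ X : E3 → E3, ∀ᶠ y in 𝓝 p, ContDiffAt ℝ ∞ X y ∧ ⟪y, X y⟫ = 0 ∧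
        ∀ u w, h y u w = ⟪fderiv ℝ X y u, w⟫ + ⟪u, fderiv ℝ X y w⟫) ∧
      ∀ i, ∀ᶠ y in 𝓝 (v i), nrm y ≠ v i → ∀ u w, h y u w = τ i * coneTerm (v i) y u w := by
  choose k hk using exists_primitive_solutionForm_cone hv hinj hτ
  have hcut : ∀ i, ∃ b : E3 → ℝ, (∀ y, ContDiffAt ℝ ∞ (fun z => b z • cr (k i z) z) y) ∧
      (∀ᶠ y in 𝓝 (v i), b y = 1) ∧ ∀ y ∉ {y | ∀ j, j ≠ i → y ≠ v j}, ∀ᶠ z in 𝓝 y, b z = 0 := by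
    intro i
    refine exists_cutoff_nhds ((hk i).mono fun y hy =>
      (cr.contDiff.contDiffAt.comp y hy.1).clm_apply contDiffAt_id) ?_
    have : ∀ᶠ y in 𝓝 (v i), ∀ j, j ≠ i → y ≠ v j := by
      rw [Filter.eventually_all]
      intro j
      by_cases hj : j = i
      · exact Filter.Eventually.of_forall fun y h => absurd hj h
      · exact (eventually_ne_nhds fun h => hj (hinj h.symm)).mono fun y hy _ => hy
    exact this
  choose b hb hb1 hb0 using hcut
  set Z : E3 → E3 := fun y => ∑ i, b i y • cr (k i y) y
  have hZs : ∀ y, ContDiffAt ℝ ∞ Z y := fun y => ContDiffAt.sum fun i _ => hb i y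
  have hZt : ∀ y, ⟪y, Z y⟫ = 0 := fun y => by
    simp only [Z, inner_sum, inner_smul_right, inner_right_cr, mul_zero, Finset.sum_const_zero]
  have hZv : ∀ i, Z =ᶠ[𝓝 (v i)] fun y => cr (k i y) y := by
    intro i
    have h1 : ∀ᶠ y in 𝓝 (v i), ∀ j, j ≠ i → b j y = 0 := by
      rw [Filter.eventually_all]
      intro j
      by_cases hj : j = i
      · exact Filter.Eventually.of_forall fun y h => absurd hj h
      · refine (hb0 j (v i) fun h => ?_).mono fun y hy _ => hy
        have h' : ∀ l, l ≠ j → v i ≠ v l := h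
        exact h' i (Ne.symm hj) rfl
    filter_upwards [h1, hb1 i] with y hy hyi
    simp only [Z]
    rw [Finset.sum_eq_single i (fun j _ hj => by rw [hy j hj, zero_smul]) (by simp), hyi, one_smul]
  refine ⟨fun y u w => rotTensor (solutionForm v τ y) y u w -
    (⟪fderiv ℝ Z y u, w⟫ + ⟪u, fderiv ℝ Z y w⟫), fun p hp hpv => ?_, fun i => ?_⟩
  · obtain ⟨k₀, hk₀⟩ := exists_primitive_solutionForm hv hτ hp hpv
    refine ⟨fun y => cr (k₀ y) y - Z y, hk₀.mono fun y hy => ⟨?_, ?_, fun u w => ?_⟩⟩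
    · exact ((cr.contDiff.contDiffAt.comp y hy.1).clm_apply contDiffAt_id).sub (hZs y)
    · rw [inner_sub_right, inner_right_cr, hZt, sub_zero]
    · change rotTensor (solutionForm v τ y) y u w -
        (⟪fderiv ℝ Z y u, w⟫ + ⟪u, fderiv ℝ Z y w⟫) = _
      rw [fderiv_fun_sub (hasFDerivAt_cr_self hy.2).differentiableAt
        ((hZs y).differentiableAt (by simp)), ← sym_fderiv_cr_self hy.2 u w]
      simp only [sub_apply, inner_sub_left, inner_sub_right]
      ring
  · filter_upwards [hk i, (hZv i).eventuallyEq_nhds] with y hy hZy hyi u w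
    rw [hZy.fderiv_eq, sym_fderiv_cr_self (hy.2 hyi) u w, rotTensor_sub, rotTensor_azForm]
    ring

end Existence

/-! ### First-order deformations of the round sphere from local data -/

section Realization

variable {ι : Type*} {v : ι → E3} {τ : ι → ℝ} {h : E3 → E3 → E3 → ℝ}

/-- The radial projection to the sphere of `y + t X(y)`, for a tangent field `X`: a family of maps
of the sphere with initial velocity `X`. -/
def projFlow (X : E3 → E3) (t : ℝ) (y : E3) : E3 := (√(1 + t ^ 2 * ‖X y‖ ^ 2))⁻¹ • (y + t • X y)

theorem projFlow_zero (X : E3 → E3) : projFlow X 0 = id := by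
  ext y : 1
  simp [projFlow]

theorem norm_projFlow {X : E3 → E3} {y : E3} (hy : ‖y‖ = 1) (hX : ⟪y, X y⟫ = 0) (t : ℝ) :
    ‖projFlow X t y‖ = 1 := by
  have h1 : ‖y + t • X y‖ ^ 2 = 1 + t ^ 2 * ‖X y‖ ^ 2 := by
    rw [norm_add_sq_real, inner_smul_right, hX, norm_smul, hy, mul_pow, Real.norm_eq_abs, sq_abs]
    ring
  have h2 : ‖y + t • X y‖ = √(1 + t ^ 2 * ‖X y‖ ^ 2) := by
    rw [← h1, Real.sqrt_sq (norm_nonneg _)]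
  have h3 : 0 < √(1 + t ^ 2 * ‖X y‖ ^ 2) := by positivity
  rw [projFlow, norm_smul, h2, norm_inv, Real.norm_of_nonneg h3.le, inv_mul_cancel₀ h3.ne']

theorem contDiffAt_projFlow {X : E3 → E3} {y : E3} (hX : ContDiffAt ℝ ∞ X y) (t : ℝ) :
    ContDiffAt ℝ ∞ (fun q : ℝ × E3 => projFlow X q.1 q.2) (t, y) := by
  have hX' : ContDiffAt ℝ ∞ (fun q : ℝ × E3 => X q.2) (t, y) :=
    ContDiffAt.comp (t, y) hX contDiffAt_snd
  have h1 : ContDiffAt ℝ ∞ (fun q : ℝ × E3 => 1 + q.1 ^ 2 * ‖X q.2‖ ^ 2) (t, y) :=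
    contDiffAt_const.add ((contDiffAt_fst.pow 2).mul (hX'.norm_sq ℝ))
  have h2 : 0 < 1 + t ^ 2 * ‖X y‖ ^ 2 := by positivity
  exact ((h1.sqrt h2.ne').inv (Real.sqrt_pos.2 h2).ne').smul
    (contDiffAt_snd.add (contDiffAt_fst.smul hX'))

theorem hasDerivAt_projFlow (X : E3 → E3) (y : E3) :
    HasDerivAt (fun t => projFlow X t y) (X y) 0 := by
  have h1 : HasDerivAt (fun t : ℝ => 1 + t ^ 2 * ‖X y‖ ^ 2) 0 0 := by
    simpa using (((hasDerivAt_id (0 : ℝ)).fun_pow 2).mul_const (‖X y‖ ^ 2)).const_add 1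
  have h2 : HasDerivAt (fun t : ℝ => (√(1 + t ^ 2 * ‖X y‖ ^ 2))⁻¹) 0 0 := by
    simpa using (h1.sqrt (by simp)).fun_inv (by simp)
  have h3 : HasDerivAt (fun t : ℝ => y + t • X y) (X y) 0 := by
    simpa using ((hasDerivAt_id (0 : ℝ)).smul_const (X y)).const_add y
  simpa [projFlow] using h2.fun_smul h3

theorem ne_zero_of_norm_sub_id_lt {A : E3 →L[ℝ] E3} (hA : ‖A - ContinuousLinearMap.id ℝ E3‖ < 1)
    {u : E3} (hu : u ≠ 0) : A u ≠ 0 := by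
  intro h0
  have h1 := (A - ContinuousLinearMap.id ℝ E3).le_opNorm u
  rw [sub_apply, h0, ContinuousLinearMap.id_apply, zero_sub, norm_neg] at h1
  nlinarith [norm_pos_iff.2 hu]

/-- Where `h` is a Lie derivative of the round metric, it is the derivative of a family of
pull-backs of the round metric. -/
theorem exists_coneFamily_of_field {p : E3} (hpv : ∀ᶠ y in 𝓝 p, y ∉ range v)
    {X : E3 → E3} (hX : ∀ᶠ y in 𝓝 p, ContDiffAt ℝ ∞ X y ∧ ⟪y, X y⟫ = 0 ∧
      ∀ u w, h y u w = ⟪fderiv ℝ X y u, w⟫ + ⟪u, fderiv ℝ X y w⟫) :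
    ∃ (U : Set E3) (T : ℝ) (θ : ι → ℝ → ℝ) (g : ℝ → E3 → E3 → E3 → ℝ),
    IsOpen U ∧ p ∈ U ∧ 0 < T ∧ IsConeFamilyOn U T v θ g ∧ StartsRound U v θ g ∧
      (∀ i, v i ∈ U → HasDerivWithinAt (θ i) (τ i) (Icc 0 T) 0) ∧
      ∀ x ∈ S2 ∩ U, x ∉ range v → ∀ u w, ⟪x, u⟫ = 0 → ⟪x, w⟫ = 0 →
        HasDerivWithinAt (fun t => g t x u w) (h x u w) (Icc 0 T) 0 := by
  set G : ℝ × E3 → E3 := fun q => projFlow X q.1 q.2 with hGdef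
  have hG : ContDiffAt ℝ ∞ G (0, p) := contDiffAt_projFlow hX.self_of_nhds.1 0
  have hpart : ∀ t x, ContDiffAt ℝ ∞ X x →
      fderiv ℝ (projFlow X t) x = (fderiv ℝ G (t, x)).comp (ContinuousLinearMap.inr ℝ ℝ E3) :=
    fun t x hx => (((contDiffAt_projFlow hx t).differentiableAt (by simp)).hasFDerivAt.comp x
      (hasFDerivAt_prodMk_right t x)).fderiv
  have hcont : ContinuousAt (fun q => ‖(fderiv ℝ G q).comp (ContinuousLinearMap.inr ℝ ℝ E3) -
      ContinuousLinearMap.id ℝ E3‖) (0, p) :=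
    (((hG.continuousAt_fderiv (by simp)).clm_comp continuousAt_const).sub continuousAt_const).norm
  -- Near time zero and `p` the maps are immersions, since their derivatives are close to the identity.
  have hlt : ∀ᶠ q in 𝓝 ((0 : ℝ), p), ‖(fderiv ℝ G q).comp (ContinuousLinearMap.inr ℝ ℝ E3) -
      ContinuousLinearMap.id ℝ E3‖ < 1 := by
    refine hcont.eventually_lt continuousAt_const ?_
    rw [← hpart 0 p hX.self_of_nhds.1, projFlow_zero, fderiv_id, sub_self, norm_zero]
    exact one_pos
  rw [nhds_prod_eq] at hlt
  obtain ⟨P, hP, Q, hQ, hPQ⟩ := Filter.eventually_prod_iff.1 hlt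
  obtain ⟨δ, hδ, hball⟩ := Metric.eventually_nhds_iff_ball.1 hP
  obtain ⟨U, hU, hUo, hpU⟩ := eventually_nhds_iff.1 ((hX.and hpv).and hQ)
  have hT : 0 < δ / 2 := by positivity
  have hPT : ∀ t ∈ Icc 0 (δ / 2), P t := fun t ht => hball t (by
    rw [Metric.mem_ball, Real.dist_eq, sub_zero, abs_of_nonneg ht.1]; linarith [ht.2])
  have hsm : ContDiffOn ℝ ∞ G (Icc 0 (δ / 2) ×ˢ U) := fun q hq =>
    (contDiffAt_projFlow (hU q.2 hq.2).1.1.1 q.1).contDiffWithinAt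
  refine ⟨U, δ / 2, fun i t => 2 * Real.pi + t * τ i, fun t x u w =>
    ⟪fderiv ℝ (projFlow X t) x u, fderiv ℝ (projFlow X t) x w⟫, hUo, hpU, hT, ⟨?_, ?_, ?_⟩, ⟨?_, ?_⟩,
    ?_, ?_⟩
  · rintro t ht x ⟨-, hx⟩ - u - hu
    refine real_inner_self_pos.2 (ne_zero_of_norm_sub_id_lt ?_ hu)
    rw [hpart t x (hU x hx).1.1.1]
    exact hPQ (hPT t ht) (hU x hx).2
  · rintro q ⟨-, hq⟩ -
    refine ⟨U, projFlow X, hUo, hq, hsm, fun t _ x hx => ?_, fun t _ x _ u w _ _ => rfl⟩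
    rw [mem_sphere_zero_iff_norm]
    exact norm_projFlow (norm_one_of_mem hx.2) (hU x hx.1).1.1.2.1 t
  · exact fun i hi => absurd ⟨i, rfl⟩ (hU _ hi).1.2
  · rintro x - - u w - -
    simp only [projFlow_zero, fderiv_id, ContinuousLinearMap.id_apply]
  · exact fun i hi => absurd ⟨i, rfl⟩ (hU _ hi).1.2
  · exact fun i hi => absurd ⟨i, rfl⟩ (hU _ hi).1.2
  · rintro x ⟨-, hx⟩ - u w - -
    obtain ⟨-, -, -, d4⟩ := family_derivatives hT hUo hsm
    have hvel : velocity (δ / 2) (projFlow X) = X := by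
      ext y : 1
      exact (hasDerivAt_projFlow X y).hasDerivWithinAt.derivWithin
        (uniqueDiffOn_Icc hT 0 ⟨le_rfl, hT.le⟩)
    have h1 := (d4 x hx u).inner ℝ (d4 x hx w)
    rw [hvel, projFlow_zero, fderiv_id] at h1
    refine h1.congr_deriv ?_
    rw [(hU x hx).1.1.2.2, add_comm]
    rfl

/-- The rotation by the angle `s` about the axis `v`. -/
def axisRot (v : E3) (s : ℝ) : E3 →L[ℝ] E3 :=
  Real.cos s • ContinuousLinearMap.id ℝ E3 + Real.sin s • cr v +
    (1 - Real.cos s) • (innerSL ℝ v).smulRight v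

theorem axisRot_apply (v : E3) (s : ℝ) (y : E3) : axisRot v s y =
    Real.cos s • y + Real.sin s • cr v y + (1 - Real.cos s) • ⟪v, y⟫ • v := rfl

theorem inner_axisRot {v : E3} (hv : ‖v‖ = 1) (s : ℝ) (u w : E3) :
    ⟪axisRot v s u, axisRot v s w⟫ = ⟪u, w⟫ := by
  have h1 : ⟪u, cr v w⟫ = -⟪cr v u, w⟫ := by linarith [inner_cr_skew v u w]
  simp only [axisRot_apply, inner_add_left, inner_add_right, inner_smul_right, real_inner_smul_left,
    inner_cr_cr, inner_cr_left, inner_left_cr, real_inner_self_one hv, real_inner_comm v u, h1]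
  linear_combination (⟪u, w⟫ - ⟪v, u⟫ * ⟪v, w⟫) * Real.cos_sq_add_sin_sq s

theorem hasDerivAt_axisRot {v : E3} (hv : ‖v‖ = 1) (s : ℝ) :
    HasDerivAt (axisRot v) ((axisRot v s).comp (cr v)) s := by
  have h1 := (((Real.hasDerivAt_cos s).smul_const (ContinuousLinearMap.id ℝ E3)).add
    ((Real.hasDerivAt_sin s).smul_const (cr v))).add
    (((Real.hasDerivAt_cos s).const_sub 1).smul_const ((innerSL ℝ v).smulRight v))
  refine h1.congr_deriv ?_
  ext y : 1
  simp only [add_apply, smul_apply, ContinuousLinearMap.comp_apply, axisRot_apply,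
    ContinuousLinearMap.id_apply, ContinuousLinearMap.smulRight_apply, innerSL_apply_apply, cr_cr,
    inner_left_cr, real_inner_self_one hv]
  module

theorem contDiff_axisRot (v : E3) : ContDiff ℝ ∞ (axisRot v) :=
  ((Real.contDiff_cos.smul contDiff_const).add (Real.contDiff_sin.smul contDiff_const)).add
    ((contDiff_const.sub Real.contDiff_cos).smul contDiff_const)

/-- The derivative of the map that rotates each point about `v` by `c` times its azimuth `k` around
`v`. This map multiplies azimuths by `1 + c`. -/
theorem fderiv_axisRot_azimuth {v : E3} (hv : ‖v‖ = 1) {k : E3 → ℝ} {y : E3} (c : ℝ)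
    (hk : HasFDerivAt k (azForm v y) y) (u : E3) :
    fderiv ℝ (fun z => axisRot v (c * k z) z) y u =
      axisRot v (c * k y) (u + (c * azForm v y u) • cr v y) := by
  have h1 := ((hasDerivAt_axisRot hv (c * k y)).hasFDerivAt.comp y (hk.const_mul c)).clm_apply
    (hasFDerivAt_id y)
  have h2 : HasFDerivAt (fun z => axisRot v (c * k z) z) _ y := h1
  rw [h2.fderiv]
  simp [mul_smul]

theorem one_sub_inner_sq_pos {v x : E3} (hv : ‖v‖ = 1) (hx : ‖x‖ = 1) (hxv : x ≠ v)
    (h0 : 0 < ⟪v, x⟫) : 0 < 1 - ⟪v, x⟫ ^ 2 := by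
  have h1 := inner_lt_norm hv (ne_zero_of_norm_one hx) (by rwa [nrm_of_norm_one hx])
  rw [hx] at h1
  nlinarith

theorem coneMetric_mul {v x u w : E3} (hv : ‖v‖ = 1) (hx : ‖x‖ = 1) (hS : 0 < 1 - ⟪v, x⟫ ^ 2)
    (hu : ⟪x, u⟫ = 0) (hw : ⟪x, w⟫ = 0) (c : ℝ) :
    coneMetric v (2 * Real.pi * (1 + c)) x u w =
      ⟪u, w⟫ + (2 * c + c ^ 2) * (⟪cr v x, u⟫ * ⟪cr v x, w⟫ / (1 - ⟪v, x⟫ ^ 2)) := by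
  have hpi := Real.pi_pos
  rw [coneMetric_eq, ← inner_mul_sub_eq hv hx hu hw]
  field_simp
  ring

/-- The map that multiplies azimuths about `v` by `1 + c` pulls the round metric back to the cone
metric of angle `2π (1 + c)`. -/
theorem inner_fderiv_axisRot_azimuth {v x u w : E3} (hv : ‖v‖ = 1) (hx : ‖x‖ = 1)
    (hS : 0 < 1 - ⟪v, x⟫ ^ 2) (hu : ⟪x, u⟫ = 0) (hw : ⟪x, w⟫ = 0) {k : E3 → ℝ} (c : ℝ)
    (hk : HasFDerivAt k (azForm v x) x) :
    ⟪fderiv ℝ (fun z => axisRot v (c * k z) z) x u, fderiv ℝ (fun z => axisRot v (c * k z) z) x w⟫ =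
      coneMetric v (2 * Real.pi * (1 + c)) x u w := by
  rw [fderiv_axisRot_azimuth hv c hk, fderiv_axisRot_azimuth hv c hk, inner_axisRot hv,
    coneMetric_mul hv hx hS hu hw]
  simp only [inner_add_left, inner_add_right, inner_smul_right, real_inner_smul_left, azForm_apply,
    inner_cr_cr, real_inner_self_one hv, real_inner_self_one hx, hx, real_inner_comm v x,
    real_inner_comm (cr v x) u]
  field_simp
  ring

theorem coneMetric_self_pos {v x u : E3} (hv : ‖v‖ = 1) (hx : ‖x‖ = 1) (hS : 0 < 1 - ⟪v, x⟫ ^ 2)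
    (hu : ⟪x, u⟫ = 0) (hu0 : u ≠ 0) {θ : ℝ} (hθ : 0 < θ) : 0 < coneMetric v θ x u u := by
  have hpi := Real.pi_pos
  have h1 := inner_mul_sub_eq hv hx hu hu
  have h2 : coneMetric v θ x u u = (⟪v, u⟫ * ⟪v, u⟫ + (θ / (2 * Real.pi)) ^ 2 *
      (⟪cr v x, u⟫ * ⟪cr v x, u⟫)) / (1 - ⟪v, x⟫ ^ 2) := by
    rw [coneMetric, ← h1]; field_simp
  have h3 : 0 < ⟪u, u⟫ * (1 - ⟪v, x⟫ ^ 2) := mul_pos (real_inner_self_pos.2 hu0) hS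
  have h4 : 0 < (θ / (2 * Real.pi)) ^ 2 := by positivity
  rw [h2]
  refine div_pos ?_ hS
  rcases (mul_self_nonneg ⟪v, u⟫).eq_or_lt with h0 | h0
  · rw [← h0, zero_add]
    exact mul_pos h4 (by linarith)
  · exact add_pos_of_pos_of_nonneg h0 (mul_nonneg h4.le (mul_self_nonneg _))

/-- `coneTerm` is the derivative of the cone metric in the cone angle, at the angle `2π`. -/
theorem hasDerivAt_coneMetric {v x u w : E3} (hv : ‖v‖ = 1) (hx : ‖x‖ = 1)
    (hS : 0 < 1 - ⟪v, x⟫ ^ 2) (hu : ⟪x, u⟫ = 0) (hw : ⟪x, w⟫ = 0) (a : ℝ) :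
    HasDerivAt (fun t => coneMetric v (2 * Real.pi * (1 + t * (a / (2 * Real.pi)))) x u w)
      (a * coneTerm v x u w) 0 := by
  simp only [coneMetric_mul hv hx hS hu hw]
  have h1 := (hasDerivAt_id (0 : ℝ)).mul_const (a / (2 * Real.pi))
  have h2 := (((h1.const_mul 2).fun_add (h1.fun_pow 2)).mul_const
    (⟪cr v x, u⟫ * ⟪cr v x, w⟫ / (1 - ⟪v, x⟫ ^ 2))).const_add ⟪u, w⟫
  refine h2.congr_deriv ?_
  have hpi := Real.pi_pos
  rw [coneTerm, hx]
  simp only [id]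
  field_simp
  ring

/-- Near a cone point, `τ i` times the variation of the cone metric is realized by the cone metrics
of angle `2π + t τ i`; away from the cone point these are pull-backs of the round metric by maps
that multiply the azimuth. -/
theorem exists_coneFamily_of_coneTerm (hv : ∀ i, ‖v i‖ = 1) {i : ι}
    (hvi : ∀ᶠ y in 𝓝 (v i), ∀ j, j ≠ i → y ≠ v j)
    (hh : ∀ᶠ y in 𝓝 (v i), nrm y ≠ v i → ∀ u w, h y u w = τ i * coneTerm (v i) y u w) :
    ∃ (U : Set E3) (T : ℝ) (θ : ι → ℝ → ℝ) (g : ℝ → E3 → E3 → E3 → ℝ),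
    IsOpen U ∧ v i ∈ U ∧ 0 < T ∧ IsConeFamilyOn U T v θ g ∧ StartsRound U v θ g ∧
      (∀ j, v j ∈ U → HasDerivWithinAt (θ j) (τ j) (Icc 0 T) 0) ∧
      ∀ x ∈ S2 ∩ U, x ∉ range v → ∀ u w, ⟪x, u⟫ = 0 → ⟪x, w⟫ = 0 →
        HasDerivWithinAt (fun t => g t x u w) (h x u w) (Icc 0 T) 0 := by
  have hpi := Real.pi_pos
  have hpos : ∀ᶠ y : E3 in 𝓝 (v i), 0 < ⟪v i, y⟫ :=
    ContinuousAt.eventually_lt (f := fun _ : E3 => (0 : ℝ)) (g := fun z => ⟪v i, z⟫)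
      (by fun_prop) (by fun_prop) (by rw [real_inner_self_one (hv i)]; norm_num)
  obtain ⟨U, hU, hUo, hiU⟩ := eventually_nhds_iff.1 ((hvi.and hh).and hpos)
  have hj : ∀ j, v j ∈ U → j = i := fun j hjU => by
    by_contra hne
    exact (hU _ hjU).1.1 j hne rfl
  have hS : ∀ x ∈ S2 ∩ U, x ≠ v i → 0 < 1 - ⟪v i, x⟫ ^ 2 := fun x hx hxi =>
    one_sub_inner_sq_pos (hv i) (norm_one_of_mem hx.1) hxi (hU x hx.2).2
  have hneg : ∀ x ∈ U, x ≠ -v i := fun x hx hxi => by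
    have := (hU x hx).2
    rw [hxi, inner_neg_right, real_inner_self_one (hv i)] at this
    linarith
  -- Up to this time the cone angle is at least `2π - 1`.
  set T : ℝ := 1 / (1 + |τ i|) with hTdef
  have hT : 0 < T := by positivity
  set θ : ι → ℝ → ℝ := fun j t => 2 * Real.pi * (1 + t * (τ j / (2 * Real.pi))) with hθdef
  have hθ : ∀ t ∈ Icc 0 T, 0 < θ i t := by
    intro t ht
    have e : θ i t = 2 * Real.pi + t * τ i := by simp only [hθdef]; field_simp
    have h1 : t * |τ i| ≤ 1 := by
      have := ht.2
      rw [hTdef, le_div_iff₀ (by positivity)] at this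
      linarith [ht.1]
    have h2 : -(t * |τ i|) ≤ t * τ i := by
      rw [← mul_neg]; exact mul_le_mul_of_nonneg_left (neg_abs_le _) ht.1
    rw [e]
    linarith [Real.pi_gt_three]
  refine ⟨U, T, θ, fun t => coneMetric (v i) (θ i t), hUo, hiU, hT, ⟨?_, ?_, ?_⟩, ⟨?_, ?_⟩, ?_, ?_⟩
  · intro t ht x hx hxv u hu hu0
    exact coneMetric_self_pos (hv i) (norm_one_of_mem hx.1) (hS x hx fun h => hxv ⟨i, h.symm⟩) hu hu0
      (hθ t ht)
  · intro p hp hpv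
    have hp1 := norm_one_of_mem hp.1
    obtain ⟨k, hk⟩ := exists_azimuth (v := v i) (y := p) (hv i) (by
      have := hS p hp fun h => hpv ⟨i, h.symm⟩
      rw [hp1]; linarith)
    obtain ⟨W, hW, hWo, hpW⟩ := eventually_nhds_iff.1
      ((hk.and (hUo.mem_nhds hp.2)).and (eventually_ne_nhds fun h => hpv ⟨i, h.symm⟩))
    refine ⟨W, fun t y => axisRot (v i) (t * (τ i / (2 * Real.pi)) * k y) y, hWo, hpW,
      fun q hq => ContDiffAt.contDiffWithinAt ?_, fun t _ x hx => ?_, fun t _ x hx u w hu hw => ?_⟩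
    · have h1 : ContDiffAt ℝ ∞ (fun q : ℝ × E3 => k q.2) q :=
        ContDiffAt.comp q (hW q.2 hq.2).1.1.1 contDiffAt_snd
      exact ((contDiff_axisRot (v i)).contDiffAt.comp q
        ((contDiffAt_fst.mul contDiffAt_const).mul h1)).clm_apply contDiffAt_snd
    · have hx1 := norm_one_of_mem hx.2
      rw [mem_sphere_zero_iff_norm, norm_eq_sqrt_real_inner, inner_axisRot (hv i),
        real_inner_self_one hx1, Real.sqrt_one]
    · obtain ⟨⟨hkx, hxU⟩, hxi⟩ := hW x hx.1
      exact (inner_fderiv_axisRot_azimuth (hv i) (norm_one_of_mem hx.2) (hS x ⟨hx.2, hxU⟩ hxi) hu hw _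
        hkx.2).symm
  · intro j hjU
    obtain rfl := hj j hjU
    refine ⟨hθ, U \ {v j}, fun _ y => y, hUo.sdiff isClosed_singleton, ?_, contDiffOn_snd,
      fun t _ => ⟨fun x hx => ⟨hx.2, ?_⟩, fun x _ y _ hxy => hxy⟩, fun t _ => ⟨?_, ?_⟩,
      fun t _ x _ u w _ _ => ?_⟩
    · filter_upwards [mem_nhdsWithin_of_mem_nhds (hUo.mem_nhds hiU), self_mem_nhdsWithin] with x hx hxS
      exact ⟨hx, hxS.2⟩
    · rintro (hxj | hxj)
      exacts [hx.1.2 hxj, hneg x hx.1.1 hxj]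
    · exact (continuous_snd.tendsto (t, v j)).mono_left nhdsWithin_le_nhds
    · have h0 : (fun q : ℝ × E3 => derivWithin (fun _ : ℝ => q.2) (Icc 0 T) q.1) = fun _ => 0 := by
        ext1 q
        rw [derivWithin_fun_const]
        rfl
      rw [h0]
      exact tendsto_const_nhds
    · simp only [fderiv_fun_id, ContinuousLinearMap.id_apply]
  · intro x hx hxv u w hu hw
    have := coneMetric_mul (hv i) (norm_one_of_mem hx.1) (hS x hx fun h => hxv ⟨i, h.symm⟩) hu hw 0
    simpa [hθdef] using this
  · intro j _
    simp [hθdef]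
  · intro j _
    have h1 := ((((hasDerivAt_id (0 : ℝ)).mul_const (τ j / (2 * Real.pi))).const_add 1).const_mul
      (2 * Real.pi)).hasDerivWithinAt (s := Icc 0 T)
    refine h1.congr_deriv ?_
    field_simp
  · intro x hx hxv u w hu hw
    have hx1 := norm_one_of_mem hx.1
    have hxi : x ≠ v i := fun h => hxv ⟨i, h.symm⟩
    rw [(hU x hx.2).1.2 (by rwa [nrm_of_norm_one hx1])]
    exact (hasDerivAt_coneMetric (hv i) hx1 (hS x hx hxi) hu hw (τ i)).hasDerivWithinAt

/-- Cone angle variations in balance are realized by a first-order deformation. -/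
theorem exists_isFirstOrderConeDeformation [Fintype ι] (hv : ∀ i, ‖v i‖ = 1)
    (hinj : Function.Injective v) (hτ : ∑ i, τ i • v i = 0) :
    ∃ h, IsFirstOrderConeDeformation v τ h := by
  obtain ⟨h, h1, h2⟩ := exists_local_solution hv hinj hτ
  refine ⟨h, fun p hp => ?_⟩
  by_cases hpv : p ∈ range v
  · obtain ⟨i, rfl⟩ := hpv
    refine exists_coneFamily_of_coneTerm hv ?_ (h2 i)
    rw [Filter.eventually_all]
    intro j
    by_cases hji : j = i
    · exact Filter.Eventually.of_forall fun y h => absurd hji h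
    · exact (eventually_ne_nhds fun h => hji (hinj h.symm)).mono fun y hy _ => hy
  · obtain ⟨X, hX⟩ := h1 p (norm_one_of_mem hp) hpv
    exact exists_coneFamily_of_field ((finite_range v).isClosed.isOpen_compl.mem_nhds hpv) hX

end Realization

end

theorem theorem1p13 (n : ℕ) (v : Fin n → E3) (hv : ∀ i, v i ∈ S2)
    (hinj : Function.Injective v) :
    (∀ (θ : Fin n → ℝ → ℝ) (g : ℝ → E3 → E3 → E3 → ℝ),
      IsConeFamilyOn univ 1 v θ g → StartsRound univ v θ g →
        (∀ i, DifferentiableWithinAt ℝ (θ i) (Icc 0 1) 0) ∧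
          ∑ i, derivWithin (θ i) (Icc 0 1) 0 • v i = 0) ∧
    (∀ τ : Fin n → ℝ, ∑ i, τ i • v i = 0 →
      (∃ h, IsFirstOrderConeDeformation v τ h) ∧
        ∀ h₁ h₂, IsFirstOrderConeDeformation v τ h₁ → IsFirstOrderConeDeformation v τ h₂ →
          IsTrivialDeformation v (h₁ - h₂)) := by
  have hv' : ∀ i, ‖v i‖ = 1 := fun i => norm_one_of_mem (hv i)
  refine ⟨fun θ g hfam hround => ⟨fun i => ?_, ?_⟩, fun τ hτ => ⟨?_, fun h₁ h₂ hd₁ hd₂ => ?_⟩⟩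
  · exact hfam.differentiableWithinAt_angle one_pos isOpen_univ hround hv' (mem_univ _)
  · obtain ⟨h, hh⟩ := hfam.exists_isFirstOrderConeDeformation one_pos hround hv'
    exact (hh.hasLocalForm hv').sum_smul_eq_zero hv' hinj
  · exact exists_isFirstOrderConeDeformation hv' hinj hτ
  · exact hd₁.isTrivialDeformation_sub hd₂ hv' hinj
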